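/- Let $G=PO(3)$ be the affine algebraic group over $\mathbb Q$ obtained from the orthogonal group $O(3)$ of the form $x^2+y^2+z^2$ by dividing out the scalar matrices. For a group $\Gamma$ let $\mathrm{Hom}(\Gamma,G)$ be the affine $\mathbb Q$-scheme whose $R$-points are the homomorphisms $\Gamma\to PO(3,R)$, on which $G$ acts by conjugation, and let $X(\Gamma,G)=\mathrm{Hom}(\Gamma,G)/\!/G=\operatorname{Spec}\,\mathcal O(\mathrm{Hom}(\Gamma,G))^G$ be the character scheme. For a Coxeter group $\Gamma$ with generators $g_v$, $v\in V$ ($V$ finite), relations $g_v^2=1$, and $(g_vg_w)^{m}=1$ for each edge $[v,w]$ of label $m$ of a labelled graph on $V$, an elementary subgroup is a finite subgroup generated by at most two of the $g_v$. Let $\mathrm{Hom}_o(\Gamma,G)\subset\mathrm{Hom}(\Gamma,G)$ be the open subscheme of the representations which are injective on every elementary subgroup, and let $X_o(\Gamma,G)$ be its image in $X(\Gamma,G)$. **Theorem.** Let $X$ be an affine scheme of finite type over $\mathbb Q$ and let $x\in X(\mathbb Q)$ be a rational point. Then there exist an open subscheme $X'\subset X$ containing $x$, a finitely generated Coxeter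 group $\Gamma$ all of whose edge labels are $2$ or $4$, and a representation $\rho_c:\Gamma\to PO(3,\mathbb R)$ with dense image, such that: 1. For every $\rho:\Gamma\to PO(3,\mathbb C)$ which is injective on all elementary subgroups, the centralizer of $\rho(\Gamma)$ in $PO(3,\mathbb C)$ is the center of $PO(3,\mathbb C)$, and $\rho$ is a stable point (its conjugation orbit is Zariski closed in $\mathrm{Hom}(\Gamma,PO(3,\mathbb C))$ and its stabilizer is finite); moreover $X_o(\Gamma,G)$ is open in $X(\Gamma,G)$, and is regarded as an open subscheme. 2. $X'$ is isomorphic, as a scheme over $\mathbb Q$, to an open subscheme $S\subset X_o(\Gamma,G)$, by an isomorphism under which $x$ corresponds to the class $[\rho_c]$ (as complex points). 3. The action of $G$ on $\mathrm{Hom}_o(\Gamma,G)$ has a cross-section $S_c$ containing $\rho_c$, i.e. a closed subscheme $S_c\subset\mathrm{Hom}_o(\Gamma,G)$ which the quotient morphism maps isomorphically onto $X_o(\Gamma,G)$. -/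

import Mathlib

open AlgebraicGeometry CategoryTheory
open scoped TensorProduct

noncomputable section

namespace KM

/-! ### The algebraic group `PO(3)` over `ℚ`, through its functor of points -/

section PO3

variable (R : Type*) [CommRing R]

/-- The `R`-points of the orthogonal group of the form `x² + y² + z²`. -/
abbrev O3 : Type _ := Matrix.orthogonalGroup (Fin 3) R

variable {R} in
theorem O3.mul_transpose (g : O3 R) :
    (g : Matrix (Fin 3) (Fin 3) R) * (g : Matrix (Fin 3) (Fin 3) R).transpose = 1 :=
  (Matrix.mem_orthogonalGroup_iff _ _).1 g.2

variable {R} in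
theorem O3.det_mul_det (g : O3 R) :
    (g : Matrix (Fin 3) (Fin 3) R).det * (g : Matrix (Fin 3) (Fin 3) R).det = 1 := by
  have := congrArg Matrix.det (O3.mul_transpose g)
  simpa using this

/-- The scalar matrices in the orthogonal group (over a field: `{1, -1}`). -/
def scalarO3 : Subgroup (O3 R) where
  carrier := {g | ∃ c : R, (g : Matrix (Fin 3) (Fin 3) R) = c • 1}
  one_mem' := ⟨1, by simp⟩
  mul_mem' := by
    rintro a b ⟨c, hc⟩ ⟨d, hd⟩
    exact ⟨c * d, by simp [hc, hd, smul_smul, mul_comm]⟩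
  inv_mem' := by
    rintro a ⟨c, hc⟩
    refine ⟨c, ?_⟩
    have h1 := O3.mul_transpose a
    have h2 : (a : Matrix (Fin 3) (Fin 3) R) * ((a⁻¹ : O3 R) : Matrix (Fin 3) (Fin 3) R) = 1 := by
      rw [← Submonoid.coe_mul]; simp
    have h3 : ((a⁻¹ : O3 R) : Matrix (Fin 3) (Fin 3) R) * (a : Matrix (Fin 3) (Fin 3) R) = 1 := by
      rw [← Submonoid.coe_mul]; simp
    have h4 := left_inv_eq_right_inv h3 h1
    rw [h4, hc]; simp

instance : (scalarO3 R).Normal where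
  conj_mem := by
    rintro a ⟨c, hc⟩ g
    refine ⟨c, ?_⟩
    have h2 : (g : Matrix (Fin 3) (Fin 3) R) * ((g⁻¹ : O3 R) : Matrix (Fin 3) (Fin 3) R) = 1 := by
      rw [← Submonoid.coe_mul]; simp
    rw [Submonoid.coe_mul, Submonoid.coe_mul, hc, Matrix.mul_smul, Matrix.mul_one, Matrix.smul_mul,
      h2]

/-- The `R`-points of `PO(3) = O(3) / {scalars}`. No sheafification is needed: every class
has exactly one representative of determinant one (`PO3.equivSO`), so this functor is represented
by an affine group scheme. For `R = ℝ` and `R = ℂ` these are the groups `PO(3, ℝ)`, `PO(3, ℂ)`. -/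
abbrev PO3 : Type _ := O3 R ⧸ scalarO3 R

variable {R} {S : Type*} [CommRing S]

/-- Entrywise base change of orthogonal matrices. -/
def O3.map (f : R →+* S) : O3 R →* O3 S where
  toFun g := ⟨(g : Matrix (Fin 3) (Fin 3) R).map f, (Matrix.mem_orthogonalGroup_iff _ _).2 (by
    rw [← Matrix.transpose_map, ← Matrix.map_mul, O3.mul_transpose g]
    simp [Matrix.map_one])⟩
  map_one' := Subtype.ext (by simp [Matrix.map_one])
  map_mul' a b := Subtype.ext (by simp [Matrix.map_mul])

/-- Base change `PO(3, R) → PO(3, S)`. -/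
def PO3.map (f : R →+* S) : PO3 R →* PO3 S :=
  QuotientGroup.map _ _ (O3.map f) (by
    rintro a ⟨c, hc⟩
    refine ⟨f c, ?_⟩
    change (a : Matrix (Fin 3) (Fin 3) R).map f = _
    rw [hc]
    ext i j
    by_cases h : i = j <;> simp [h])

/-- The homomorphism `O(3) → SO(3)`, `g ↦ det(g) g`. -/
def O3.toSO : O3 R →* Matrix.specialOrthogonalGroup (Fin 3) R where
  toFun g := ⟨(g : Matrix (Fin 3) (Fin 3) R).det • (g : Matrix (Fin 3) (Fin 3) R),
    Matrix.mem_specialOrthogonalGroup_iff.2 ⟨(Matrix.mem_orthogonalGroup_iff _ _).2 (by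
      rw [Matrix.transpose_smul, Matrix.smul_mul, Matrix.mul_smul, smul_smul, O3.mul_transpose g,
        O3.det_mul_det g, one_smul]), by
      rw [Matrix.det_smul, Fintype.card_fin]
      linear_combination ((g : Matrix (Fin 3) (Fin 3) R).det ^ 2 + 1) * O3.det_mul_det g⟩⟩
  map_one' := Subtype.ext (by simp)
  map_mul' a b := Subtype.ext (by
    simp [Matrix.det_mul, smul_smul, mul_comm])

/-- The canonical isomorphism `PO(3, R) ≃ SO(3, R)` of groups: the class of `g` goes to its
unique representative `det(g) g` of determinant one. -/
def PO3.equivSO : PO3 R ≃* Matrix.specialOrthogonalGroup (Fin 3) R :=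
  MulEquiv.ofBijective (QuotientGroup.lift (scalarO3 R) O3.toSO (by
    rintro a ⟨c, hc⟩
    have h := O3.det_mul_det a
    apply Subtype.ext
    change (a : Matrix (Fin 3) (Fin 3) R).det • (a : Matrix (Fin 3) (Fin 3) R) = 1
    have h1 := O3.mul_transpose a
    rw [hc] at h h1 ⊢
    have h2 := congrFun (congrFun h1 0) 0
    simp at h2
    rw [Matrix.det_smul, Fintype.card_fin, Matrix.det_one, smul_smul,
      show c ^ 3 * 1 * c = (c * c) * (c * c) by ring, h2]
    simp)) (by
    constructor
    · rw [injective_iff_map_eq_one]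
      intro a
      induction a using QuotientGroup.induction_on with
      | H g =>
        intro h
        rw [QuotientGroup.eq_one_iff]
        have h1 : (g : Matrix (Fin 3) (Fin 3) R).det • (g : Matrix (Fin 3) (Fin 3) R) = 1 :=
          congrArg Subtype.val h
        refine ⟨(g : Matrix (Fin 3) (Fin 3) R).det, ?_⟩
        rw [← h1, smul_smul, O3.det_mul_det, one_smul]
    · intro a
      have ha := Matrix.mem_specialOrthogonalGroup_iff.1 a.2
      refine ⟨QuotientGroup.mk ⟨a.1, ha.1⟩, Subtype.ext ?_⟩
      change (a.1).det • a.1 = a.1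
      rw [ha.2, one_smul])

theorem PO3.equivSO_map (f : R →+* S) (a : PO3 R) :
    (PO3.equivSO (PO3.map f a)).1 = (PO3.equivSO a).1.map f := by
  induction a using QuotientGroup.induction_on with
  | H g =>
    change ((g : Matrix (Fin 3) (Fin 3) R).map f).det • ((g : Matrix (Fin 3) (Fin 3) R).map f) =
      ((g : Matrix (Fin 3) (Fin 3) R).det • (g : Matrix (Fin 3) (Fin 3) R)).map f
    have : ((g : Matrix (Fin 3) (Fin 3) R).map f).det = f (g : Matrix (Fin 3) (Fin 3) R).det :=
      (RingHom.map_det f _).symm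
    rw [this]
    ext i j
    simp

end PO3

/-! ### The representation scheme `Hom(Γ, PO(3))` -/

section Rep

variable (Γ : Type) [Group Γ]

/-- The matrix of indeterminates attached to `γ`. -/
def genericMatrix (γ : Γ) : Matrix (Fin 3) (Fin 3) (MvPolynomial (Γ × Fin 3 × Fin 3) ℚ) :=
  Matrix.of fun i j => MvPolynomial.X (γ, i, j)

/-- The equations saying that the matrices attached to the elements of `Γ` are orthogonal of
determinant one and multiply as the elements of `Γ` do. -/
def repRelations : Set (MvPolynomial (Γ × Fin 3 × Fin 3) ℚ) :=
  {p | ∃ γ δ i j, p = (genericMatrix Γ (γ * δ) - genericMatrix Γ γ * genericMatrix Γ δ) i j} ∪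
  {p | ∃ γ i j, p = (genericMatrix Γ γ * (genericMatrix Γ γ).transpose - 1) i j} ∪
  {p | ∃ γ, p = (genericMatrix Γ γ).det - 1}

/-- The coordinate ring of the representation scheme `Hom(Γ, PO(3))` over `ℚ`, written with the
identification `PO(3) = SO(3)`. See `points` for the functor it represents. -/
def RepRing : Type := MvPolynomial (Γ × Fin 3 × Fin 3) ℚ ⧸ Ideal.span (repRelations Γ)

instance : CommRing (RepRing Γ) :=
  inferInstanceAs (CommRing (MvPolynomial (Γ × Fin 3 × Fin 3) ℚ ⧸ Ideal.span (repRelations Γ)))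

instance : Algebra ℚ (RepRing Γ) :=
  inferInstanceAs (Algebra ℚ (MvPolynomial (Γ × Fin 3 × Fin 3) ℚ ⧸ Ideal.span (repRelations Γ)))

/-- The projection from the polynomial ring. -/
def RepRing.mk : MvPolynomial (Γ × Fin 3 × Fin 3) ℚ →ₐ[ℚ] RepRing Γ :=
  Ideal.Quotient.mkₐ ℚ (Ideal.span (repRelations Γ))

theorem RepRing.mk_eq_zero {p : MvPolynomial (Γ × Fin 3 × Fin 3) ℚ} (hp : p ∈ repRelations Γ) :
    RepRing.mk Γ p = 0 :=
  Ideal.Quotient.eq_zero_iff_mem.2 (Ideal.subset_span hp)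

/-- The matrix of coordinate functions of `ρ(γ)`. -/
def univMatrix (γ : Γ) : Matrix (Fin 3) (Fin 3) (RepRing Γ) :=
  (genericMatrix Γ γ).map (RepRing.mk Γ)

theorem univMatrix_mul (γ δ : Γ) :
    univMatrix Γ (γ * δ) = univMatrix Γ γ * univMatrix Γ δ := by
  have h : ∀ i j, RepRing.mk Γ
      ((genericMatrix Γ (γ * δ) - genericMatrix Γ γ * genericMatrix Γ δ) i j) = 0 :=
    fun i j => RepRing.mk_eq_zero Γ (Or.inl (Or.inl ⟨γ, δ, i, j, rfl⟩))
  unfold univMatrix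
  rw [← Matrix.map_mul]
  ext i j
  simpa [sub_eq_zero] using h i j

theorem univMatrix_mem (γ : Γ) :
    univMatrix Γ γ ∈ Matrix.specialOrthogonalGroup (Fin 3) (RepRing Γ) := by
  rw [Matrix.mem_specialOrthogonalGroup_iff, Matrix.mem_orthogonalGroup_iff]
  constructor
  · have h : ∀ i j, RepRing.mk Γ
        ((genericMatrix Γ γ * (genericMatrix Γ γ).transpose - 1) i j) = 0 :=
      fun i j => RepRing.mk_eq_zero Γ (Or.inl (Or.inr ⟨γ, i, j, rfl⟩))
    unfold univMatrix
    rw [← Matrix.transpose_map, ← Matrix.map_mul,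
      ← Matrix.map_one (RepRing.mk Γ) (map_zero _) (map_one _)]
    ext i j
    simpa only [Matrix.sub_apply, map_sub, sub_eq_zero, Matrix.map_apply] using h i j
  · have h : RepRing.mk Γ ((genericMatrix Γ γ).det - 1) = 0 :=
      RepRing.mk_eq_zero Γ (Or.inr ⟨γ, rfl⟩)
    rw [map_sub, map_one, sub_eq_zero] at h
    rw [← h]
    exact (AlgHom.map_det (RepRing.mk Γ) (genericMatrix Γ γ)).symm

/-- The universal representation of `Γ` in `PO(3)`. -/
def univRep : Γ →* PO3 (RepRing Γ) :=
  MonoidHom.comp (PO3.equivSO.symm.toMonoidHom)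
    (MonoidHom.mk' (fun γ => (⟨univMatrix Γ γ, univMatrix_mem Γ γ⟩ :
      Matrix.specialOrthogonalGroup (Fin 3) (RepRing Γ)))
      (fun a b => Subtype.ext (univMatrix_mul Γ a b)))

variable {Γ} {R : Type*} [CommRing R] [Algebra ℚ R]

/-- The representation attached to a point of the representation scheme. -/
def repOf (φ : RepRing Γ →ₐ[ℚ] R) : Γ →* PO3 R :=
  (PO3.map (φ : RepRing Γ →+* R)).comp (univRep Γ)

theorem equivSO_repOf (φ : RepRing Γ →ₐ[ℚ] R) (γ : Γ) :
    (PO3.equivSO (repOf φ γ)).1 = (univMatrix Γ γ).map φ := by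
  have h : repOf φ γ = PO3.map (φ : RepRing Γ →+* R) (univRep Γ γ) := rfl
  rw [h, PO3.equivSO_map]
  have h2 : PO3.equivSO (univRep Γ γ) = ⟨univMatrix Γ γ, univMatrix_mem Γ γ⟩ := by
    simp [univRep]
  rw [h2]
  rfl

/-- The polynomial evaluation at a representation. -/
def evalRep (ρ : Γ →* PO3 R) : MvPolynomial (Γ × Fin 3 × Fin 3) ℚ →ₐ[ℚ] R :=
  MvPolynomial.aeval fun t => (PO3.equivSO (ρ t.1)).1 t.2.1 t.2.2

theorem genericMatrix_map_evalRep (ρ : Γ →* PO3 R) (γ : Γ) :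
    (genericMatrix Γ γ).map (evalRep ρ) = (PO3.equivSO (ρ γ)).1 := by
  ext i j
  simp [genericMatrix, evalRep]

/-- The point of the representation scheme attached to a representation. -/
def pointOf (ρ : Γ →* PO3 R) : RepRing Γ →ₐ[ℚ] R :=
  Ideal.Quotient.liftₐ (Ideal.span (repRelations Γ)) (evalRep ρ) (by
    have key : Ideal.span (repRelations Γ) ≤ RingHom.ker (evalRep ρ) := by
      rw [Ideal.span_le]
      have ho : ∀ γ, _ := fun γ =>
        Matrix.mem_specialOrthogonalGroup_iff.1 (PO3.equivSO (ρ γ)).2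
      rintro p ((⟨γ, δ, i, j, rfl⟩ | ⟨γ, i, j, rfl⟩) | ⟨γ, rfl⟩)
      · have h : (genericMatrix Γ (γ * δ) - genericMatrix Γ γ * genericMatrix Γ δ).map
            (evalRep ρ) = 0 := by
          rw [Matrix.map_sub (evalRep ρ) (map_sub _), Matrix.map_mul]
          simp only [genericMatrix_map_evalRep]
          simp
        exact congrFun (congrFun h i) j
      · have h : (genericMatrix Γ γ * (genericMatrix Γ γ).transpose - 1).map
            (evalRep ρ) = 0 := by
          rw [Matrix.map_sub (evalRep ρ) (map_sub _), Matrix.map_mul, Matrix.transpose_map,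
            Matrix.map_one (evalRep ρ) (map_zero _) (map_one _)]
          simp only [genericMatrix_map_evalRep]
          rw [(Matrix.mem_orthogonalGroup_iff _ _).1 (ho γ).1, sub_self]
        exact congrFun (congrFun h i) j
      · change evalRep ρ _ = 0
        rw [map_sub, map_one, sub_eq_zero]
        have h := AlgHom.map_det (evalRep ρ) (genericMatrix Γ γ)
        rw [h]
        change ((genericMatrix Γ γ).map (evalRep ρ)).det = 1
        rw [genericMatrix_map_evalRep]
        exact (ho γ).2
    exact fun a ha => key ha)

/-- The representation scheme represents `R ↦ Hom(Γ, PO(3, R))`. -/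
def points : (RepRing Γ →ₐ[ℚ] R) ≃ (Γ →* PO3 R) where
  toFun := repOf
  invFun := pointOf
  left_inv φ := by
    apply Ideal.Quotient.algHom_ext
    apply MvPolynomial.algHom_ext
    rintro ⟨γ, i, j⟩
    have h := congrFun (congrFun (equivSO_repOf φ γ) i) j
    change evalRep (repOf φ) (MvPolynomial.X (γ, i, j)) = φ (RepRing.mk Γ (MvPolynomial.X (γ, i, j)))
    simp only [evalRep, MvPolynomial.aeval_X]
    rw [h]
    rfl
  right_inv ρ := by
    ext γ
    apply PO3.equivSO.injective
    apply Subtype.ext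
    rw [equivSO_repOf]
    exact genericMatrix_map_evalRep ρ γ

/-- The conjugation action `(g, ρ) ↦ g ρ g⁻¹` on representations. -/
def conjRep {H : Type*} [Group H] (g : H) (ρ : Γ →* H) : Γ →* H :=
  (MulAut.conj g).toMonoidHom.comp ρ

variable (Γ)

/-- The ring of invariants: the regular functions on `Hom(Γ, PO(3))` that are constant along
the conjugation action of the group scheme `PO(3)`, tested on points in all `ℚ`-algebras. -/
def charRing : Subalgebra ℚ (RepRing Γ) where
  carrier := {a | ∀ (R : Type) [CommRing R] [Algebra ℚ R] (ρ : Γ →* PO3 R) (g : PO3 R),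
    pointOf (conjRep g ρ) a = pointOf ρ a}
  mul_mem' ha hb R _ _ ρ g := by rw [map_mul, map_mul, ha R ρ g, hb R ρ g]
  add_mem' ha hb R _ _ ρ g := by rw [map_add, map_add, ha R ρ g, hb R ρ g]
  algebraMap_mem' r R _ _ ρ g := by rw [AlgHom.commutes, AlgHom.commutes]

/-- The representation scheme `Hom(Γ, PO(3))`. -/
def homScheme : Scheme.{0} := Spec (CommRingCat.of (RepRing Γ))

/-- The character scheme `X(Γ, PO(3)) = Hom(Γ, PO(3)) // PO(3)`. -/
def charScheme : Scheme.{0} := Spec (CommRingCat.of (charRing Γ))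

/-- The quotient morphism `Hom(Γ, PO(3)) ⟶ X(Γ, PO(3))`. -/
def quotientMap : homScheme Γ ⟶ charScheme Γ :=
  Spec.map (CommRingCat.ofHom (charRing Γ).val.toRingHom)

/-- The structure morphism of the character scheme. -/
def charSchemeToSpec : charScheme Γ ⟶ Spec (CommRingCat.of ℚ) :=
  Spec.map (CommRingCat.ofHom (algebraMap ℚ (charRing Γ)))

variable {Γ}

/-- The `R`-point of `Hom(Γ, PO(3))` given by a representation over `R`. -/
def homPoint {R : Type} [CommRing R] [Algebra ℚ R] (ρ : Γ →* PO3 R) :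
    Spec (CommRingCat.of R) ⟶ homScheme Γ :=
  Spec.map (CommRingCat.ofHom (pointOf ρ).toRingHom)

/-- The complexification of a representation in `PO(3, ℝ)`. -/
def complexify (ρ : Γ →* PO3 ℝ) : Γ →* PO3 ℂ :=
  (PO3.map Complex.ofRealHom).comp ρ

/-- The set of representations over `ℂ` is the set of complex points of the representation
scheme; a complex polynomial function on it is an element of `ℂ ⊗ RepRing Γ`. -/
def complexEval (ρ : Γ →* PO3 ℂ) : ℂ ⊗[ℚ] RepRing Γ →ₐ[ℂ] ℂ :=
  Algebra.TensorProduct.lift (AlgHom.id ℂ ℂ) (pointOf ρ) (fun _ _ => Commute.all _ _)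

/-- Stable points: the orbit is Zariski closed in `Hom(Γ, PO(3, ℂ))` and the stabilizer (which is
the centralizer of the image) is finite. -/
def IsStable (ρ : Γ →* PO3 ℂ) : Prop :=
  (∃ E : Set (ℂ ⊗[ℚ] RepRing Γ), ∀ ρ' : Γ →* PO3 ℂ,
    (∃ g : PO3 ℂ, ρ' = conjRep g ρ) ↔ ∀ e ∈ E, complexEval ρ' e = 0) ∧
  Finite (Subgroup.centralizer (Set.range ρ))

end Rep

/-! ### Coxeter groups and the subschemes `Hom_o`, `X_o` -/

section Coxeter

variable {n : ℕ} (M : CoxeterMatrix (Fin n))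

/-- Elementary subgroups: finite parabolic subgroups of rank at most two. -/
def IsElementary (H : Subgroup M.Group) : Prop :=
  Finite H ∧ ∃ T : Finset (Fin n), T.card ≤ 2 ∧ H = Subgroup.closure (M.simple '' (T : Set (Fin n)))

/-- The homomorphism is injective on every elementary subgroup. -/
def InjOnElementary {G : Type*} [Group G] (ρ : M.Group →* G) : Prop :=
  ∀ H : Subgroup M.Group, IsElementary M H → Set.InjOn ρ H

/-- The representation over the residue field at a point of the representation scheme. -/
def repAt {Γ : Type} [Group Γ] (p : PrimeSpectrum (RepRing Γ)) :
    Γ →* PO3 p.asIdeal.ResidueField :=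
  repOf (IsScalarTower.toAlgHom ℚ (RepRing Γ) p.asIdeal.ResidueField)

theorem isOpen_repAt_ne_one {Γ : Type} [Group Γ] (γ : Γ) :
    IsOpen {p : PrimeSpectrum (RepRing Γ) | repAt p γ ≠ 1} := by
  have h : {p : PrimeSpectrum (RepRing Γ) | repAt p γ ≠ 1} =
      (PrimeSpectrum.zeroLocus
        {a | ∃ i j, a = (univMatrix Γ γ - 1) i j})ᶜ := by
    ext p
    simp only [Set.mem_ofPred_eq, Set.mem_compl_iff, PrimeSpectrum.mem_zeroLocus, ne_eq, not_iff_not]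
    have h1 : repAt p γ = 1 ↔
        (univMatrix Γ γ).map (algebraMap (RepRing Γ) p.asIdeal.ResidueField) = 1 := by
      rw [← PO3.equivSO.injective.eq_iff, map_one, Subtype.ext_iff]
      unfold repAt
      rw [equivSO_repOf]
      rfl
    rw [h1]
    have h3 : (univMatrix Γ γ).map (algebraMap (RepRing Γ) p.asIdeal.ResidueField) = 1 ↔
        ∀ i j, algebraMap (RepRing Γ) p.asIdeal.ResidueField ((univMatrix Γ γ - 1) i j) = 0 := by
      rw [← Matrix.map_one (algebraMap (RepRing Γ) p.asIdeal.ResidueField) (map_zero _)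
        (map_one _), ← Matrix.ext_iff]
      simp only [Matrix.map_apply, Matrix.sub_apply, map_sub, sub_eq_zero]
    rw [h3]
    simp only [Ideal.algebraMap_residueField_eq_zero]
    constructor
    · rintro h a ⟨i, j, rfl⟩
      exact h i j
    · intro h i j
      exact h ⟨i, j, rfl⟩
  rw [h]
  exact (PrimeSpectrum.isClosed_zeroLocus _).isOpen_compl

theorem isOpen_homO :
    IsOpen {p : PrimeSpectrum (RepRing M.Group) | InjOnElementary M (repAt p)} := by
  have h : {p : PrimeSpectrum (RepRing M.Group) | InjOnElementary M (repAt p)} =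
      ⋂ H ∈ {H : Subgroup M.Group | IsElementary M H}, ⋂ γ ∈ {γ : M.Group | γ ∈ H ∧ γ ≠ 1},
        {p | repAt p γ ≠ 1} := by
    ext p
    simp only [Set.mem_iInter, Set.mem_ofPred_eq]
    constructor
    · intro h H hH γ hγ h1
      exact hγ.2 (h H hH hγ.1 H.one_mem (by rw [h1, map_one]))
    · intro h H hH a ha b hb hab
      by_contra hne
      refine h H hH (a * b⁻¹) ⟨H.mul_mem ha (H.inv_mem hb), fun h1 => hne (mul_inv_eq_one.1 h1)⟩ ?_
      rw [map_mul, map_inv, hab, mul_inv_cancel]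
  rw [h]
  have hfin : {H : Subgroup M.Group | IsElementary M H}.Finite :=
    (Set.finite_range fun T : Finset (Fin n) =>
      Subgroup.closure (M.simple '' (T : Set (Fin n)))).subset (by
        rintro H ⟨-, T, -, rfl⟩
        exact ⟨T, rfl⟩)
  refine hfin.isOpen_biInter fun H hH => ?_
  have hH1 : (H : Set M.Group).Finite := Set.finite_coe_iff.1 hH.1
  exact (hH1.subset fun γ hγ => hγ.1).isOpen_biInter fun γ _ => isOpen_repAt_ne_one γ

/-- `Hom_o(Γ, PO(3))`: the open subscheme of the representation scheme whose points are the
representations that are injective on every elementary subgroup. -/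
def homO : (homScheme M.Group).Opens :=
  ⟨{p : PrimeSpectrum (RepRing M.Group) | InjOnElementary M (repAt p)}, isOpen_homO M⟩

/-- `X_o(Γ, PO(3))` as a subset: the projection of `Hom_o(Γ, PO(3))` to the character scheme. -/
def charOSet : Set (charScheme M.Group) :=
  quotientMap M.Group '' (homO M : Set (homScheme M.Group))

/-- The standing assumptions under which `X_o` is considered (besides evenness of the labels):
for every complex representation injective on the elementary subgroups, the centralizer of the
image is the center of `PO(3, ℂ)`, and the representation is a stable point. -/
def StandingAssumption : Prop :=
  ∀ ρ : M.Group →* PO3 ℂ, InjOnElementary M ρ →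
    Subgroup.centralizer (Set.range ρ) = Subgroup.center (PO3 ℂ) ∧ IsStable ρ

/-- A cross-section of the action of `PO(3)` on `Hom_o(Γ, PO(3))`: a closed subscheme of
`Hom_o(Γ, PO(3))` that the quotient morphism maps isomorphically onto `X_o(Γ, PO(3))`. -/
def IsCrossSection (Xo : (charScheme M.Group).Opens) {Z : Scheme.{0}}
    (ι : Z ⟶ (homO M).toScheme) : Prop :=
  IsClosedImmersion ι ∧
    ∃ e : Z ≅ Xo.toScheme, e.hom ≫ Xo.ι = ι ≫ (homO M).ι ≫ quotientMap M.Group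

end Coxeter

end KM

end

/-! Through PO(3) = SO(3) the theorem becomes one about half-turns. Over any ℚ-algebra the trace t
of an involution in SO(3) satisfies (t − 3)(t + 1) = 0, and an involution of trace −1 is 2P − 1 for
a symmetric idempotent P of trace one, that is, for a nondegenerate line. On the locus Hom_o, label
2 says that two axes are orthogonal, and label 4 that they meet at half a right angle, 2 tr(PQ) = 1.
Because the labels are even, injectivity on the elementary subgroups is tested by finitely many
involutions (`HasLabelsTwoFour.injOnElementary_iff`), so Hom_o is the clopen locus where an
invariant idempotent e (`elementaryIdem`) equals one.

Slice. Five of the generators are made to act as half-turns about three orthogonal axes and two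
bisectors. Over every coefficient ring exactly one rotation takes such a frame to the standard one
(`IsFrame.exists_rotation`, `eq_one_of_fixes_frame`). The representations with standard frame
therefore meet each orbit of Hom_o once, with trivial stabilizer, functorially in the ring. Applied
to the universal representation, this extends every function on the slice to an invariant, so the
functions on the slice are the localization at e of the ring of invariants
(`IsSlice.isLocalization`). The cross-section, the openness of X_o, stability and the triviality of
centralizers all follow.

Realization. In the style of von Staudt, sums and products of coordinates are computed from vectors
(1, p, 0) by cross products with frame vectors (`VecTerm.IsVec.exists_add`,
`VecTerm.IsVec.exists_mul`). Each subexpression gets a generator; label 2 makes the axis of a × b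
orthogonal to those of a and b, and an equation p = 0 becomes label 2 between (1, Np, 0) and the
second axis, N ≠ 0 clearing denominators. Where the cross products are nondegenerate these
orthogonalities determine all axes, so an open part of the slice is the nondegenerate locus of Spec
B (`Config.exists_openImmersion`). Each cross product used has a coordinate ±1, hence positive
squared length at rational points, and x lies in that locus.

Density. An expression with value (1, 2, 0) is added to the configuration. It yields a rotation of
angle arccos(−3/5), of infinite order by Niven's theorem; with its conjugate by a bisector half-turn
and Euler angles it gives a dense image (`denseRange_of_halfTurns`). -/

noncomputable section

namespace KM

/-! ### Half-turns in three-dimensional rotation groups over commutative rings -/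

section HalfTurns

open Matrix

variable {R : Type*} [CommRing R]

/-- The sum of the principal two-by-two minors. -/
def minorSum (N : Matrix (Fin 3) (Fin 3) R) : R :=
  N 0 0 * N 1 1 - N 0 1 * N 1 0 + (N 0 0 * N 2 2 - N 0 2 * N 2 0)
    + (N 1 1 * N 2 2 - N 1 2 * N 2 1)

/-- Cayley–Hamilton in size three. Having the adjugate as a polynomial in the matrix turns trace
conditions into matrix identities over an arbitrary ring, with no eigenvectors. -/
theorem adjugate_eq_three (N : Matrix (Fin 3) (Fin 3) R) :
    N.adjugate = N * N - N.trace • N + minorSum N • 1 := by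
  rw [adjugate_fin_three]
  ext i j
  fin_cases i <;> fin_cases j <;>
    simp [Matrix.mul_apply, Fin.sum_univ_three, trace_fin_three, minorSum] <;> ring

theorem two_mul_minorSum (N : Matrix (Fin 3) (Fin 3) R) :
    2 * minorSum N = N.trace * N.trace - (N * N).trace := by
  simp [Matrix.mul_apply, Fin.sum_univ_three, trace_fin_three, minorSum]
  ring

theorem trace_adjugate_three (N : Matrix (Fin 3) (Fin 3) R) :
    N.adjugate.trace = minorSum N := by
  rw [adjugate_fin_three]
  simp [trace_fin_three, minorSum]
  ring

theorem mul_transpose_of_mem {A : Matrix (Fin 3) (Fin 3) R}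
    (hA : A ∈ specialOrthogonalGroup (Fin 3) R) : A * Aᵀ = 1 :=
  (mem_orthogonalGroup_iff _ _).1 (mem_specialOrthogonalGroup_iff.1 hA).1

theorem transpose_mul_of_mem {A : Matrix (Fin 3) (Fin 3) R}
    (hA : A ∈ specialOrthogonalGroup (Fin 3) R) : Aᵀ * A = 1 :=
  mul_eq_one_comm.1 (mul_transpose_of_mem hA)

theorem det_of_mem {A : Matrix (Fin 3) (Fin 3) R}
    (hA : A ∈ specialOrthogonalGroup (Fin 3) R) : A.det = 1 :=
  (mem_specialOrthogonalGroup_iff.1 hA).2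

theorem mem_of_eqs {A : Matrix (Fin 3) (Fin 3) R} (h : A * Aᵀ = 1) (hd : A.det = 1) :
    A ∈ specialOrthogonalGroup (Fin 3) R :=
  mem_specialOrthogonalGroup_iff.2 ⟨(mem_orthogonalGroup_iff _ _).2 h, hd⟩

theorem adjugate_of_mem {A : Matrix (Fin 3) (Fin 3) R}
    (hA : A ∈ specialOrthogonalGroup (Fin 3) R) : A.adjugate = Aᵀ := by
  have h : A * A.adjugate = 1 := by rw [mul_adjugate, det_of_mem hA, one_smul]
  calc A.adjugate = (Aᵀ * A) * A.adjugate := by rw [transpose_mul_of_mem hA, one_mul]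
    _ = Aᵀ := by rw [mul_assoc, h, mul_one]

theorem minorSum_of_mem {A : Matrix (Fin 3) (Fin 3) R}
    (hA : A ∈ specialOrthogonalGroup (Fin 3) R) : minorSum A = A.trace := by
  rw [← trace_adjugate_three, adjugate_of_mem hA, trace_transpose]

theorem trace_mul_self_of_mem {A : Matrix (Fin 3) (Fin 3) R}
    (hA : A ∈ specialOrthogonalGroup (Fin 3) R) :
    (A * A).trace = A.trace * A.trace - 2 * A.trace := by
  have h := two_mul_minorSum A
  rw [minorSum_of_mem hA] at h
  linear_combination h

theorem transpose_eq_of_mem {A : Matrix (Fin 3) (Fin 3) R}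
    (hA : A ∈ specialOrthogonalGroup (Fin 3) R) :
    Aᵀ = A * A - A.trace • A + A.trace • 1 := by
  rw [← adjugate_of_mem hA, adjugate_eq_three, minorSum_of_mem hA]

theorem transpose_of_involution {A : Matrix (Fin 3) (Fin 3) R}
    (hA : A ∈ specialOrthogonalGroup (Fin 3) R) (h2 : A * A = 1) : Aᵀ = A := by
  calc Aᵀ = (A * A) * Aᵀ := by rw [h2, one_mul]
    _ = A := by rw [mul_assoc, mul_transpose_of_mem hA, mul_one]

/-- The trace of an involution is `3` or `-1`. -/
theorem trace_of_involution {A : Matrix (Fin 3) (Fin 3) R}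
    (hA : A ∈ specialOrthogonalGroup (Fin 3) R) (h2 : A * A = 1) :
    (A.trace - 3) * (A.trace + 1) = 0 := by
  have h := trace_mul_self_of_mem hA
  rw [h2, trace_one, Fintype.card_fin] at h
  push_cast at h
  linear_combination -h

variable [Algebra ℚ R]

theorem isUnit_ofNat_of_rat (n : ℕ) (hn : n ≠ 0) : IsUnit (n : R) := by
  have h : IsUnit (n : ℚ) := by simpa using hn
  simpa using h.map (algebraMap ℚ R)

theorem two_cancel {a b : R} (h : 2 * a = 2 * b) : a = b := by
  have := isUnit_ofNat_of_rat (R := R) 2 (by norm_num)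
  exact this.mul_left_cancel (by simpa using h)

/-- An involutive rotation is symmetric, so Cayley–Hamilton with trace 3 reads A = 1 − 3A + 3, that
is 4A = 4. -/
theorem eq_one_of_trace_three {A : Matrix (Fin 3) (Fin 3) R}
    (hA : A ∈ specialOrthogonalGroup (Fin 3) R) (h2 : A * A = 1) (ht : A.trace = 3) : A = 1 := by
  have h := transpose_eq_of_mem hA
  rw [transpose_of_involution hA h2, h2, ht] at h
  have h4 := isUnit_ofNat_of_rat (R := R) 4 (by norm_num)
  ext i j
  have h' := congrFun (congrFun h i) j
  simp only [Matrix.add_apply, Matrix.sub_apply, Matrix.smul_apply, smul_eq_mul] at h'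
  refine h4.mul_left_cancel ?_
  push_cast
  linear_combination h'

/-- Symmetric idempotents of trace one: orthogonal projections to nondegenerate lines. -/
structure IsLineProj (P : Matrix (Fin 3) (Fin 3) R) : Prop where
  symm : Pᵀ = P
  idem : P * P = P
  trace : P.trace = 1

/-- Rotations of order two with trace `-1`. -/
structure IsHalfTurn (A : Matrix (Fin 3) (Fin 3) R) : Prop where
  mem : A ∈ specialOrthogonalGroup (Fin 3) R
  sq : A * A = 1
  trace : A.trace = -1

theorem IsHalfTurn.exists_proj {A : Matrix (Fin 3) (Fin 3) R} (hA : IsHalfTurn A) :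
    ∃ P, IsLineProj P ∧ A = 2 * P - 1 := by
  have hs : (2 : Matrix (Fin 3) (Fin 3) R) * ((2⁻¹ : ℚ) • (A + 1)) = A + 1 := by
    rw [two_mul, ← add_smul]; norm_num
  refine ⟨(2⁻¹ : ℚ) • (A + 1), ⟨?_, ?_, ?_⟩, ?_⟩
  · rw [transpose_smul, transpose_add, transpose_of_involution hA.mem hA.sq, transpose_one]
  · rw [smul_mul_smul_comm, add_mul, mul_add, mul_add, hA.sq, mul_one, one_mul, mul_one,
      show (1 + A + (A + 1) : Matrix (Fin 3) (Fin 3) R) = (2 : ℚ) • (A + 1) by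
        rw [two_smul]; abel, smul_smul]
    norm_num
  · rw [trace_smul, trace_add, hA.trace, trace_one, Fintype.card_fin,
      show (-1 + ((3 : ℕ) : R)) = algebraMap ℚ R 2 by
        rw [map_ofNat]; norm_num, Algebra.smul_def, ← map_mul]
    norm_num
  · rw [hs]; abel

namespace IsLineProj

variable {P Q : Matrix (Fin 3) (Fin 3) R}

/-- From P² = P and tr P = 1, the sum of principal minors ((tr P)² − tr P²)/2 vanishes, and
Cayley–Hamilton leaves P² − P = 0 for the adjugate. -/
theorem adjugate (hP : IsLineProj P) : P.adjugate = 0 := by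
  have h2 : minorSum P = 0 := by
    apply two_cancel
    rw [two_mul_minorSum, hP.idem, hP.trace]; ring
  rw [adjugate_eq_three, hP.idem, hP.trace, h2]; simp

-- Rank one in the form valid over any ring: the two-by-two minors are the entries of the vanishing
-- adjugate, up to sign.
set_option maxHeartbeats 1000000 in
theorem minor (hP : IsLineProj P) (i j k l : Fin 3) : P i j * P k l = P i l * P k j := by
  have h := hP.adjugate
  rw [adjugate_fin_three] at h
  have e := fun a b => congrFun (congrFun h a) b
  have e00 := e 0 0
  have e01 := e 0 1
  have e02 := e 0 2
  have e10 := e 1 0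
  have e11 := e 1 1
  have e12 := e 1 2
  have e20 := e 2 0
  have e21 := e 2 1
  have e22 := e 2 2
  simp at e00 e01 e02 e10 e11 e12 e20 e21 e22
  clear e h
  fin_cases i <;> fin_cases k <;> fin_cases j <;> fin_cases l <;>
    simp only [Fin.zero_eta, Fin.mk_one, Fin.reduceFinMk] <;>
    first
    | ring1
    | linear_combination e00
    | linear_combination e01
    | linear_combination e02
    | linear_combination e10
    | linear_combination e11
    | linear_combination e12
    | linear_combination e20
    | linear_combination e21
    | linear_combination e22
    | linear_combination -e00
    | linear_combination -e01
    | linear_combination -e02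
    | linear_combination -e10
    | linear_combination -e11
    | linear_combination -e12
    | linear_combination -e20
    | linear_combination -e21
    | linear_combination -e22

theorem mul_mul_self (hP : IsLineProj P) (X : Matrix (Fin 3) (Fin 3) R) :
    P * X * P = (P * X).trace • P := by
  ext i l
  simp only [Matrix.mul_apply, Matrix.smul_apply, smul_eq_mul, Matrix.trace, diag_apply,
    Finset.sum_mul]
  refine Finset.sum_congr rfl fun k _ => Finset.sum_congr rfl fun j _ => ?_
  linear_combination X j k * hP.minor i j k l

end IsLineProj

/-- The minor sum vanishes too, so N · adj N = det N · 1 reduces to N = det N · 1; the trace then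
gives 3 det N = 0. This replaces a rank argument over rings that need not be reduced or connected.
-/
theorem eq_zero_of_idem_of_trace {N : Matrix (Fin 3) (Fin 3) R} (h : N * N = N)
    (ht : N.trace = 0) : N = 0 := by
  have h2 : minorSum N = 0 := by
    apply two_cancel
    rw [two_mul_minorSum, h, ht]; ring
  have h3 := mul_adjugate N
  rw [adjugate_eq_three, ht, h2, h] at h3
  simp only [zero_smul, sub_zero, add_zero, h] at h3
  have h4 : (3 : R) * N.det = 0 := by
    have := congrArg Matrix.trace h3
    rw [ht, trace_smul, trace_one] at this
    simpa [mul_comm] using this.symm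
  have h5 : N.det = 0 :=
    (isUnit_ofNat_of_rat (R := R) 3 (by norm_num)).mul_left_cancel (by simpa using h4)
  rw [h3, h5, zero_smul]

theorem IsLineProj.mul_eq_zero {P Q : Matrix (Fin 3) (Fin 3) R} (hP : IsLineProj P)
    (hQ : IsLineProj Q) (hc : P * Q = Q * P) (ht : (P * Q).trace = 0) : P * Q = 0 := by
  refine eq_zero_of_idem_of_trace ?_ ht
  calc P * Q * (P * Q) = P * (Q * P) * Q := by noncomm_ring
    _ = (P * P) * (Q * Q) := by rw [← hc]; noncomm_ring
    _ = P * Q := by rw [hP.idem, hQ.idem]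

end HalfTurns

/-! ### Axial vectors, and the labels 2 and 4 in terms of axes of half-turns -/

section Frames

set_option linter.unusedSectionVars false

open Matrix

variable {R : Type*} [CommRing R]

theorem det_two_mul_sub_one (N : Matrix (Fin 3) (Fin 3) R) :
    (2 * N - 1).det = 8 * N.det - 4 * minorSum N + 2 * N.trace - 1 := by
  rw [two_mul]
  simp [det_fin_three, minorSum, trace_fin_three]
  ring

/-- The axial vector of a three-by-three matrix. -/
def axial (K : Matrix (Fin 3) (Fin 3) R) : Fin 3 → R :=
  ![K 1 2 - K 2 1, K 2 0 - K 0 2, K 0 1 - K 1 0]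

theorem axial_vecMulVec (a b : Fin 3 → R) : axial (vecMulVec a b) = crossProduct a b := by
  ext i
  fin_cases i <;> simp [axial, vecMulVec_apply, cross_apply, mul_comm]

theorem axial_neg_transpose (K : Matrix (Fin 3) (Fin 3) R) : axial (-Kᵀ) = axial K := by
  ext i
  fin_cases i <;> simp [axial] <;> ring

/-- For every matrix g the axial vector transforms by the cofactor matrix, as cross products do; for
a rotation the cofactor matrix is g itself. -/
theorem axial_conj {g : Matrix (Fin 3) (Fin 3) R} (hg : g ∈ specialOrthogonalGroup (Fin 3) R)
    (K : Matrix (Fin 3) (Fin 3) R) : axial (g * K * gᵀ) = g *ᵥ axial K := by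
  have h : g = g.adjugateᵀ := by rw [adjugate_of_mem hg, transpose_transpose]
  have key : axial (g * K * gᵀ) = g.adjugateᵀ *ᵥ axial K := by
    rw [adjugate_fin_three]
    ext i
    fin_cases i <;>
      simp [axial, Matrix.mul_apply, Fin.sum_univ_three, mulVec, dotProduct] <;> ring
  rw [key, ← h]

/-- The hypothesis `hK` is what holds for K = abᵀ, P = aaᵀ, Q = bbᵀ; then the axial vector of K is a
× b, and its square is a polynomial in P and Q. The vectors a and b themselves need not exist over
the ring, which is why only their products enter. -/
theorem vecMulVec_axial {K P Q : Matrix (Fin 3) (Fin 3) R}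
    (hK : ∀ j k m n, K j k * K m n = P j m * Q k n) (hP : Pᵀ = P) (hQ : Qᵀ = Q)
    (tP : P.trace = 1) (tQ : Q.trace = 1) (hPQ : P * Q = 0) (hQP : Q * P = 0) :
    vecMulVec (axial K) (axial K) = 1 - P - Q := by
  have key : vecMulVec (axial K) (axial K) =
      (P * Q + Q * P - Q.trace • P - P.trace • Q
        + (P.trace * Q.trace - (P * Q).trace) • (1 : Matrix (Fin 3) (Fin 3) R))ᵀ := by
    ext i j
    fin_cases i <;> fin_cases j <;>
      simp [vecMulVec_apply, axial, sub_mul, mul_sub, hK, Matrix.mul_apply, Fin.sum_univ_three,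
        trace_fin_three] <;> ring
  rw [key, hPQ, hQP, tP, tQ]
  simp [hP, hQ, sub_eq_add_neg, add_comm, add_left_comm, add_assoc]

variable [Algebra ℚ R]

theorem IsLineProj.det {P : Matrix (Fin 3) (Fin 3) R} (hP : IsLineProj P) : P.det = 0 := by
  have h := mul_adjugate P
  rw [hP.adjugate, mul_zero] at h
  simpa using (congrFun (congrFun h 0) 0).symm

theorem IsLineProj.minorSum {P : Matrix (Fin 3) (Fin 3) R} (hP : IsLineProj P) :
    KM.minorSum P = 0 := by
  rw [← trace_adjugate_three, hP.adjugate, trace_zero]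

theorem IsLineProj.isHalfTurn {P : Matrix (Fin 3) (Fin 3) R} (hP : IsLineProj P) :
    IsHalfTurn (2 * P - 1) := by
  have hsq : (2 * P - 1) * (2 * P - 1) = 1 := by
    calc (2 * P - 1) * (2 * P - 1) = 4 * (P * P) - 4 * P + 1 := by noncomm_ring
      _ = 1 := by rw [hP.idem]; abel
  have htr : (2 * P - 1)ᵀ = 2 * P - 1 := by
    rw [two_mul, transpose_sub, transpose_add, hP.symm, transpose_one]
  refine ⟨mem_of_eqs (by rw [htr, hsq]) ?_, hsq, ?_⟩
  · rw [det_two_mul_sub_one, hP.det, hP.minorSum, hP.trace]; ring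
  · rw [two_mul, trace_sub, trace_add, hP.trace, trace_one, Fintype.card_fin]; norm_num

theorem IsLineProj.mul_comm_zero {P Q : Matrix (Fin 3) (Fin 3) R} (hP : IsLineProj P)
    (hQ : IsLineProj Q) (h : P * Q = 0) : Q * P = 0 := by
  have := congrArg transpose h
  rwa [transpose_mul, hP.symm, hQ.symm, transpose_zero] at this

theorem IsLineProj.trace_mul {P Q : Matrix (Fin 3) (Fin 3) R} (hP : IsLineProj P)
    (hQ : IsLineProj Q) : ((2 * P - 1) * (2 * Q - 1)).trace = 4 * (P * Q).trace - 1 := by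
  have h : (2 * P - 1) * (2 * Q - 1)
      = (P * Q + P * Q) + (P * Q + P * Q) - (P + P) - (Q + Q) + 1 := by noncomm_ring
  rw [h]
  simp only [trace_add, trace_sub, hP.trace, hQ.trace, trace_one, Fintype.card_fin]
  push_cast
  ring

theorem matrix_four_cancel {M N : Matrix (Fin 3) (Fin 3) R} (h : 4 * M = 4 * N) : M = N := by
  have h' : (4 : ℚ) • M = (4 : ℚ) • N := by
    rw [Algebra.smul_def, Algebra.smul_def, map_ofNat, h]
  exact smul_right_injective _ (by norm_num : (4 : ℚ) ≠ 0) h'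

/-- Half-turns whose product is a half-turn have orthogonal axes. -/
theorem IsLineProj.mul_eq_zero_of_commute {P Q : Matrix (Fin 3) (Fin 3) R} (hP : IsLineProj P)
    (hQ : IsLineProj Q) (h : ((2 * P - 1) * (2 * Q - 1)) * ((2 * P - 1) * (2 * Q - 1)) = 1)
    (ht : ((2 * P - 1) * (2 * Q - 1)).trace = -1) : P * Q = 0 := by
  have hA := hP.isHalfTurn.sq
  have hB := hQ.isHalfTurn.sq
  have hcomm : (2 * P - 1) * (2 * Q - 1) = (2 * Q - 1) * (2 * P - 1) := by
    generalize 2 * P - 1 = A at *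
    generalize 2 * Q - 1 = B at *
    calc A * B = A * (A * B * (A * B)) * B := by rw [h, mul_one]
      _ = (A * A) * (B * A) * (B * B) := by noncomm_ring
      _ = B * A := by rw [hA, hB, one_mul, mul_one]
  have hc : P * Q = Q * P := by
    apply matrix_four_cancel
    have e : ∀ U V : Matrix (Fin 3) (Fin 3) R,
        4 * (U * V) = (2 * U - 1) * (2 * V - 1) + 2 * U + 2 * V - 1 := by
      intro U V; noncomm_ring
    rw [e, e, hcomm]; abel
  refine hP.mul_eq_zero hQ hc ?_
  rw [hP.trace_mul hQ] at ht
  have h4 : (4 : R) * (P * Q).trace = 0 := by linear_combination ht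
  exact (isUnit_ofNat_of_rat (R := R) 4 (by norm_num)).mul_left_cancel (by simpa using h4)

theorem IsLineProj.prod_of_mul_eq_zero {P Q : Matrix (Fin 3) (Fin 3) R} (hP : IsLineProj P)
    (hQ : IsLineProj Q) (h : P * Q = 0) :
    ((2 * P - 1) * (2 * Q - 1)) * ((2 * P - 1) * (2 * Q - 1)) = 1 ∧
      ((2 * P - 1) * (2 * Q - 1)).trace = -1 := by
  have h' := hP.mul_comm_zero hQ h
  constructor
  · have hcomm : (2 * P - 1) * (2 * Q - 1) = (2 * Q - 1) * (2 * P - 1) := by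
      calc (2 * P - 1) * (2 * Q - 1) = 4 * (P * Q) - 2 * P - 2 * Q + 1 := by noncomm_ring
        _ = 4 * (Q * P) - 2 * P - 2 * Q + 1 := by rw [h, h']
        _ = _ := by noncomm_ring
    have hA := hP.isHalfTurn.sq
    have hB := hQ.isHalfTurn.sq
    generalize 2 * P - 1 = A at *
    generalize 2 * Q - 1 = B at *
    calc A * B * (A * B) = A * (B * A) * B := by noncomm_ring
      _ = (A * A) * (B * B) := by rw [← hcomm]; noncomm_ring
      _ = 1 := by rw [hA, hB, one_mul]
  · rw [hP.trace_mul hQ, h, trace_zero]; ring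

/-- The rotations of order four, through their traces. -/
theorem trace_eq_one_of_order_four {C : Matrix (Fin 3) (Fin 3) R}
    (hC : C ∈ specialOrthogonalGroup (Fin 3) R) (h4 : C ^ 4 = 1) (ht : (C ^ 2).trace = -1) :
    C.trace = 1 := by
  have h1 := trace_mul_self_of_mem hC
  rw [← pow_two, ht] at h1
  -- The inverse of C is C³. Inserting this in the Cayley–Hamilton formula and taking traces gives 3
  -- = 2t + t² for t = tr C, while tr C² = −1 gives −1 = t² − 2t; the difference is 4 = 4t.
  have h3 : Cᵀ = C * C * C := by
    calc Cᵀ = C ^ 4 * Cᵀ := by rw [h4, one_mul]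
      _ = C * C * C * (C * Cᵀ) := by noncomm_ring
      _ = C * C * C := by rw [mul_transpose_of_mem hC, mul_one]
  have h5 := transpose_eq_of_mem hC
  have h6 : (1 : Matrix (Fin 3) (Fin 3) R)
      = Cᵀ - C.trace • (C * C) + C.trace • C := by
    calc (1 : Matrix (Fin 3) (Fin 3) R) = Cᵀ * C := (transpose_mul_of_mem hC).symm
      _ = (C * C - C.trace • C + C.trace • 1) * C := by rw [← h5]
      _ = _ := by rw [h3, add_mul, sub_mul, smul_mul_assoc, smul_mul_assoc, one_mul]
  have h7 := congrArg Matrix.trace h6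
  rw [trace_one, Fintype.card_fin, trace_add, trace_sub, trace_transpose, trace_smul, trace_smul,
    ← pow_two, ht] at h7
  push_cast at h7
  simp only [smul_eq_mul] at h7
  refine (isUnit_ofNat_of_rat (R := R) 4 (by norm_num)).mul_left_cancel ?_
  push_cast
  linear_combination -h7 + h1

/-- With trace one the characteristic polynomial is (X − 1)(X² + 1), a divisor of X⁴ − 1. -/
theorem order_four_of_trace_eq_one {C : Matrix (Fin 3) (Fin 3) R}
    (hC : C ∈ specialOrthogonalGroup (Fin 3) R) (ht : C.trace = 1) :
    C ^ 4 = 1 ∧ (C ^ 2).trace = -1 := by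
  constructor
  · have h5 := transpose_eq_of_mem hC
    rw [ht, one_smul, one_smul] at h5
    have h6 : C * C * C = C * C - C + 1 := by
      have : (1 : Matrix (Fin 3) (Fin 3) R) = (C * C - C + 1) * C := by
        rw [← h5, transpose_mul_of_mem hC]
      rw [add_mul, sub_mul, one_mul] at this
      rw [this]; abel_nf
    calc C ^ 4 = (C * C * C) * C := by noncomm_ring
      _ = (C * C - C + 1) * C := by rw [h6]
      _ = C * C * C - C * C + C := by rw [add_mul, sub_mul, one_mul]
      _ = 1 := by rw [h6]; abel
  · rw [pow_two, trace_mul_self_of_mem hC, ht]; ring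

end Frames

/-! ### Lines spanned by vectors, and the normal form of a frame -/

section NormalForm

set_option linter.unusedSectionVars false

open Matrix

variable {R : Type*} [CommRing R]

/-- The orthogonal projection to the line spanned by `v`, meaningful when `v ⬝ᵥ v` is a unit. -/
def lineProj (v : Fin 3 → R) : Matrix (Fin 3) (Fin 3) R :=
  Ring.inverse (v ⬝ᵥ v) • vecMulVec v v

/-- The half-turn about the line spanned by `v`, meaningful when `v ⬝ᵥ v` is a unit. -/
def halfTurn (v : Fin 3 → R) : Matrix (Fin 3) (Fin 3) R := 2 * lineProj v - 1

theorem lineProj_isLineProj {v : Fin 3 → R} (hv : IsUnit (v ⬝ᵥ v)) : IsLineProj (lineProj v) := by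
  have h := Ring.inverse_mul_cancel _ hv
  refine ⟨?_, ?_, ?_⟩
  · rw [lineProj, transpose_smul, transpose_vecMulVec]
  · rw [lineProj, smul_mul_smul_comm, vecMulVec_mul_vecMulVec, vecMulVec_smul, smul_smul]
    congr 1
    linear_combination Ring.inverse (v ⬝ᵥ v) * h
  · rw [lineProj, trace_smul, trace_vecMulVec, smul_eq_mul, h]

theorem lineProj_mul {v w : Fin 3 → R} :
    lineProj v * lineProj w =
      (Ring.inverse (v ⬝ᵥ v) * Ring.inverse (w ⬝ᵥ w) * (v ⬝ᵥ w)) • vecMulVec v w := by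
  rw [lineProj, lineProj, smul_mul_smul_comm, vecMulVec_mul_vecMulVec, vecMulVec_smul, smul_smul]

theorem trace_lineProj_mul {v w : Fin 3 → R} :
    (lineProj v * lineProj w).trace =
      Ring.inverse (v ⬝ᵥ v) * Ring.inverse (w ⬝ᵥ w) * (v ⬝ᵥ w) ^ 2 := by
  rw [lineProj_mul, trace_smul, trace_vecMulVec, smul_eq_mul]
  ring

theorem lineProj_mul_eq_zero {v w : Fin 3 → R} (h : v ⬝ᵥ w = 0) :
    lineProj v * lineProj w = 0 := by
  rw [lineProj_mul, h]; simp

theorem map_ringInverse {S : Type*} [CommRing S] (f : R →+* S) {a : R} (ha : IsUnit a) :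
    f (Ring.inverse a) = Ring.inverse (f a) := by
  obtain ⟨u, rfl⟩ := ha
  have : f u = (Units.map (f : R →* S) u : Sˣ) := rfl
  rw [Ring.inverse_unit, this, Ring.inverse_unit]
  simp

theorem map_lineProj {S : Type*} [CommRing S] (f : R →+* S) {v : Fin 3 → R}
    (hv : IsUnit (v ⬝ᵥ v)) : (lineProj v).map f = lineProj (f ∘ v) := by
  ext i j
  have : f (v ⬝ᵥ v) = (f ∘ v) ⬝ᵥ (f ∘ v) := RingHom.map_dotProduct f v v
  simp [lineProj, vecMulVec_apply, map_ringInverse f hv, this]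

theorem map_halfTurn {S : Type*} [CommRing S] (f : R →+* S) {v : Fin 3 → R}
    (hv : IsUnit (v ⬝ᵥ v)) : (halfTurn v).map f = halfTurn (f ∘ v) := by
  rw [halfTurn, halfTurn, ← map_lineProj f hv, two_mul, two_mul, Matrix.map_sub f (map_sub f),
    Matrix.map_add f (map_add f), Matrix.map_one f (map_zero f) (map_one f)]

theorem conj_lineProj {g : Matrix (Fin 3) (Fin 3) R} (hg : g ∈ specialOrthogonalGroup (Fin 3) R)
    (v : Fin 3 → R) : g * lineProj v * gᵀ = lineProj (g *ᵥ v) := by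
  have h : (g *ᵥ v) ⬝ᵥ (g *ᵥ v) = v ⬝ᵥ v := by
    rw [dotProduct_mulVec, vecMul_mulVec, transpose_mul_of_mem hg, vecMul_one]
  rw [lineProj, lineProj, h, mul_smul_comm, smul_mul_assoc, mul_vecMulVec, vecMulVec_mul,
    vecMul_transpose]

theorem conj_halfTurn {g : Matrix (Fin 3) (Fin 3) R} (hg : g ∈ specialOrthogonalGroup (Fin 3) R)
    (v : Fin 3 → R) : g * halfTurn v * gᵀ = halfTurn (g *ᵥ v) := by
  rw [halfTurn, halfTurn, ← conj_lineProj hg, mul_sub, sub_mul, mul_one, mul_transpose_of_mem hg]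
  noncomm_ring

/-- The first three vectors are the standard basis. -/
def axisVec (k : Fin 3) : Fin 3 → R := Pi.single k 1

/-- The bisector of the coordinate axes `k` and `k + 1`. -/
def diagVec (k : Fin 2) : Fin 3 → R := axisVec k.castSucc + axisVec k.succ

theorem axisVec_dot (i j : Fin 3) : (axisVec i : Fin 3 → R) ⬝ᵥ axisVec j = if i = j then 1 else 0 := by
  simp [axisVec, Pi.single_apply, eq_comm]

theorem diagVec_dot (k : Fin 2) : (diagVec k : Fin 3 → R) ⬝ᵥ diagVec k = 2 := by
  fin_cases k <;> simp [diagVec, axisVec_dot] <;> norm_num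

variable [Algebra ℚ R]

theorem lineProj_eq_of_dot_one {u : Fin 3 → R} (h : u ⬝ᵥ u = 1) : lineProj u = vecMulVec u u := by
  rw [lineProj, h, Ring.inverse_one, one_smul]

theorem isUnit_axisVec (k : Fin 3) : IsUnit ((axisVec k : Fin 3 → R) ⬝ᵥ axisVec k) := by
  simp [axisVec_dot]

theorem isUnit_diagVec (k : Fin 2) : IsUnit ((diagVec k : Fin 3 → R) ⬝ᵥ diagVec k) := by
  rw [diagVec_dot]
  simpa using isUnit_ofNat_of_rat (R := R) 2 (by norm_num)

/-- For P = vvᵀ the matrix MPN is (Mv)(Nᵀv)ᵀ and the identity is visible. In general a matrix unit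
is inserted and PXP = tr(PX) P is used. It supplies the hypothesis `hK` of `vecMulVec_axial`. -/
theorem IsLineProj.prod_entries {P : Matrix (Fin 3) (Fin 3) R} (hP : IsLineProj P)
    (M N : Matrix (Fin 3) (Fin 3) R) (j k m n : Fin 3) :
    (M * P * N) j k * (M * P * N) m n = (M * P * Mᵀ) j m * (Nᵀ * P * N) k n := by
  have h1 : (M * P * N * Matrix.single k n (1 : R) * (M * P * N)ᵀ) j m = (M * P * N) j k * (M * P * N) m n := by
    have h : ∀ K : Matrix (Fin 3) (Fin 3) R,
        (K * Matrix.single k n (1 : R) * Kᵀ) j m = K j k * K m n := by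
      intro K
      simp [Matrix.mul_apply, Matrix.single_apply, ite_and]
    exact h _
  have h2 : (P * (N * Matrix.single k n (1 : R) * Nᵀ)).trace = (Nᵀ * P * N) k n := by
    have : (P * (N * Matrix.single k n (1 : R) * Nᵀ)).trace = ((Nᵀ * P * N) * Matrix.single k n (1 : R)).trace := by
      rw [← mul_assoc, trace_mul_comm]; simp only [mul_assoc]
    rw [this, trace_mul_single, MulOpposite.op_one, one_smul]
    have hs : (Nᵀ * P * N)ᵀ = Nᵀ * P * N := by
      simp [transpose_mul, hP.symm, mul_assoc]
    exact congrFun (congrFun hs k) n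
  rw [← h1, transpose_mul, transpose_mul, hP.symm]
  have h3 : M * P * N * Matrix.single k n (1 : R) * (Nᵀ * (P * Mᵀ))
      = M * (P * (N * Matrix.single k n (1 : R) * Nᵀ) * P) * Mᵀ := by simp only [mul_assoc]
  rw [h3, hP.mul_mul_self, h2, mul_smul_comm, smul_mul_assoc, Matrix.smul_apply, smul_eq_mul,
    mul_comm]

theorem matrix_two_cancel {M N : Matrix (Fin 3) (Fin 3) R} (h : 2 * M = 2 * N) : M = N := by
  apply matrix_four_cancel
  calc 4 * M = 2 * (2 * M) := by noncomm_ring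
    _ = 2 * (2 * N) := by rw [h]
    _ = 4 * N := by noncomm_ring

theorem IsLineProj.sum_eq_one {X Y Z : Matrix (Fin 3) (Fin 3) R} (hX : IsLineProj X)
    (hY : IsLineProj Y) (hZ : IsLineProj Z) (hXY : X * Y = 0) (hYZ : Y * Z = 0) (hXZ : X * Z = 0) :
    X + Y + Z = 1 := by
  have hYX := hX.mul_comm_zero hY hXY
  have hZY := hY.mul_comm_zero hZ hYZ
  have hZX := hX.mul_comm_zero hZ hXZ
  have h : 1 - (X + Y + Z) = 0 := by
    refine eq_zero_of_idem_of_trace ?_ ?_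
    · simp only [mul_sub, sub_mul, mul_add, add_mul, mul_one, one_mul, hX.idem, hY.idem, hZ.idem,
        hXY, hYZ, hXZ, hYX, hZY, hZX]
      abel
    · rw [trace_sub, trace_add, trace_add, hX.trace, hY.trace, hZ.trace, trace_one,
        Fintype.card_fin]
      norm_num
  exact (sub_eq_zero.1 h).symm

/-- The half-turn about a bisector of two orthogonal axes interchanges them. -/
theorem IsLineProj.bisector_conj {X Y Z A : Matrix (Fin 3) (Fin 3) R} (hX : IsLineProj X)
    (hY : IsLineProj Y) (hZ : IsLineProj Z) (hA : IsLineProj A) (hXY : X * Y = 0)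
    (hYZ : Y * Z = 0) (hXZ : X * Z = 0) (hAZ : A * Z = 0) (tX : 2 * (A * X).trace = 1)
    (tY : 2 * (A * Y).trace = 1) : (2 * A - 1) * X * (2 * A - 1) = Y := by
  have h1 := hX.sum_eq_one hY hZ hXY hYZ hXZ
  have hZA := hA.mul_comm_zero hZ hAZ
  have two : ∀ {U V : Matrix (Fin 3) (Fin 3) R}, IsLineProj U → 2 * (V * U).trace = 1 →
      2 * (U * V * U) = U := by
    intro U V hU ht
    rw [hU.mul_mul_self, trace_mul_comm, two_mul, ← add_smul, ← two_mul, ht, one_smul]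
  have eX : 2 * (X * A * X) = X := two hX tX
  have eY : 2 * (Y * A * Y) = Y := two hY tY
  have eA : 2 * (A * X * A) = A := two hA (by rw [trace_mul_comm, tX])
  have aXY : A * X + A * Y = A := by
    calc A * X + A * Y = A * (X + Y + Z) := by rw [mul_add, mul_add, hAZ, add_zero]
      _ = A := by rw [h1, mul_one]
  have aXY' : X * A + Y * A = A := by
    calc X * A + Y * A = (X + Y + Z) * A := by rw [add_mul, add_mul, hZA, add_zero]
      _ = A := by rw [h1, one_mul]
  have e1 : 2 * (A * X) = X + 2 * (Y * A * X) := by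
    calc 2 * (A * X) = 2 * ((X * A + Y * A) * X) := by rw [aXY']
      _ = 2 * (X * A * X) + 2 * (Y * A * X) := by noncomm_ring
      _ = _ := by rw [eX]
  have e2 : 2 * (X * A) = X + 2 * (X * A * Y) := by
    calc 2 * (X * A) = 2 * (X * (A * X + A * Y)) := by rw [aXY]
      _ = 2 * (X * A * X) + 2 * (X * A * Y) := by noncomm_ring
      _ = _ := by rw [eX]
  have e3 : 2 * (Y * A) = Y + 2 * (Y * A * X) := by
    calc 2 * (Y * A) = 2 * (Y * (A * X + A * Y)) := by rw [aXY]
      _ = 2 * (Y * A * Y) + 2 * (Y * A * X) := by noncomm_ring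
      _ = _ := by rw [eY]
  -- Block decomposition of 2A along X and Y: the blocks meeting Z vanish, and the diagonal blocks
  -- are X and Y because the angles are half right angles.
  have e4 : 2 * A = X + Y + 2 * (X * A * Y) + 2 * (Y * A * X) := by
    calc 2 * A = 2 * (X * A + Y * A) := by rw [aXY']
      _ = 2 * (X * A) + 2 * (Y * A) := by noncomm_ring
      _ = _ := by rw [e2, e3]; abel
  calc (2 * A - 1) * X * (2 * A - 1)
      = 2 * (2 * (A * X * A)) - 2 * (A * X) - 2 * (X * A) + X := by noncomm_ring
    _ = Y := by rw [eA, e1, e2, e4]; abel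

theorem eq_halfTurn_add {u v w : Fin 3 → R} {A : Matrix (Fin 3) (Fin 3) R}
    (hsum : vecMulVec u u + vecMulVec v v + vecMulVec w w = 1) (hu : u ⬝ᵥ u = 1)
    (hv : v ⬝ᵥ v = 1) (huv : u ⬝ᵥ v = 0) (Au : A *ᵥ u = v) (Av : A *ᵥ v = u)
    (Aw : A *ᵥ w = -w) : A = halfTurn (u + v) := by
  have h1 : A = vecMulVec v u + vecMulVec u v - vecMulVec w w := by
    calc A = A * (vecMulVec u u + vecMulVec v v + vecMulVec w w) := by rw [hsum, mul_one]
      _ = _ := by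
        rw [mul_add, mul_add, mul_vecMulVec, mul_vecMulVec, mul_vecMulVec, Au, Av, Aw,
          neg_vecMulVec, sub_eq_add_neg]
  have h2 : (u + v) ⬝ᵥ (u + v) = 2 := by
    rw [add_dotProduct, dotProduct_add, dotProduct_add, hu, hv, huv, dotProduct_comm v u, huv]
    norm_num
  have h3 : 2 * lineProj (u + v) = vecMulVec (u + v) (u + v) := by
    have h4 : (2 : R) * Ring.inverse 2 = 1 := Ring.mul_inverse_cancel _ (by
      simpa using isUnit_ofNat_of_rat (R := R) 2 (by norm_num))
    rw [lineProj, h2, two_mul, ← add_smul, ← two_mul, h4, one_smul]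
  rw [h1, halfTurn, h3, ← hsum, add_vecMulVec, vecMulVec_add, vecMulVec_add]
  abel

theorem dotProduct_eq_zero_of_proj {u v : Fin 3 → R} (hu : u ⬝ᵥ u = 1) (hv : v ⬝ᵥ v = 1)
    (h : vecMulVec u u * vecMulVec v v = 0) : u ⬝ᵥ v = 0 := by
  have h1 := congrArg (fun M => u ⬝ᵥ (M *ᵥ v)) h
  simpa [vecMulVec_mul_vecMulVec, vecMulVec_smul, smul_mulVec, vecMulVec_mulVec, hu, hv] using h1

/-- The configurations of five lines formed by three orthogonal axes and two bisectors. -/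
structure IsFrame (P : Fin 3 → Matrix (Fin 3) (Fin 3) R) (D : Fin 2 → Matrix (Fin 3) (Fin 3) R) :
    Prop where
  axis : ∀ k, IsLineProj (P k)
  diag : ∀ k, IsLineProj (D k)
  orth : ∀ i j, i ≠ j → P i * P j = 0
  orth_zero : D 0 * P 2 = 0
  orth_one : D 1 * P 0 = 0
  bisect_left : ∀ k, 2 * (D k * P k.castSucc).trace = 1
  bisect_right : ∀ k, 2 * (D k * P k.succ).trace = 1

/-- A line over a ring may have no unit generator, and where it has one the sign is ambiguous; the
bisectors remove both difficulties. If v spanned the second axis, the half-turns A and B about the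
bisectors would carry it to u = Av and w = Bv, and the matrices P₁B, BP₁A, AP₁ would be the tensors
v ⊗ w, w ⊗ u, u ⊗ v. These matrices always exist and are even in v, so their axial vectors define a
coherent oriented orthonormal basis. -/
theorem IsFrame.exists_rotation {P : Fin 3 → Matrix (Fin 3) (Fin 3) R}
    {D : Fin 2 → Matrix (Fin 3) (Fin 3) R} (h : IsFrame P D) :
    ∃ g ∈ specialOrthogonalGroup (Fin 3) R, (∀ k, P k = lineProj (g *ᵥ axisVec k)) ∧
      ∀ k, 2 * D k - 1 = halfTurn (g *ᵥ diagVec k) := by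
  have hX := h.axis 0
  have hY := h.axis 1
  have hZ := h.axis 2
  have hXY := h.orth 0 1 (by decide)
  have hYZ := h.orth 1 2 (by decide)
  have hXZ := h.orth 0 2 (by decide)
  have hYX := h.orth 1 0 (by decide)
  have hZY := h.orth 2 1 (by decide)
  have hZX := h.orth 2 0 (by decide)
  have hsum := hX.sum_eq_one hY hZ hXY hYZ hXZ
  have cA := hX.bisector_conj hY hZ (h.diag 0) hXY hYZ hXZ h.orth_zero (h.bisect_left 0)
    (h.bisect_right 0)
  have cA' := hY.bisector_conj hX hZ (h.diag 0) hYX hXZ hYZ h.orth_zero (h.bisect_right 0)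
    (h.bisect_left 0)
  have cB := hY.bisector_conj hZ hX (h.diag 1) hYZ hZX hYX h.orth_one (h.bisect_left 1)
    (h.bisect_right 1)
  have cB' := hZ.bisector_conj hY hX (h.diag 1) hZY hYX hZX h.orth_one (h.bisect_right 1)
    (h.bisect_left 1)
  have tA := (h.diag 0).isHalfTurn
  have tB := (h.diag 1).isHalfTurn
  have zA : P 2 * (2 * D 0 - 1) = -P 2 := by
    have := (h.diag 0).mul_comm_zero hZ h.orth_zero
    calc P 2 * (2 * D 0 - 1) = 2 * (P 2 * D 0) - P 2 := by noncomm_ring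
      _ = _ := by rw [this]; simp
  have xB : P 0 * (2 * D 1 - 1) = -P 0 := by
    have := (h.diag 1).mul_comm_zero hX h.orth_one
    calc P 0 * (2 * D 1 - 1) = 2 * (P 0 * D 1) - P 0 := by noncomm_ring
      _ = _ := by rw [this]; simp
  obtain ⟨A, hAdef⟩ : ∃ A, A = 2 * D 0 - 1 := ⟨_, rfl⟩
  obtain ⟨B, hBdef⟩ : ∃ B, B = 2 * D 1 - 1 := ⟨_, rfl⟩
  rw [← hAdef] at cA cA' tA zA
  rw [← hBdef] at cB cB' tB xB
  have sA := transpose_of_involution tA.mem tA.sq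
  have sB := transpose_of_involution tB.mem tB.sq
  -- the three basis vectors
  obtain ⟨u, hu⟩ : ∃ u, u = axial (P 1 * B) := ⟨_, rfl⟩
  obtain ⟨v, hv⟩ : ∃ v, v = axial (B * P 1 * A) := ⟨_, rfl⟩
  obtain ⟨w, hw⟩ : ∃ w, w = axial (A * P 1) := ⟨_, rfl⟩
  have uu : vecMulVec u u = P 0 := by
    rw [hu, vecMulVec_axial (P := P 1) (Q := P 2) ?_ hY.symm hZ.symm hY.trace hZ.trace hYZ hZY,
      ← hsum]
    · abel
    · intro j k m n
      have := hY.prod_entries 1 B j k m n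
      rwa [one_mul, transpose_one, mul_one, sB, cB] at this
  have vv : vecMulVec v v = P 1 := by
    rw [hv, vecMulVec_axial (P := P 2) (Q := P 0) ?_ hZ.symm hX.symm hZ.trace hX.trace hZX hXZ,
      ← hsum]
    · abel
    · intro j k m n
      have := hY.prod_entries B A j k m n
      rwa [sA, sB, cB, cA'] at this
  have ww : vecMulVec w w = P 2 := by
    rw [hw, vecMulVec_axial (P := P 0) (Q := P 1) ?_ hX.symm hY.symm hX.trace hY.trace hXY hYX,
      ← hsum]
    · abel
    · intro j k m n
      have := hY.prod_entries A 1 j k m n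
      rwa [mul_one, transpose_one, one_mul, mul_one, sA, cA'] at this
  -- Since P₁B = BP₂ and P₂A = −P₂, conjugating P₁B by A gives minus the transpose of BP₁A, which
  -- has the same axial vector as BP₁A.
  have Au : A *ᵥ u = v := by
    have e : P 1 * B * A = -(P 1 * B) := by
      have : P 1 * B = B * P 2 := by
        rw [← cB, mul_assoc, ← mul_assoc B B, tB.sq, one_mul]
      rw [this, mul_assoc, zA, mul_neg]
    rw [hu, ← axial_conj tA.mem, sA, mul_assoc, e, hv, ← axial_neg_transpose (B * P 1 * A)]
    simp [transpose_mul, sA, sB, hY.symm]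
  have Bv : B *ᵥ v = w := by
    have e : P 1 * A * B = -(P 1 * A) := by
      have : P 1 * A = A * P 0 := by
        rw [← cA', mul_assoc, ← mul_assoc A A, tA.sq, one_mul]
      rw [this, mul_assoc, xB, mul_neg]
    rw [hv, ← axial_conj tB.mem, sB, ← mul_assoc, ← mul_assoc, tB.sq, one_mul, e, hw,
      ← axial_neg_transpose (A * P 1)]
    simp [transpose_mul, sA, hY.symm]
  have Av : A *ᵥ v = u := by rw [← Au, mulVec_mulVec, tA.sq, one_mulVec]
  have Bw : B *ᵥ w = v := by rw [← Bv, mulVec_mulVec, tB.sq, one_mulVec]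
  -- Now P₁ = v ⊗ v and w = Bv make P₁B equal to v ⊗ w. This fixes the orientation: the triple
  -- product of u, v, w is u · u = 1.
  have vw : crossProduct v w = u := by
    rw [← axial_vecMulVec, hu]
    congr 1
    rw [← Bv, ← vv, vecMulVec_mul, ← mulVec_transpose, sB]
  have duu : u ⬝ᵥ u = 1 := by rw [← trace_vecMulVec, uu, hX.trace]
  have dvv : v ⬝ᵥ v = 1 := by rw [← trace_vecMulVec, vv, hY.trace]
  have dww : w ⬝ᵥ w = 1 := by rw [← trace_vecMulVec, ww, hZ.trace]
  obtain ⟨g, hg⟩ : ∃ g : Matrix (Fin 3) (Fin 3) R, g = (Matrix.of ![u, v, w])ᵀ := ⟨_, rfl⟩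
  have ge : ∀ k, g *ᵥ axisVec k = ![u, v, w] k := by
    intro k
    rw [hg, axisVec, mulVec_single_one]
    ext i
    simp
  have hmem : g ∈ specialOrthogonalGroup (Fin 3) R := by
    refine mem_of_eqs ?_ ?_
    · rw [← hsum, ← uu, ← vv, ← ww, hg]
      ext i j
      simp [Matrix.mul_apply, Fin.sum_univ_three, vecMulVec_apply]
    · rw [hg, det_transpose]
      have := triple_product_eq_det u v w
      rw [vw, duu] at this
      exact this.symm
  refine ⟨g, hmem, ?_, ?_⟩
  · intro k
    rw [ge]
    fin_cases k
    · simp [lineProj_eq_of_dot_one duu, uu]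
    · simp [lineProj_eq_of_dot_one dvv, vv]
    · simp [lineProj_eq_of_dot_one dww, ww]
  · have zAu : A *ᵥ w = -w := by
      have e : A * P 2 = -P 2 := by
        have := congrArg transpose zA
        rwa [transpose_mul, sA, transpose_neg, hZ.symm] at this
      have e2 : P 2 *ᵥ w = w := by rw [← ww, vecMulVec_mulVec, dww]; simp
      rw [← e2, mulVec_mulVec, e, neg_mulVec, e2]
    have xBu : B *ᵥ u = -u := by
      have e : B * P 0 = -P 0 := by
        have := congrArg transpose xB
        rwa [transpose_mul, sB, transpose_neg, hX.symm] at this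
      have e2 : P 0 *ᵥ u = u := by rw [← uu, vecMulVec_mulVec, duu]; simp
      rw [← e2, mulVec_mulVec, e, neg_mulVec, e2]
    rw [← uu, ← vv, ← ww] at hsum
    have duv := dotProduct_eq_zero_of_proj duu dvv (by rw [uu, vv, hXY])
    have dvw := dotProduct_eq_zero_of_proj dvv dww (by rw [vv, ww, hYZ])
    intro k
    rw [diagVec, mulVec_add, ge, ge]
    fin_cases k
    · simpa [← hAdef] using eq_halfTurn_add hsum duu dvv duv Au Av zAu
    · simpa [← hBdef] using eq_halfTurn_add (u := v) (v := w) (w := u) (by rw [← hsum]; abel)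
        dvv dww dvw Bv Bw xBu

/-- Fixing the axes makes g diagonal with entries of square one, fixing the bisectors makes products
of neighbouring entries equal to one, and the determinant then forces each entry to be one. Over a
disconnected ring square roots of one are not just signs, so this is argued by equations. -/
theorem eq_one_of_fixes_frame {g : Matrix (Fin 3) (Fin 3) R}
    (hg : g ∈ specialOrthogonalGroup (Fin 3) R)
    (ha : ∀ k, lineProj (g *ᵥ axisVec k) = lineProj (axisVec k))
    (hd : ∀ k, lineProj (g *ᵥ diagVec k) = lineProj (diagVec k)) : g = 1 := by
  have hn : ∀ v, (g *ᵥ v) ⬝ᵥ (g *ᵥ v) = v ⬝ᵥ v := by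
    intro v
    rw [dotProduct_mulVec, vecMul_mulVec, transpose_mul_of_mem hg, vecMul_one]
  have h1 : ∀ k i j, g i k * g j k = if i = k ∧ j = k then 1 else 0 := by
    intro k i j
    have h1 := ha k
    rw [lineProj, lineProj, hn, axisVec_dot, if_pos rfl, Ring.inverse_one, one_smul, one_smul,
      axisVec, mulVec_single_one] at h1
    have h2 := congrFun (congrFun h1 i) j
    simp only [vecMulVec_apply, col_apply, Pi.single_apply] at h2
    rw [h2]
    by_cases hi : i = k <;> by_cases hj : j = k <;> simp [hi, hj]
  have hoff : ∀ i k, i ≠ k → g i k = 0 := by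
    intro i k hik
    have e1 := h1 k i k
    have e2 := h1 k k k
    simp [hik] at e1 e2
    linear_combination g k k * e1 - g i k * e2
  have h2 : ∀ k : Fin 2, g k.castSucc k.castSucc * g k.succ k.succ = 1 := by
    intro k
    have h3 := hd k
    have h4 : (2 : R) * Ring.inverse 2 = 1 := Ring.mul_inverse_cancel _ (by
      simpa using isUnit_ofNat_of_rat (R := R) 2 (by norm_num))
    rw [lineProj, lineProj, hn, diagVec_dot] at h3
    have h5 : vecMulVec (g *ᵥ diagVec k) (g *ᵥ diagVec k)
        = vecMulVec (diagVec k : Fin 3 → R) (diagVec k) := by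
      have := congrArg (fun M => (2 : R) • M) h3
      simpa only [smul_smul, h4, one_smul] using this
    have h6 := congrFun (congrFun h5 k.castSucc) k.succ
    have h7 : k.castSucc ≠ k.succ := (Fin.castSucc_lt_succ).ne
    simpa [vecMulVec_apply, diagVec, axisVec, mulVec_add, mulVec_single_one, hoff, h7, h7.symm]
      using h6
  have e0 := h2 0
  have e1 := h2 1
  have hdet := det_of_mem hg
  rw [det_fin_three] at hdet
  simp [hoff] at hdet e0 e1
  have f0 : g 0 0 = 1 := by linear_combination hdet - g 0 0 * e1
  have f1 : g 1 1 = 1 := by rw [f0] at e0; simpa using e0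
  have f2 : g 2 2 = 1 := by rw [f1] at e1; simpa using e1
  ext i j
  fin_cases i <;> fin_cases j <;> simp [hoff, f0, f1, f2]

theorem lineProj_mulVec_self {v : Fin 3 → R} (hv : IsUnit (v ⬝ᵥ v)) : lineProj v *ᵥ v = v := by
  have h := Ring.inverse_mul_cancel _ hv
  rw [lineProj, smul_mulVec, vecMulVec_mulVec]
  ext i
  simp only [Pi.smul_apply, MulOpposite.smul_eq_mul_unop, MulOpposite.unop_op, smul_eq_mul]
  linear_combination v i * h

theorem mulVec_eq_zero_of_mul_lineProj {P : Matrix (Fin 3) (Fin 3) R} {v : Fin 3 → R}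
    (hv : IsUnit (v ⬝ᵥ v)) (h : P * lineProj v = 0) : P *ᵥ v = 0 := by
  rw [← lineProj_mulVec_self hv, mulVec_mulVec, h, zero_mulVec]

/-- The line orthogonal to two given lines. -/
theorem IsLineProj.eq_lineProj_cross {P : Matrix (Fin 3) (Fin 3) R} (hP : IsLineProj P)
    {p q : Fin 3 → R} (hp : P *ᵥ p = 0) (hq : P *ᵥ q = 0)
    (hw : IsUnit (crossProduct p q ⬝ᵥ crossProduct p q)) : P = lineProj (crossProduct p q) := by
  obtain ⟨w, hwdef⟩ : ∃ w, w = crossProduct p q := ⟨_, rfl⟩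
  rw [← hwdef] at hw ⊢
  have hu := Ring.inverse_mul_cancel _ hw
  -- The rows of P are orthogonal to p and q, hence proportional to w = p × q; the coefficients come
  -- from expanding the double cross product.
  have row : ∀ i j, (w ⬝ᵥ w) * P i j = (P *ᵥ w) i * w j := by
    intro i j
    have e1 := congrFun hp i
    have e2 := congrFun hq i
    rw [hwdef]
    simp only [mulVec, dotProduct, Fin.sum_univ_three, cross_apply, Pi.zero_apply] at e1 e2 ⊢
    fin_cases j <;> simp only [Fin.zero_eta, Fin.mk_one, Fin.reduceFinMk, cons_val]
    · linear_combination
        (-((p 2 * q 0 - p 0 * q 2) * q 2 - (p 0 * q 1 - p 1 * q 0) * q 1)) * e1 +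
        ((p 2 * q 0 - p 0 * q 2) * p 2 - (p 0 * q 1 - p 1 * q 0) * p 1) * e2
    · linear_combination
        (-((p 0 * q 1 - p 1 * q 0) * q 0 - (p 1 * q 2 - p 2 * q 1) * q 2)) * e1 +
        ((p 0 * q 1 - p 1 * q 0) * p 0 - (p 1 * q 2 - p 2 * q 1) * p 2) * e2
    · linear_combination
        (-((p 1 * q 2 - p 2 * q 1) * q 1 - (p 2 * q 0 - p 0 * q 2) * q 0)) * e1 +
        ((p 1 * q 2 - p 2 * q 1) * p 1 - (p 2 * q 0 - p 0 * q 2) * p 0) * e2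
  have hPw : P * lineProj w = P := by
    ext i j
    rw [lineProj, mul_smul_comm, mul_vecMulVec, Matrix.smul_apply, vecMulVec_apply, ← row,
      smul_eq_mul, ← mul_assoc, hu, one_mul]
  have hW := lineProj_isLineProj hw
  have hPw' : lineProj w * P = P := by
    have := congrArg transpose hPw
    rwa [transpose_mul, hP.symm, hW.symm] at this
  have h3 := hW.mul_mul_self P
  rw [hPw', hPw, hP.trace, one_smul] at h3
  exact h3

/-- Lines in the horizontal plane, other than the second axis. -/
theorem IsLineProj.eq_lineProj_var {P : Matrix (Fin 3) (Fin 3) R} (hP : IsLineProj P)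
    (h3 : P *ᵥ axisVec 2 = 0) (h0 : IsUnit (P 0 0)) :
    IsUnit (![1, Ring.inverse (P 0 0) * P 0 1, 0] ⬝ᵥ ![1, Ring.inverse (P 0 0) * P 0 1, 0]) ∧
      P = lineProj ![1, Ring.inverse (P 0 0) * P 0 1, 0] := by
  have hu := Ring.inverse_mul_cancel _ h0
  obtain ⟨a, ha⟩ : ∃ a, a = Ring.inverse (P 0 0) := ⟨_, rfl⟩
  rw [← ha] at hu ⊢
  have hz : ∀ i, P i 2 = 0 := by
    intro i
    have := congrFun h3 i
    simpa [axisVec, mulVec_single_one] using this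
  have hs : ∀ i j, P j i = P i j := fun i j => congrFun (congrFun hP.symm i) j
  have ht := hP.trace
  rw [trace_fin_three, hz 2, add_zero] at ht
  have hm := hP.minor 0 0 1 1
  rw [hs 0 1] at hm
  -- With the trace and the vanishing minor, the vector of slope P₀₁/P₀₀ has squared length 1/P₀₀.
  have hq : ![1, a * P 0 1, 0] ⬝ᵥ ![1, a * P 0 1, 0] = a := by
    simp only [dotProduct, Fin.sum_univ_three, cons_val]
    linear_combination (-a ^ 2) * hm + a * P 1 1 * hu + a * ht - hu
  have hau : IsUnit a := IsUnit.of_mul_eq_one _ hu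
  refine ⟨by rw [hq]; exact hau, ?_⟩
  have hinv : Ring.inverse a = P 0 0 := by
    rw [ha, Ring.inverse_inverse h0]
  rw [lineProj, hq, hinv]
  have e1 : P 0 0 * (a * P 0 1) = P 0 1 := by linear_combination P 0 1 * hu
  have e2 : P 0 0 * (a * P 0 1 * (a * P 0 1)) = P 1 1 := by
    linear_combination (P 1 1 * a * P 0 0 + P 1 1 - a * (P 0 0 * P 1 1 - P 0 1 * P 0 1)) * hu - hm * a
  ext i j
  fin_cases i <;> fin_cases j <;>
    simp [hz, hs 0 1, hs 0 2, hs 1 2, e1, e2]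

theorem cross_dot_cross_self (a b : Fin 3 → R) :
    crossProduct a b ⬝ᵥ crossProduct a b = (a ⬝ᵥ a) * (b ⬝ᵥ b) - (a ⬝ᵥ b) ^ 2 := by
  rw [cross_dot_cross, dotProduct_comm b a, pow_two]

theorem three_sub_trace_halfTurn_mul {a b : Fin 3 → R} (ha : IsUnit (a ⬝ᵥ a))
    (hb : IsUnit (b ⬝ᵥ b)) : 3 - (halfTurn a * halfTurn b).trace =
      4 * (Ring.inverse (a ⬝ᵥ a) * Ring.inverse (b ⬝ᵥ b)
        * (crossProduct a b ⬝ᵥ crossProduct a b)) := by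
  rw [halfTurn, halfTurn, (lineProj_isLineProj ha).trace_mul (lineProj_isLineProj hb),
    trace_lineProj_mul, cross_dot_cross_self]
  linear_combination (-4 * Ring.inverse (b ⬝ᵥ b) * (b ⬝ᵥ b)) * Ring.inverse_mul_cancel _ ha
    - 4 * Ring.inverse_mul_cancel _ hb

/-- By Lagrange's identity 3 − tr is four times the squared sine of the angle between the axes.
Nondegeneracy of a cross product thus becomes invertibility of a regular function of the
representation. -/
theorem isUnit_three_sub_trace_iff {a b : Fin 3 → R} (ha : IsUnit (a ⬝ᵥ a))
    (hb : IsUnit (b ⬝ᵥ b)) : IsUnit (3 - (halfTurn a * halfTurn b).trace) ↔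
      IsUnit (crossProduct a b ⬝ᵥ crossProduct a b) := by
  have h4 : IsUnit (4 : R) := by simpa using isUnit_ofNat_of_rat (R := R) 4 (by norm_num)
  rw [three_sub_trace_halfTurn_mul ha hb, IsUnit.mul_iff, IsUnit.mul_iff, IsUnit.mul_iff]
  simp [h4, ha.ringInverse, hb.ringInverse]

end NormalForm

/-! ### Slices of the conjugation action -/

section Slices

variable {Γ : Type} [Group Γ]

theorem RepRing.algHom_ext {S : Type*} [CommRing S] [Algebra ℚ S] {φ ψ : RepRing Γ →ₐ[ℚ] S}
    (h : ∀ γ, (univMatrix Γ γ).map φ = (univMatrix Γ γ).map ψ) : φ = ψ := by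
  apply Ideal.Quotient.algHom_ext
  apply MvPolynomial.algHom_ext
  rintro ⟨γ, i, j⟩
  exact congrFun (congrFun (h γ) i) j

theorem univMatrix_map_pointOf {R : Type*} [CommRing R] [Algebra ℚ R] (ρ : Γ →* PO3 R) (γ : Γ) :
    (univMatrix Γ γ).map (pointOf ρ) = (PO3.equivSO (ρ γ)).1 := by
  rw [← equivSO_repOf]
  congr 2
  exact DFunLike.congr_fun (points.right_inv ρ) γ

theorem pointOf_repOf {R : Type*} [CommRing R] [Algebra ℚ R] (φ : RepRing Γ →ₐ[ℚ] R) :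
    pointOf (repOf φ) = φ :=
  points.left_inv φ

theorem repOf_pointOf {R : Type*} [CommRing R] [Algebra ℚ R] (ρ : Γ →* PO3 R) :
    repOf (pointOf ρ) = ρ :=
  points.right_inv ρ

theorem pointOf_map {R S : Type*} [CommRing R] [Algebra ℚ R] [CommRing S] [Algebra ℚ S]
    (f : R →ₐ[ℚ] S) (ρ : Γ →* PO3 R) :
    pointOf ((PO3.map (f : R →+* S)).comp ρ) = f.comp (pointOf ρ) := by
  apply RepRing.algHom_ext
  intro γ
  rw [univMatrix_map_pointOf, MonoidHom.comp_apply, PO3.equivSO_map, ← univMatrix_map_pointOf]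
  rfl

theorem repOf_comp {R S : Type*} [CommRing R] [Algebra ℚ R] [CommRing S] [Algebra ℚ S]
    (f : R →ₐ[ℚ] S) (φ : RepRing Γ →ₐ[ℚ] R) :
    repOf (f.comp φ) = (PO3.map (f : R →+* S)).comp (repOf φ) := by
  rw [← repOf_pointOf ((PO3.map (f : R →+* S)).comp (repOf φ)), pointOf_map, pointOf_repOf]

theorem conjRep_conjRep {H : Type*} [Group H] (g h : H) (ρ : Γ →* H) :
    conjRep g (conjRep h ρ) = conjRep (g * h) ρ := by
  ext γ; simp [conjRep]

theorem conjRep_one {H : Type*} [Group H] (ρ : Γ →* H) : conjRep 1 ρ = ρ := by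
  ext γ; simp [conjRep]

theorem comp_conjRep {H H' : Type*} [Group H] [Group H'] (f : H →* H') (g : H) (ρ : Γ →* H) :
    f.comp (conjRep g ρ) = conjRep (f g) (f.comp ρ) := by
  ext γ; simp [conjRep]

/-- An ideal `J` of the representation ring cutting out a slice of the conjugation action on
the clopen locus `e = 1`: every orbit in that locus meets the zero locus of `J` exactly once and
with trivial stabilizer, functorially in the coefficients. -/
structure IsSlice (e : RepRing Γ) (J : Ideal (RepRing Γ)) : Prop where
  idem : e * e = e
  inv : e ∈ charRing Γ
  mem : 1 - e ∈ J
  exists_conj : ∀ (R : Type) [CommRing R] [Algebra ℚ R] (ρ : Γ →* PO3 R), pointOf ρ e = 1 →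
    ∃ g, ∀ a ∈ J, pointOf (conjRep g ρ) a = 0
  unique : ∀ (R : Type) [CommRing R] [Algebra ℚ R] (ρ : Γ →* PO3 R) (g : PO3 R),
    (∀ a ∈ J, pointOf ρ a = 0) → (∀ a ∈ J, pointOf (conjRep g ρ) a = 0) → g = 1

namespace IsSlice

variable {e : RepRing Γ} {J : Ideal (RepRing Γ)}

theorem conj_eq (h : IsSlice e J) {R : Type} [CommRing R] [Algebra ℚ R] {ρ : Γ →* PO3 R}
    {g k : PO3 R} (hg : ∀ a ∈ J, pointOf (conjRep g ρ) a = 0)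
    (hk : ∀ a ∈ J, pointOf (conjRep k ρ) a = 0) : g = k := by
  have h1 : conjRep g ρ = conjRep (g * k⁻¹) (conjRep k ρ) := by
    rw [conjRep_conjRep, inv_mul_cancel_right]
  rw [h1] at hg
  exact mul_inv_eq_one.1 (h.unique R _ _ hk hg)

/-- The extension of a function on the slice to an invariant function. -/
theorem exists_extension (h : IsSlice e J) (a : RepRing Γ) :
    ∃ b : RepRing Γ, ∀ (R : Type) [CommRing R] [Algebra ℚ R] (ρ : Γ →* PO3 R),
      pointOf ρ e = 1 → ∀ k : PO3 R, (∀ c ∈ J, pointOf (conjRep k ρ) c = 0) →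
        pointOf ρ b = pointOf (conjRep k ρ) a := by
  -- The universal representation over the locus e = 1 is moved into the slice by some g; a
  -- evaluated there is the desired function, and b is any lift of it.
  let I : Ideal (RepRing Γ) := Ideal.span {1 - e}
  let φ : RepRing Γ →ₐ[ℚ] RepRing Γ ⧸ I := Ideal.Quotient.mkₐ ℚ I
  have hφe : φ e = 1 := by
    have : φ (1 - e) = 0 := Ideal.Quotient.eq_zero_iff_mem.2 (Ideal.subset_span rfl)
    rw [map_sub, map_one, sub_eq_zero] at this
    exact this.symm
  obtain ⟨g, hg⟩ := h.exists_conj _ (repOf φ) (by rw [pointOf_repOf, hφe])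
  obtain ⟨b, hb⟩ := Ideal.Quotient.mk_surjective (I := I) (pointOf (conjRep g (repOf φ)) a)
  refine ⟨b, fun R _ _ ρ hρ k hk => ?_⟩
  have hI : ∀ c ∈ I, pointOf ρ c = 0 := by
    intro c hc
    obtain ⟨d, rfl⟩ := Ideal.mem_span_singleton'.1 hc
    rw [map_mul, map_sub, map_one, hρ, sub_self, mul_zero]
  let ψ : RepRing Γ ⧸ I →ₐ[ℚ] R := Ideal.Quotient.liftₐ I (pointOf ρ) hI
  have hψ : ψ.comp φ = pointOf ρ := Ideal.Quotient.liftₐ_comp _ _ _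
  have hρψ : (PO3.map (ψ : RepRing Γ ⧸ I →+* R)).comp (repOf φ) = ρ := by
    rw [← repOf_comp, hψ, repOf_pointOf]
  have hmap : ∀ c, pointOf (conjRep (PO3.map (ψ : RepRing Γ ⧸ I →+* R) g) ρ) c
      = ψ (pointOf (conjRep g (repOf φ)) c) := by
    intro c
    conv_lhs => rw [← hρψ]
    rw [← comp_conjRep, pointOf_map]
    rfl
  -- Uniqueness in the slice forces the specialization of the universal g to be the given k.
  have hgk : PO3.map (ψ : RepRing Γ ⧸ I →+* R) g = k := by
    refine h.conj_eq (fun c hc => ?_) hk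
    rw [hmap, hg c hc, map_zero]
  rw [← hgk, hmap, ← hb, ← hψ]
  rfl

/-- The extension b is controlled only where e = 1; multiplying by the invariant idempotent e
discards the rest. At the tautological point of the slice the conjugating element is 1, whence the
congruence with a. -/
theorem exists_invariant (h : IsSlice e J) (a : RepRing Γ) :
    ∃ b ∈ charRing Γ, b - a ∈ J := by
  obtain ⟨b, hb⟩ := h.exists_extension a
  refine ⟨e * b, ?_, ?_⟩
  · intro R _ _ ρ g
    have he : pointOf (conjRep g ρ) e = pointOf ρ e := h.inv R ρ g
    -- Invariance is checked modulo 1 − e(ρ), where both representations have the same normal form;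
    -- what remains is a multiple of 1 − e(ρ), killed by e(ρ).
    let I : Ideal R := Ideal.span {1 - pointOf ρ e}
    let π : R →ₐ[ℚ] R ⧸ I := Ideal.Quotient.mkₐ ℚ I
    have hπ : π (pointOf ρ e) = 1 := by
      have : π (1 - pointOf ρ e) = 0 := Ideal.Quotient.eq_zero_iff_mem.2 (Ideal.subset_span rfl)
      rw [map_sub, map_one, sub_eq_zero] at this
      exact this.symm
    have h1 : pointOf ((PO3.map (π : R →+* R ⧸ I)).comp ρ) e = 1 := by
      rw [pointOf_map]; exact hπ
    have h2 : pointOf ((PO3.map (π : R →+* R ⧸ I)).comp (conjRep g ρ)) e = 1 := by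
      rw [pointOf_map, AlgHom.comp_apply, he, hπ]
    obtain ⟨k, hk⟩ := h.exists_conj _ _ h1
    have h3 : conjRep k ((PO3.map (π : R →+* R ⧸ I)).comp ρ)
        = conjRep (k * (PO3.map (π : R →+* R ⧸ I) g)⁻¹)
          ((PO3.map (π : R →+* R ⧸ I)).comp (conjRep g ρ)) := by
      rw [comp_conjRep, conjRep_conjRep, inv_mul_cancel_right]
    have h4 := hb _ _ h1 k hk
    have h5 := hb _ _ h2 (k * (PO3.map (π : R →+* R ⧸ I) g)⁻¹) (by rw [← h3]; exact hk)
    rw [← h3, ← h4, pointOf_map, pointOf_map] at h5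
    have h6 : pointOf (conjRep g ρ) b - pointOf ρ b ∈ I :=
      (Ideal.Quotient.eq).1 h5
    obtain ⟨r, hr⟩ := Ideal.mem_span_singleton'.1 h6
    have hid : pointOf ρ e * pointOf ρ e = pointOf ρ e := by rw [← map_mul, h.idem]
    rw [map_mul, map_mul, he]
    linear_combination -pointOf ρ e * hr - r * hid
  · let π : RepRing Γ →ₐ[ℚ] RepRing Γ ⧸ J := Ideal.Quotient.mkₐ ℚ J
    have hJ : ∀ c ∈ J, π c = 0 := fun c hc => Ideal.Quotient.eq_zero_iff_mem.2 hc
    have he : π e = 1 := by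
      have := hJ _ h.mem
      rw [map_sub, map_one, sub_eq_zero] at this
      exact this.symm
    have h1 := hb _ (repOf π) (by rw [pointOf_repOf, he]) 1 (by
      rw [conjRep_one, pointOf_repOf]; exact hJ)
    rw [conjRep_one, pointOf_repOf] at h1
    apply Ideal.Quotient.eq_zero_iff_mem.1
    change π (e * b - a) = 0
    rw [map_sub, map_mul, he, one_mul, h1, sub_self]

theorem mul_eq_zero (h : IsSlice e J) {b : RepRing Γ} (hb : b ∈ charRing Γ) (hbJ : b ∈ J) :
    e * b = 0 := by
  let I : Ideal (RepRing Γ) := Ideal.span {1 - e}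
  let φ : RepRing Γ →ₐ[ℚ] RepRing Γ ⧸ I := Ideal.Quotient.mkₐ ℚ I
  have hφe : φ e = 1 := by
    have : φ (1 - e) = 0 := Ideal.Quotient.eq_zero_iff_mem.2 (Ideal.subset_span rfl)
    rw [map_sub, map_one, sub_eq_zero] at this
    exact this.symm
  obtain ⟨g, hg⟩ := h.exists_conj _ (repOf φ) (by rw [pointOf_repOf, hφe])
  have h1 := hb _ (repOf φ) g
  rw [hg b hbJ, pointOf_repOf] at h1
  obtain ⟨r, hr⟩ := Ideal.mem_span_singleton'.1 (Ideal.Quotient.eq_zero_iff_mem.1 h1.symm)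
  rw [← hr]
  linear_combination -r * h.idem

theorem surjective_algebraMap (h : IsSlice e J) :
    Function.Surjective (algebraMap (charRing Γ) (RepRing Γ ⧸ J)) := by
  intro c
  obtain ⟨a, rfl⟩ := Ideal.Quotient.mk_surjective c
  obtain ⟨b, hb, hba⟩ := h.exists_invariant a
  exact ⟨⟨b, hb⟩, Ideal.Quotient.eq.2 hba⟩

/-- Localizing at an idempotent e is dividing by 1 − e. An invariant vanishing on the slice vanishes
on every orbit of the locus e = 1, so restriction to the slice has exactly this kernel. -/
theorem isLocalization (h : IsSlice e J) :
    IsLocalization.Away (⟨e, h.inv⟩ : charRing Γ) (RepRing Γ ⧸ J) := by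
  refine IsLocalization.away_of_isIdempotentElem (Subtype.ext h.idem) ?_ h.surjective_algebraMap
  ext ⟨b, hb⟩
  rw [RingHom.mem_ker, Ideal.mem_span_singleton']
  constructor
  · intro hbJ
    have h1 := h.mul_eq_zero hb (Ideal.Quotient.eq_zero_iff_mem.1 hbJ)
    refine ⟨⟨b, hb⟩, Subtype.ext ?_⟩
    change b * (1 - e) = b
    linear_combination -h1
  · rintro ⟨⟨a, ha⟩, hab⟩
    have h1 : a * (1 - e) = b := congrArg Subtype.val hab
    have h2 : b ∈ J := h1 ▸ J.mul_mem_left _ h.mem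
    exact Ideal.Quotient.eq_zero_iff_mem.2 h2

theorem centralizer_eq_bot (h : IsSlice e J) (ρ : Γ →* PO3 ℂ) (hρ : pointOf ρ e = 1) :
    Subgroup.centralizer (Set.range ρ) = ⊥ := by
  rw [eq_bot_iff]
  intro z hz
  obtain ⟨g, hg⟩ := h.exists_conj _ ρ hρ
  have h1 : conjRep z ρ = ρ := by
    ext γ
    have := (Subgroup.mem_centralizer_iff.1 hz) (ρ γ) ⟨γ, rfl⟩
    simp [conjRep, ← this]
  have h2 : g = g * z := by
    refine h.conj_eq (ρ := ρ) hg ?_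
    rw [← conjRep_conjRep, h1]
    exact hg
  simpa using h2.symm

theorem isStable (h : IsSlice e J) (ρ : Γ →* PO3 ℂ) (hρ : pointOf ρ e = 1) : IsStable ρ := by
  -- Equations of the orbit: every invariant takes the value that it has at ρ.
  refine ⟨⟨{c | ∃ a ∈ charRing Γ, c = 1 ⊗ₜ a - pointOf ρ a ⊗ₜ 1}, fun ρ' => ⟨?_, fun hρ' => ?_⟩⟩, ?_⟩
  · rintro ⟨g, rfl⟩ c ⟨a, ha, rfl⟩
    simp [complexEval, ha ℂ ρ g]
  · have h1 : ∀ a ∈ charRing Γ, pointOf ρ' a = pointOf ρ a := by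
      intro a ha
      have := hρ' _ ⟨a, ha, rfl⟩
      simpa [complexEval, sub_eq_zero] using this
    obtain ⟨g, hg⟩ := h.exists_conj _ ρ hρ
    obtain ⟨k, hk⟩ := h.exists_conj _ ρ' (by rw [h1 e h.inv, hρ])
    -- Every function on the slice is the restriction of an invariant, so two points of the slice
    -- with equal invariants coincide.
    have h2 : pointOf (conjRep k ρ') = pointOf (conjRep g ρ) := by
      ext a
      obtain ⟨b, hb, hba⟩ := h.exists_invariant a
      have e1 := hg _ hba
      have e2 := hk _ hba
      rw [map_sub, sub_eq_zero, hb ℂ] at e1 e2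
      rw [← e1, ← e2, h1 b hb]
    have h3 : conjRep k ρ' = conjRep g ρ := points.symm.injective h2
    refine ⟨k⁻¹ * g, ?_⟩
    rw [← conjRep_conjRep, ← h3, conjRep_conjRep, inv_mul_cancel, conjRep_one]
  · rw [h.centralizer_eq_bot ρ hρ]
    infer_instance

theorem centralizer_eq_center (h : IsSlice e J) (ρ : Γ →* PO3 ℂ) (hρ : pointOf ρ e = 1) :
    Subgroup.centralizer (Set.range ρ) = Subgroup.center (PO3 ℂ) := by
  refine le_antisymm ?_ (Subgroup.center_le_centralizer _)
  rw [h.centralizer_eq_bot ρ hρ]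
  exact bot_le

end IsSlice

end Slices

/-! ### The schemes attached to a slice -/

section SliceSchemes

variable {n : ℕ} {M : CoxeterMatrix (Fin n)} {e : RepRing M.Group} {J : Ideal (RepRing M.Group)}

/-- The slice as a scheme. -/
def sliceScheme (J : Ideal (RepRing M.Group)) : Scheme.{0} :=
  Spec (CommRingCat.of (RepRing M.Group ⧸ J))

/-- The inclusion of the slice into the representation scheme. -/
def sliceToHom (J : Ideal (RepRing M.Group)) : sliceScheme J ⟶ homScheme M.Group :=
  Spec.map (CommRingCat.ofHom (Ideal.Quotient.mk J))

instance (J : Ideal (RepRing M.Group)) : IsClosedImmersion (sliceToHom J) :=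
  IsClosedImmersion.spec_of_surjective _ Ideal.Quotient.mk_surjective

theorem sliceToHom_comp (J : Ideal (RepRing M.Group)) : sliceToHom J ≫ quotientMap M.Group
    = Spec.map (CommRingCat.ofHom (algebraMap (charRing M.Group) (RepRing M.Group ⧸ J))) :=
  (Spec.map_comp (CommRingCat.ofHom (charRing M.Group).val.toRingHom)
    (CommRingCat.ofHom (Ideal.Quotient.mk J))).symm

theorem IsSlice.isOpenImmersion (h : IsSlice e J) :
    IsOpenImmersion (sliceToHom J ≫ quotientMap M.Group) := by
  have h1 := h.isLocalization
  rw [sliceToHom_comp]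
  exact IsOpenImmersion.of_isLocalization (⟨e, h.inv⟩ : charRing M.Group)

theorem IsSlice.range_sliceToHom_subset (h : IsSlice e J)
    (hO : ∀ p : PrimeSpectrum (RepRing M.Group), InjOnElementary M (repAt p) ↔ e ∉ p.asIdeal) :
    Set.range (sliceToHom J) ⊆ (homO M : Set (homScheme M.Group)) := by
  rintro _ ⟨q, rfl⟩
  refine (hO _).2 fun he => ?_
  have h1 : (1 - e) ∈ (sliceToHom J q).asIdeal := by
    change Ideal.Quotient.mk J (1 - e) ∈ q.asIdeal
    rw [Ideal.Quotient.eq_zero_iff_mem.2 h.mem]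
    exact zero_mem _
  have h2 := add_mem h1 he
  rw [sub_add_cancel] at h2
  exact (Ideal.ne_top_iff_one _).1 (sliceToHom J q).isPrime.ne_top h2

/-- As e is invariant, the image of Hom_o lies in the basic open set of e in the character scheme,
which by the localization is already the image of the slice. -/
theorem IsSlice.range_eq_charOSet (h : IsSlice e J)
    (hO : ∀ p : PrimeSpectrum (RepRing M.Group), InjOnElementary M (repAt p) ↔ e ∉ p.asIdeal) :
    Set.range (sliceToHom J ≫ quotientMap M.Group) = charOSet M := by
  apply Set.Subset.antisymm
  · rintro _ ⟨q, rfl⟩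
    exact ⟨sliceToHom J q, h.range_sliceToHom_subset hO ⟨q, rfl⟩, by simp⟩
  · rintro _ ⟨p, hp, rfl⟩
    have h1 := h.isLocalization
    have h3 : Set.range (PrimeSpectrum.comap (algebraMap (charRing M.Group) (RepRing M.Group ⧸ J)))
        = PrimeSpectrum.basicOpen (⟨e, h.inv⟩ : charRing M.Group) :=
      PrimeSpectrum.localization_away_comap_range _ _
    rw [sliceToHom_comp]
    have h4 : quotientMap M.Group p ∈ Set.range
        (PrimeSpectrum.comap (algebraMap (charRing M.Group) (RepRing M.Group ⧸ J))) := by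
      rw [h3]
      intro he
      exact (hO p).1 hp he
    exact h4

/-- The slice and the open subsets of an affine scheme, put together. -/
theorem IsSlice.assemble (h : IsSlice e J)
    (hO : ∀ p : PrimeSpectrum (RepRing M.Group), InjOnElementary M (repAt p) ↔ e ∉ p.asIdeal)
    {B B' : Type} [CommRing B] [Algebra ℚ B] [CommRing B'] [Algebra ℚ B'] (x : B →ₐ[ℚ] ℚ)
    (j : B →ₐ[ℚ] B') (hj : IsOpenImmersion (Spec.map (CommRingCat.ofHom j.toRingHom)))
    (Φ : RepRing M.Group ⧸ J →ₐ[ℚ] B')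
    (hΦ : IsOpenImmersion (Spec.map (CommRingCat.ofHom Φ.toRingHom)))
    (x' : B' →ₐ[ℚ] ℚ) (hx : x'.comp j = x) (ρc : M.Group →* PO3 ℝ)
    (hρ : pointOf ρc = (Algebra.ofId ℚ ℝ).comp (x'.comp (Φ.comp (Ideal.Quotient.mkₐ ℚ J)))) :
    ∃ (X' : (Spec (CommRingCat.of B)).Opens),
      ∃ Xo : (charScheme M.Group).Opens,
        (Xo : Set (charScheme M.Group)) = charOSet M ∧
        (∃ (S : (charScheme M.Group).Opens) (f : X'.toScheme ≅ S.toScheme)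
          (x' : Spec (CommRingCat.of ℚ) ⟶ X'.toScheme),
          S ≤ Xo ∧
          f.hom ≫ S.ι ≫ charSchemeToSpec M.Group =
            X'.ι ≫ Spec.map (CommRingCat.ofHom (algebraMap ℚ B)) ∧
          x' ≫ X'.ι = Spec.map (CommRingCat.ofHom x.toRingHom) ∧
          Spec.map (CommRingCat.ofHom (algebraMap ℚ ℂ)) ≫ x' ≫ f.hom ≫ S.ι =
            homPoint (complexify ρc) ≫ quotientMap M.Group) ∧
        ∃ (Sc : Scheme.{0}) (ι : Sc ⟶ (homO M).toScheme),
          IsCrossSection M Xo ι ∧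
          ∃ s : Spec (CommRingCat.of ℂ) ⟶ Sc,
            s ≫ ι ≫ (homO M).ι = homPoint (complexify ρc) := by
  let jB := Spec.map (CommRingCat.ofHom j.toRingHom)
  let jC : Spec (CommRingCat.of B') ⟶ sliceScheme J := Spec.map (CommRingCat.ofHom Φ.toRingHom)
  let q := sliceToHom J ≫ quotientMap M.Group
  have hq : IsOpenImmersion q := h.isOpenImmersion
  have hjC : IsOpenImmersion jC := hΦ
  have hjB : IsOpenImmersion jB := hj
  have hc : pointOf (complexify ρc)
      = (Algebra.ofId ℚ ℂ).comp (x'.comp (Φ.comp (Ideal.Quotient.mkₐ ℚ J))) := by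
    have h1 : pointOf (complexify ρc) = (Complex.ofRealHom.toRatAlgHom).comp (pointOf ρc) :=
      pointOf_map Complex.ofRealHom.toRatAlgHom ρc
    rw [h1, hρ, ← AlgHom.comp_assoc]
    congr 1
  have hpt : homPoint (complexify ρc) = Spec.map (CommRingCat.ofHom (algebraMap ℚ ℂ)) ≫
      Spec.map (CommRingCat.ofHom x'.toRingHom) ≫ jC ≫ sliceToHom J := by
    rw [homPoint, hc]
    change Spec.map _ = Spec.map _ ≫ Spec.map _ ≫ Spec.map (CommRingCat.ofHom Φ.toRingHom) ≫
      Spec.map (CommRingCat.ofHom (Ideal.Quotient.mk J))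
    rw [← Spec.map_comp, ← Spec.map_comp, ← Spec.map_comp]
    rfl
  refine ⟨jB.opensRange, q.opensRange, ?_, ?_, ?_⟩
  · exact h.range_eq_charOSet hO
  · refine ⟨(jC ≫ q).opensRange, jB.isoOpensRange.symm ≪≫ (jC ≫ q).isoOpensRange,
      Spec.map (CommRingCat.ofHom x'.toRingHom) ≫ jB.isoOpensRange.hom, ?_, ?_, ?_, ?_⟩
    · rintro _ ⟨y, rfl⟩
      exact ⟨jC y, by simp⟩
    · rw [← cancel_epi jB.isoOpensRange.hom]
      simp only [Iso.trans_hom, Iso.symm_hom, Category.assoc, Iso.hom_inv_id_assoc,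
        Scheme.Hom.isoOpensRange_hom_ι_assoc]
      simp only [q]
      rw [sliceToHom_comp]
      change Spec.map (CommRingCat.ofHom Φ.toRingHom) ≫ Spec.map (CommRingCat.ofHom
        (algebraMap (charRing M.Group) (RepRing M.Group ⧸ J))) ≫
        Spec.map (CommRingCat.ofHom (algebraMap ℚ (charRing M.Group))) =
        Spec.map (CommRingCat.ofHom j.toRingHom) ≫ Spec.map (CommRingCat.ofHom (algebraMap ℚ B))
      rw [← Spec.map_comp, ← Spec.map_comp, ← Spec.map_comp, ← CommRingCat.ofHom_comp,
        ← CommRingCat.ofHom_comp, ← CommRingCat.ofHom_comp]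
      congr 2
      -- A ring has at most one homomorphism from ℚ.
      exact Subsingleton.elim _ _
    · rw [Category.assoc, Scheme.Hom.isoOpensRange_hom_ι, ← hx]
      simp only [jB, ← Spec.map_comp]
      rfl
    · simp only [Iso.trans_hom, Iso.symm_hom, Category.assoc, Iso.hom_inv_id_assoc,
        Scheme.Hom.isoOpensRange_hom_ι]
      rw [hpt]
      simp only [Category.assoc, q]
  · let ι : sliceScheme J ⟶ (homO M).toScheme := IsOpenImmersion.lift (homO M).ι (sliceToHom J) (by
      rw [Scheme.Opens.range_ι]
      exact h.range_sliceToHom_subset hO)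
    have hι : ι ≫ (homO M).ι = sliceToHom J := IsOpenImmersion.lift_fac _ _ _
    refine ⟨sliceScheme J, ι, ⟨?_, q.isoOpensRange, ?_⟩,
      Spec.map (CommRingCat.ofHom (algebraMap ℚ ℂ)) ≫
      Spec.map (CommRingCat.ofHom x'.toRingHom) ≫ jC, ?_⟩
    · have : IsClosedImmersion (ι ≫ (homO M).ι) := by rw [hι]; infer_instance
      exact IsClosedImmersion.of_comp ι (homO M).ι
    · rw [Scheme.Hom.isoOpensRange_hom_ι, ← Category.assoc, hι]
    · rw [hι, hpt]
      simp only [Category.assoc]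

end SliceSchemes

/-! ### Coxeter groups with labels two and four -/

section EvenCoxeter

variable {n : ℕ} (M : CoxeterMatrix (Fin n))

/-- The finite labels off the diagonal are `2` or `4`. -/
def HasLabelsTwoFour : Prop := ∀ i j, i ≠ j → M i j = 0 ∨ M i j = 2 ∨ M i j = 4

variable {M}

theorem simple_mul_self (i : Fin n) : M.simple i * M.simple i = 1 :=
  M.toCoxeterSystem.simple_mul_simple_self i

theorem simple_mul_simple_pow (i j : Fin n) : (M.simple i * M.simple j) ^ M i j = 1 :=
  M.toCoxeterSystem.simple_mul_simple_pow i j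

/-- The order is bounded below in a dihedral group: i and j go to adjacent reflections, all other
generators to 1. Evenness of the labels preserves the relations involving a generator sent to 1. For
label 0 the target is the infinite dihedral group and the order is 0. -/
theorem HasLabelsTwoFour.orderOf_mul (hM : HasLabelsTwoFour M) {i j : Fin n} (hij : i ≠ j) :
    orderOf (M.simple i * M.simple j) = M i j := by
  apply Nat.dvd_antisymm (orderOf_dvd_of_pow_eq_one (simple_mul_simple_pow i j))
  let f : Fin n → DihedralGroup (M i j) := fun k =>
    if k = i then DihedralGroup.sr 0 else if k = j then DihedralGroup.sr 1 else 1
  have hf2 : ∀ k, f k * f k = 1 := by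
    intro k
    by_cases h1 : k = i
    · simp only [f, h1, if_true]; exact DihedralGroup.sr_mul_self 0
    · by_cases h2 : k = j
      · simp only [f, h2, if_neg hij.symm, if_true]; exact DihedralGroup.sr_mul_self 1
      · simp [f, h1, h2]
  have heven : ∀ g : DihedralGroup (M i j), g * g = 1 → ∀ k l, k ≠ l → g ^ M k l = 1 := by
    intro g hg k l hkl
    rcases hM k l hkl with h | h | h <;> rw [h]
    · simp
    · rw [pow_two, hg]
    · rw [show 4 = 2 * 2 by rfl, pow_mul, pow_two g, hg, one_pow]
  have hr : ∀ a : DihedralGroup (M i j), a = DihedralGroup.r 1 ∨ a = DihedralGroup.r (-1) →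
      a ^ M i j = 1 := by
    rintro a (rfl | rfl)
    · exact DihedralGroup.r_one_pow_n
    · rw [DihedralGroup.r_pow]; simp
  have hfi : f i = DihedralGroup.sr 0 := by simp [f]
  have hfj : f j = DihedralGroup.sr 1 := by simp [f, hij.symm]
  have hfk : ∀ k, k ≠ i → k ≠ j → f k = 1 := by intro k h1 h2; simp [f, h1, h2]
  have hf : M.IsLiftable f := by
    intro k l
    by_cases hkl : k = l
    · subst hkl; rw [hf2, one_pow]
    by_cases hk : k ≠ i ∧ k ≠ j
    · rw [hfk k hk.1 hk.2, one_mul]; exact heven _ (hf2 l) k l hkl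
    by_cases hl : l ≠ i ∧ l ≠ j
    · rw [hfk l hl.1 hl.2, mul_one]; exact heven _ (hf2 k) k l hkl
    have hk' : k = i ∨ k = j := by tauto
    have hl' : l = i ∨ l = j := by tauto
    rcases hk' with rfl | rfl <;> rcases hl' with rfl | rfl
    · exact absurd rfl hkl
    · rw [hfi, hfj, DihedralGroup.sr_mul_sr]; exact hr _ (Or.inl (by simp))
    · rw [hfi, hfj, DihedralGroup.sr_mul_sr]
      exact (congrArg (fun m => (DihedralGroup.r (0 - 1)) ^ m) (M.symmetric k l)).trans
        (hr _ (Or.inr (congrArg _ (zero_sub 1))))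
    · exact absurd rfl hkl
  have h1 : M.toCoxeterSystem.lift ⟨f, hf⟩ (M.simple i * M.simple j) = DihedralGroup.r 1 := by
    have e : ∀ k, M.toCoxeterSystem.lift ⟨f, hf⟩ (M.simple k) = f k := fun k =>
      M.toCoxeterSystem.lift_apply_simple hf k
    rw [map_mul, e, e, hfi, hfj, DihedralGroup.sr_mul_sr, sub_zero]
  have h2 := orderOf_map_dvd (M.toCoxeterSystem.lift ⟨f, hf⟩) (M.simple i * M.simple j)
  rwa [h1, DihedralGroup.orderOf_r_one] at h2

theorem simple_ne_one (i : Fin n) :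
    M.simple i ≠ 1 := by
  let f : Fin n → Multiplicative (ZMod 2) := fun _ => Multiplicative.ofAdd 1
  have hf : M.IsLiftable f := by
    intro k l
    have : f k * f l = 1 := by decide
    rw [this, one_pow]
  have e : M.toCoxeterSystem.lift ⟨f, hf⟩ (M.simple i) = f i :=
    M.toCoxeterSystem.lift_apply_simple hf i
  intro h
  rw [h, map_one] at e
  exact absurd e (by decide)

/-- The elements of a subgroup generated by two involutions. -/
theorem mem_closure_pair_involutions {G : Type*} [Group G] {g h : G} (hg : g * g = 1)
    (hh : h * h = 1) {x : G} (hx : x ∈ Subgroup.closure {g, h}) :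
    ∃ k : ℤ, x = (g * h) ^ k ∨ x = (g * h) ^ k * g := by
  have hgi : g⁻¹ = g := inv_eq_of_mul_eq_one_left hg
  have hhi : h⁻¹ = h := inv_eq_of_mul_eq_one_left hh
  have hconj : ∀ k : ℤ, g * (g * h) ^ k = (g * h) ^ (-k) * g := by
    intro k
    have h1 : g * (g * h) * g⁻¹ = (g * h)⁻¹ := by
      rw [mul_inv_rev, hgi, hhi, ← mul_assoc, hg, one_mul]
    have h2 : g * (g * h) ^ k * g⁻¹ = (g * h) ^ (-k) := by
      rw [← conj_zpow, h1, zpow_neg, inv_zpow]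
    rw [← h2, inv_mul_cancel_right]
  induction hx using Subgroup.closure_induction with
  | mem x hx =>
    rcases hx with rfl | rfl
    · exact ⟨0, Or.inr (by simp)⟩
    · refine ⟨-1, Or.inr ?_⟩
      rw [zpow_neg, zpow_one, mul_inv_rev, hgi, hhi, mul_assoc, hg, mul_one]
  | one => exact ⟨0, Or.inl (by simp)⟩
  | mul x y _ _ hx hy =>
    obtain ⟨a, rfl | rfl⟩ := hx <;> obtain ⟨b, rfl | rfl⟩ := hy
    · exact ⟨a + b, Or.inl (zpow_add _ _ _).symm⟩
    · exact ⟨a + b, Or.inr (by rw [zpow_add, mul_assoc])⟩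
    · exact ⟨a + -b, Or.inr (by rw [mul_assoc, hconj, zpow_add, mul_assoc])⟩
    · refine ⟨a + -b, Or.inl ?_⟩
      rw [mul_assoc, ← mul_assoc g, hconj, mul_assoc _ g g, hg, mul_one, zpow_add]
  | inv x _ hx =>
    obtain ⟨a, rfl | rfl⟩ := hx
    · exact ⟨-a, Or.inl (zpow_neg _ _).symm⟩
    · refine ⟨a, Or.inr ?_⟩
      rw [mul_inv_rev, hgi, ← zpow_neg, hconj, neg_neg]

theorem finite_closure_pair_involutions {G : Type*} [Group G] {g h : G} (hg : g * g = 1)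
    (hh : h * h = 1) (hf : IsOfFinOrder (g * h)) : Finite (Subgroup.closure {g, h}) := by
  have h1 : (Set.range fun k : ℤ => (g * h) ^ k).Finite := by
    have := hf.finite_zpowers
    rwa [Subgroup.coe_zpowers] at this
  have h2 := h1.union (h1.image (· * g))
  refine Set.Finite.to_subtype (h2.subset ?_)
  intro x hx
  obtain ⟨k, rfl | rfl⟩ := mem_closure_pair_involutions hg hh hx
  · exact Or.inl ⟨k, rfl⟩
  · exact Or.inr ⟨_, ⟨k, rfl⟩, rfl⟩

variable (M) in
/-- Involutions testing injectivity on the elementary subgroups. -/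
def testElements : Set M.Group :=
  Set.range M.simple ∪
    {γ | ∃ i j, i ≠ j ∧ M i j ≠ 0 ∧ γ = (M.simple i * M.simple j) ^ (M i j / 2)}

theorem finite_testElements : (testElements M).Finite := by
  refine (Set.finite_range _).union ((Set.finite_range fun p : Fin n × Fin n =>
    (M.simple p.1 * M.simple p.2) ^ (M p.1 p.2 / 2)).subset ?_)
  rintro γ ⟨i, j, -, -, rfl⟩
  exact ⟨(i, j), rfl⟩

theorem HasLabelsTwoFour.mul_self_of_mem (hM : HasLabelsTwoFour M) {γ : M.Group}
    (hγ : γ ∈ testElements M) : γ * γ = 1 := by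
  rcases hγ with ⟨i, rfl⟩ | ⟨i, j, hij, h0, rfl⟩
  · exact simple_mul_self i
  · have h1 := simple_mul_simple_pow (M := M) i j
    rcases hM i j hij with h | h | h
    · exact absurd h h0
    · rw [h] at h1 ⊢; rw [← pow_add]; exact h1
    · rw [h] at h1 ⊢; rw [← pow_add]; exact h1

theorem HasLabelsTwoFour.ne_one_of_mem (hM : HasLabelsTwoFour M) {γ : M.Group}
    (hγ : γ ∈ testElements M) : γ ≠ 1 := by
  rcases hγ with ⟨i, rfl⟩ | ⟨i, j, hij, h0, rfl⟩
  · exact simple_ne_one i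
  · intro h1
    have h2 := orderOf_dvd_of_pow_eq_one h1
    rw [hM.orderOf_mul hij] at h2
    rcases hM i j hij with h | h | h
    · exact absurd h h0
    · rw [h] at h2; norm_num at h2
    · rw [h] at h2; norm_num at h2

theorem isElementary_single (i : Fin n) :
    IsElementary M (Subgroup.closure {M.simple i}) := by
  refine ⟨?_, {i}, by simp, by simp⟩
  have h := finite_closure_pair_involutions (simple_mul_self (M := M) i) (simple_mul_self i)
    (by rw [simple_mul_self]; exact IsOfFinOrder.one)
  simpa using h

theorem isElementary_pair {i j : Fin n} (h0 : M i j ≠ 0) :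
    IsElementary M (Subgroup.closure {M.simple i, M.simple j}) := by
  refine ⟨finite_closure_pair_involutions (simple_mul_self i) (simple_mul_self j)
    (isOfFinOrder_iff_pow_eq_one.2 ⟨_, Nat.pos_of_ne_zero h0, simple_mul_simple_pow i j⟩),
    {i, j}, Finset.card_le_two, ?_⟩
  congr 1
  simp [Set.image_insert_eq]

/-- A nontrivial normal subgroup of a dihedral group of order 4 or 8 contains a defining reflection
or the half-period rotation; those are the test elements. -/
theorem HasLabelsTwoFour.injOnElementary_iff (hM : HasLabelsTwoFour M) {G : Type*} [Group G]
    (ρ : M.Group →* G) : InjOnElementary M ρ ↔ ∀ γ ∈ testElements M, ρ γ ≠ 1 := by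
  constructor
  · intro h γ hγ h1
    have key : ∀ H, IsElementary M H → γ ∈ H → False := fun H hH hm =>
      hM.ne_one_of_mem hγ (h H hH hm H.one_mem (by rw [h1, map_one]))
    rcases hγ with ⟨i, rfl⟩ | ⟨i, j, hij, h0, rfl⟩
    · exact key _ (isElementary_single i) (Subgroup.subset_closure rfl)
    · refine key _ (isElementary_pair h0) (Subgroup.pow_mem _ (Subgroup.mul_mem _ ?_ ?_) _)
      · exact Subgroup.subset_closure (by simp)
      · exact Subgroup.subset_closure (by simp)
  · intro h H hH
    have hs : ∀ i, ρ (M.simple i) ≠ 1 := fun i => h _ (Or.inl ⟨i, rfl⟩)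
    suffices hker : ∀ γ ∈ H, ρ γ = 1 → γ = 1 by
      intro a ha b hb hab
      have := hker (a * b⁻¹) (H.mul_mem ha (H.inv_mem hb)) (by simp [hab])
      exact mul_inv_eq_one.1 this
    obtain ⟨hfin, T, hT, rfl⟩ := hH
    interval_cases hc : T.card
    · rw [Finset.card_eq_zero] at hc
      subst hc
      intro γ hγ _
      simpa using hγ
    · obtain ⟨i, rfl⟩ := Finset.card_eq_one.1 hc
      intro γ hγ h1
      have hγ' : γ ∈ Subgroup.closure {M.simple i, M.simple i} := by simpa using hγ
      obtain ⟨k, rfl | rfl⟩ :=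
        mem_closure_pair_involutions (simple_mul_self i) (simple_mul_self i) hγ'
      · rw [simple_mul_self, one_zpow]
      · rw [simple_mul_self, one_zpow, one_mul] at h1
        exact absurd h1 (hs i)
    · obtain ⟨i, j, hij, rfl⟩ := Finset.card_eq_two.1 hc
      have hset : M.simple '' (({i, j} : Finset (Fin n)) : Set (Fin n))
          = {M.simple i, M.simple j} := by
        rw [Finset.coe_pair, Set.image_pair]
      rw [hset] at hfin ⊢
      -- Label 0 would give an element of infinite order in a finite subgroup.
      have h0 : M i j ≠ 0 := by
        intro h0
        have hmem : M.simple i * M.simple j ∈ Subgroup.closure {M.simple i, M.simple j} :=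
          Subgroup.mul_mem _ (Subgroup.subset_closure (by simp)) (Subgroup.subset_closure (by simp))
        have h2 := isOfFinOrder_of_finite
          (⟨_, hmem⟩ : Subgroup.closure {M.simple i, M.simple j})
        rw [← orderOf_pos_iff, Subgroup.orderOf_mk] at h2
        rw [hM.orderOf_mul hij, h0] at h2
        exact lt_irrefl _ h2
      intro γ hγ h1
      obtain ⟨k, rfl | rfl⟩ :=
        mem_closure_pair_involutions (simple_mul_self i) (simple_mul_self j) hγ
      · have ht := h _ (Or.inr ⟨i, j, hij, h0, rfl⟩)
        have hpow := simple_mul_simple_pow (M := M) i j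
        generalize M.simple i * M.simple j = c at *
        have hev : ∀ a : ℤ, ρ c ^ (k * a) = 1 := by
          intro a
          rw [zpow_mul, ← map_zpow, h1, one_zpow]
        have hzp : c ^ ((M i j : ℕ) : ℤ) = 1 := by rw [zpow_natCast, hpow]
        rw [map_pow, ← zpow_natCast] at ht
        have hρp : ρ c ^ ((M i j : ℕ) : ℤ) = 1 := by rw [← map_zpow, hzp, map_one]
        have hred : ∀ a b : ℤ, ρ c ^ (k * a - (M i j : ℤ) * b) = 1 := by
          intro a b
          rw [zpow_sub, hev, zpow_mul, hρp, one_zpow, inv_one, mul_one]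
        -- A rotation with exponent not divisible by 2 or 4 respectively has itself or its square
        -- equal to the half-period rotation.
        have hdiv : ((M i j : ℕ) : ℤ) ∣ k := by
          by_contra hnd
          apply ht
          rcases hM i j hij with h' | h' | h'
          · exact absurd h' h0
          · rw [h'] at hnd hred ⊢
            have := hred 1 (k / 2)
            rwa [show k * 1 - ((2 : ℕ) : ℤ) * (k / 2) = ((2 / 2 : ℕ) : ℤ) by
              push_cast at hnd ⊢; omega] at this
          · rw [h'] at hnd hred ⊢
            push_cast at hnd
            by_cases hk : k % 4 = 2
            · have := hred 1 (k / 4)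
              rwa [show k * 1 - ((4 : ℕ) : ℤ) * (k / 4) = ((4 / 2 : ℕ) : ℤ) by
                push_cast; omega] at this
            · have := hred 2 (k / 2)
              rwa [show k * 2 - ((4 : ℕ) : ℤ) * (k / 2) = ((4 / 2 : ℕ) : ℤ) by
                push_cast; omega] at this
        obtain ⟨b, rfl⟩ := hdiv
        rw [zpow_mul, hzp, one_zpow]
      · exfalso
        have hi2 := simple_mul_self (M := M) i
        have hj2 := simple_mul_self (M := M) j
        have hii : (M.simple i)⁻¹ = M.simple i := inv_eq_of_mul_eq_one_left hi2
        have hji : (M.simple j)⁻¹ = M.simple j := inv_eq_of_mul_eq_one_left hj2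
        have hconj : ∀ a : ℤ, M.simple i * (M.simple i * M.simple j) ^ a * M.simple i
            = (M.simple i * M.simple j) ^ (-a) := by
          intro a
          have h3 : M.simple i * (M.simple i * M.simple j) * (M.simple i)⁻¹
              = (M.simple i * M.simple j)⁻¹ := by
            rw [mul_inv_rev, hii, hji, ← mul_assoc, hi2, one_mul]
          have h4 := conj_zpow (a := M.simple i) (b := M.simple i * M.simple j) (i := a)
          rw [h3, inv_zpow, ← zpow_neg, hii] at h4
          exact h4.symm
        have hgen : ∀ (a : ℤ) (x : M.Group), ρ ((M.simple i * M.simple j) ^ a * x *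
            (M.simple i * M.simple j) ^ (-a)) = 1 → ρ x = 1 := by
          intro a x hx
          rw [map_mul, map_mul, zpow_neg, map_inv] at hx
          exact conj_eq_one_iff.1 hx
        -- A reflection of even exponent is conjugate to the first generator, one of odd exponent to
        -- the second.
        rcases Int.even_or_odd' k with ⟨a, rfl | rfl⟩
        · refine hs i (hgen a _ ?_)
          rw [← h1, two_mul, zpow_add, mul_assoc _ _ (M.simple i), mul_assoc]
          congr 2
          rw [← hconj, ← mul_assoc, ← mul_assoc, hi2, one_mul]
        · refine hs j (hgen (a + 1) _ ?_)
          rw [← h1, show 2 * a + 1 = (a + 1) + a by ring, zpow_add _ (a + 1) a,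
            mul_assoc _ _ (M.simple i), mul_assoc]
          congr 2
          have h5 := hconj (-a)
          rw [neg_neg] at h5
          rw [← h5, mul_assoc _ (M.simple i) (M.simple i), hi2, mul_one, neg_add, add_comm,
            zpow_add, zpow_neg_one, mul_inv_rev, hii, hji, ← mul_assoc, ← mul_assoc, hj2, one_mul]

end EvenCoxeter

/-! ### The idempotent cutting out the representations injective on elementary subgroups -/

section Idempotent

open Matrix

/-- The rotation matrix of `ρ γ`. -/
def repMat {Γ : Type} [Group Γ] {R : Type*} [CommRing R] (ρ : Γ →* PO3 R) (γ : Γ) :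
    Matrix (Fin 3) (Fin 3) R :=
  (PO3.equivSO (ρ γ)).1

section RepMat

variable {Γ : Type} [Group Γ] {R : Type*} [CommRing R] (ρ : Γ →* PO3 R)

theorem repMat_mem (γ : Γ) : repMat ρ γ ∈ specialOrthogonalGroup (Fin 3) R :=
  (PO3.equivSO (ρ γ)).2

theorem repMat_mul (γ δ : Γ) : repMat ρ (γ * δ) = repMat ρ γ * repMat ρ δ := by
  simp [repMat]

theorem repMat_one : repMat ρ 1 = 1 := by
  simp [repMat]

theorem repMat_pow (γ : Γ) (k : ℕ) : repMat ρ (γ ^ k) = repMat ρ γ ^ k := by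
  induction k with
  | zero => simp [repMat_one]
  | succ k ih => rw [pow_succ, repMat_mul, ih, pow_succ]

theorem repMat_eq_one_iff (γ : Γ) : repMat ρ γ = 1 ↔ ρ γ = 1 := by
  rw [← PO3.equivSO.injective.eq_iff, map_one, Subtype.ext_iff]
  rfl

theorem repMat_conjRep (g : PO3 R) (γ : Γ) :
    repMat (conjRep g ρ) γ = (PO3.equivSO g).1 * repMat ρ γ * (PO3.equivSO g).1ᵀ := by
  have h : (((PO3.equivSO g)⁻¹ : specialOrthogonalGroup (Fin 3) R) : Matrix (Fin 3) (Fin 3) R)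
      = (PO3.equivSO g).1ᵀ := by
    have h1 := transpose_mul_of_mem (PO3.equivSO g).2
    have h2 : (PO3.equivSO g).1 *
        (((PO3.equivSO g)⁻¹ : specialOrthogonalGroup (Fin 3) R) : Matrix (Fin 3) (Fin 3) R) = 1 := by
      rw [← Submonoid.coe_mul, mul_inv_cancel]; rfl
    exact (left_inv_eq_right_inv h1 h2).symm
  rw [← h]
  simp [repMat, conjRep]

theorem trace_repMat_conjRep (g : PO3 R) (γ : Γ) :
    (repMat (conjRep g ρ) γ).trace = (repMat ρ γ).trace := by
  rw [repMat_conjRep, trace_mul_comm, ← mul_assoc, transpose_mul_of_mem (PO3.equivSO g).2, one_mul]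

end RepMat

section TraceFunctions

variable {Γ : Type} [Group Γ]

theorem pointOf_univMatrix_apply {R : Type*} [CommRing R] [Algebra ℚ R] (ρ : Γ →* PO3 R)
    (γ : Γ) (i j : Fin 3) : pointOf ρ (univMatrix Γ γ i j) = repMat ρ γ i j :=
  congrFun (congrFun (univMatrix_map_pointOf ρ γ) i) j

theorem pointOf_trace {R : Type*} [CommRing R] [Algebra ℚ R] (ρ : Γ →* PO3 R)
    (γ : Γ) : pointOf ρ (univMatrix Γ γ).trace = (repMat ρ γ).trace := by
  simp [trace_fin_three, pointOf_univMatrix_apply]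

theorem univMatrix_eq_repMat (γ : Γ) :
    univMatrix Γ γ = repMat (repOf (AlgHom.id ℚ (RepRing Γ))) γ := by
  rw [repMat, equivSO_repOf]
  ext i j
  rfl

/-- The function which, for an involution `γ`, is one where `ρ γ` is a half-turn and zero where
it is trivial. -/
def traceIdem (γ : Γ) : RepRing Γ := (4⁻¹ : ℚ) • (3 - (univMatrix Γ γ).trace)

theorem pointOf_traceIdem {R : Type*} [CommRing R] [Algebra ℚ R] (ρ : Γ →* PO3 R) (γ : Γ) :
    pointOf ρ (traceIdem γ) = (4⁻¹ : ℚ) • (3 - (repMat ρ γ).trace) := by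
  rw [traceIdem, map_smul, map_sub, pointOf_trace, map_ofNat]

theorem pointOf_traceIdem_eq_one_iff {R : Type*} [CommRing R] [Algebra ℚ R] (ρ : Γ →* PO3 R)
    (γ : Γ) : pointOf ρ (traceIdem γ) = 1 ↔ (repMat ρ γ).trace = -1 := by
  rw [pointOf_traceIdem, inv_smul_eq_iff₀ (by norm_num), Algebra.smul_def, map_ofNat, mul_one]
  constructor <;> intro h
  · linear_combination -h
  · linear_combination -h

theorem pointOf_traceIdem_eq_zero_iff {R : Type*} [CommRing R] [Algebra ℚ R] (ρ : Γ →* PO3 R)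
    {γ : Γ} (hγ : γ * γ = 1) : pointOf ρ (traceIdem γ) = 0 ↔ ρ γ = 1 := by
  have h2 : repMat ρ γ * repMat ρ γ = 1 := by rw [← repMat_mul, hγ, repMat_one]
  rw [pointOf_traceIdem, inv_smul_eq_iff₀ (by norm_num), smul_zero, ← repMat_eq_one_iff]
  constructor
  · intro h
    exact eq_one_of_trace_three (repMat_mem ρ γ) h2 (by linear_combination -h)
  · intro h
    rw [h, trace_one]; norm_num

/-- The relation (t − 3)(t + 1) = 0 holds over the representation ring itself and is idempotence of
(3 − t)/4. Hence Hom_o is clopen as a scheme, nilpotents included. -/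
theorem traceIdem_mul_self {γ : Γ} (hγ : γ * γ = 1) :
    traceIdem γ * traceIdem γ = traceIdem γ := by
  have h1 := trace_of_involution (univMatrix_mem Γ γ) (by
    rw [univMatrix_eq_repMat, ← repMat_mul, hγ, repMat_one])
  have h4 : algebraMap ℚ (RepRing Γ) 4⁻¹ * 4 = 1 := by
    rw [← map_ofNat (algebraMap ℚ (RepRing Γ)) 4, ← map_mul]; norm_num
  rw [traceIdem, Algebra.smul_def]
  generalize algebraMap ℚ (RepRing Γ) 4⁻¹ = c at *
  linear_combination c ^ 2 * h1 + c * (3 - (univMatrix Γ γ).trace) * h4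

theorem traceIdem_mem_charRing (γ : Γ) : traceIdem γ ∈ charRing Γ := by
  intro R _ _ ρ g
  rw [pointOf_traceIdem, pointOf_traceIdem, trace_repMat_conjRep]

end TraceFunctions

variable {n : ℕ} (M : CoxeterMatrix (Fin n))

/-- The idempotent whose nonvanishing locus is `Hom_o`. -/
def elementaryIdem : RepRing M.Group :=
  ∏ γ ∈ (finite_testElements (M := M)).toFinset, traceIdem γ

variable {M}

theorem HasLabelsTwoFour.elementaryIdem_mul_self (hM : HasLabelsTwoFour M) :
    elementaryIdem M * elementaryIdem M = elementaryIdem M := by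
  rw [elementaryIdem, ← Finset.prod_mul_distrib]
  refine Finset.prod_congr rfl fun γ hγ => traceIdem_mul_self (hM.mul_self_of_mem ?_)
  simpa using hγ

theorem elementaryIdem_mem_charRing : elementaryIdem M ∈ charRing M.Group :=
  prod_mem fun γ _ => traceIdem_mem_charRing γ

theorem HasLabelsTwoFour.pointOf_elementaryIdem_eq_one_iff (hM : HasLabelsTwoFour M) {R : Type*}
    [CommRing R] [Algebra ℚ R] (ρ : M.Group →* PO3 R) :
    pointOf ρ (elementaryIdem M) = 1 ↔ ∀ γ ∈ testElements M, (repMat ρ γ).trace = -1 := by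
  constructor
  · intro h γ hγ
    rw [← pointOf_traceIdem_eq_one_iff]
    classical
    -- An idempotent factor is absorbed by the product, so it is one wherever the product is.
    have h1 : traceIdem γ * elementaryIdem M = elementaryIdem M := by
      rw [elementaryIdem, ← Finset.mul_prod_erase _ _ (by simpa using hγ), ← mul_assoc,
        traceIdem_mul_self (hM.mul_self_of_mem hγ)]
    have h2 := congrArg (pointOf ρ) h1
    rwa [map_mul, h, mul_one] at h2
  · intro h
    rw [elementaryIdem, map_prod]
    refine Finset.prod_eq_one fun γ hγ => ?_
    rw [pointOf_traceIdem_eq_one_iff]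
    exact h γ (by simpa using hγ)

theorem HasLabelsTwoFour.pointOf_elementaryIdem_ne_zero_iff (hM : HasLabelsTwoFour M) {K : Type*}
    [Field K] [Algebra ℚ K] (ρ : M.Group →* PO3 K) :
    pointOf ρ (elementaryIdem M) ≠ 0 ↔ InjOnElementary M ρ := by
  rw [hM.injOnElementary_iff, elementaryIdem, map_prod, Finset.prod_ne_zero_iff]
  constructor
  · intro h γ hγ
    rw [ne_eq, ← pointOf_traceIdem_eq_zero_iff ρ (hM.mul_self_of_mem hγ)]
    exact h γ (by simpa using hγ)
  · intro h γ hγ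
    have hγ' : γ ∈ testElements M := by simpa using hγ
    rw [ne_eq, pointOf_traceIdem_eq_zero_iff ρ (hM.mul_self_of_mem hγ')]
    exact h γ hγ'

theorem HasLabelsTwoFour.injOnElementary_repAt_iff (hM : HasLabelsTwoFour M)
    (p : PrimeSpectrum (RepRing M.Group)) :
    InjOnElementary M (repAt p) ↔ elementaryIdem M ∉ p.asIdeal := by
  rw [← hM.pointOf_elementaryIdem_ne_zero_iff, repAt, pointOf_repOf, ne_eq,
    ← Ideal.algebraMap_residueField_eq_zero]
  rfl

theorem HasLabelsTwoFour.pointOf_elementaryIdem_of_injOn (hM : HasLabelsTwoFour M) {K : Type*}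
    [Field K] [Algebra ℚ K] (ρ : M.Group →* PO3 K) (hρ : InjOnElementary M ρ) :
    pointOf ρ (elementaryIdem M) = 1 := by
  have h0 := (hM.pointOf_elementaryIdem_ne_zero_iff ρ).2 hρ
  have h1 := congrArg (pointOf ρ) hM.elementaryIdem_mul_self
  rw [map_mul] at h1
  exact mul_left_cancel₀ h0 (by rw [h1, mul_one])

theorem IsSlice.standingAssumption (hM : HasLabelsTwoFour M) {J : Ideal (RepRing M.Group)}
    (h : IsSlice (elementaryIdem M) J) : StandingAssumption M := fun ρ hρ =>
  ⟨h.centralizer_eq_center ρ (hM.pointOf_elementaryIdem_of_injOn ρ hρ),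
    h.isStable ρ (hM.pointOf_elementaryIdem_of_injOn ρ hρ)⟩

/-! Consequences of the Coxeter relations for the rotation matrices of a representation. -/

section Relations

variable {R : Type*} [CommRing R] [Algebra ℚ R] {ρ : M.Group →* PO3 R}

theorem HasLabelsTwoFour.isHalfTurn (hM : HasLabelsTwoFour M)
    (hρ : pointOf ρ (elementaryIdem M) = 1) (i : Fin n) : IsHalfTurn (repMat ρ (M.simple i)) :=
  ⟨repMat_mem _ _, by rw [← repMat_mul, simple_mul_self, repMat_one],
    (hM.pointOf_elementaryIdem_eq_one_iff ρ).1 hρ _ (Or.inl ⟨i, rfl⟩)⟩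

theorem HasLabelsTwoFour.mul_eq_zero (hM : HasLabelsTwoFour M)
    (hρ : pointOf ρ (elementaryIdem M) = 1) {i j : Fin n} (hij : M i j = 2)
    {P Q : Matrix (Fin 3) (Fin 3) R} (hP : IsLineProj P) (hQ : IsLineProj Q)
    (hi : repMat ρ (M.simple i) = 2 * P - 1) (hj : repMat ρ (M.simple j) = 2 * Q - 1) :
    P * Q = 0 := by
  have hne : i ≠ j := by rintro rfl; simp at hij
  have h1 := (hM.pointOf_elementaryIdem_eq_one_iff ρ).1 hρ _
    (Or.inr ⟨i, j, hne, by rw [hij]; norm_num, rfl⟩)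
  rw [hij, repMat_pow, repMat_mul, hi, hj, Nat.div_self (by norm_num), pow_one] at h1
  have h2 := congrArg (repMat ρ) (simple_mul_simple_pow (M := M) i j)
  rw [hij, repMat_pow, repMat_one, repMat_mul, hi, hj, pow_two] at h2
  exact hP.mul_eq_zero_of_commute hQ h2 h1

theorem HasLabelsTwoFour.two_mul_trace (hM : HasLabelsTwoFour M)
    (hρ : pointOf ρ (elementaryIdem M) = 1) {i j : Fin n} (hij : M i j = 4)
    {P Q : Matrix (Fin 3) (Fin 3) R} (hP : IsLineProj P) (hQ : IsLineProj Q)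
    (hi : repMat ρ (M.simple i) = 2 * P - 1) (hj : repMat ρ (M.simple j) = 2 * Q - 1) :
    2 * (P * Q).trace = 1 := by
  have hne : i ≠ j := by rintro rfl; simp at hij
  have h1 := (hM.pointOf_elementaryIdem_eq_one_iff ρ).1 hρ _
    (Or.inr ⟨i, j, hne, by rw [hij]; norm_num, rfl⟩)
  rw [hij, repMat_pow, show 4 / 2 = 2 by rfl] at h1
  have h2 := congrArg (repMat ρ) (simple_mul_simple_pow (M := M) i j)
  rw [hij, repMat_pow, repMat_one] at h2
  have h3 := trace_eq_one_of_order_four (repMat_mem ρ _) h2 h1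
  rw [repMat_mul, hi, hj, hP.trace_mul hQ] at h3
  apply two_cancel
  linear_combination h3

end Relations

end Idempotent

/-! ### Configurations of vectors built with cross products -/

section Terms

open Matrix

/-- Expressions for vectors in space, built from a standard frame and the vectors `(1, xᵢ, 0)`
by cross products. -/
inductive VecTerm (m : ℕ) : Type
  | axis (k : Fin 3) : VecTerm m
  | diag (k : Fin 2) : VecTerm m
  | var (i : Fin m) : VecTerm m
  | cross (a b : VecTerm m) : VecTerm m

namespace VecTerm

variable {m : ℕ}

/-- The value of an expression. -/
def eval {R : Type*} [CommRing R] (x : Fin m → R) : VecTerm m → Fin 3 → R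
  | axis k => axisVec k
  | diag k => diagVec k
  | var i => ![1, x i, 0]
  | cross a b => crossProduct (eval x a) (eval x b)

theorem map_eval {R S : Type*} [CommRing R] [CommRing S] (f : R →+* S) (x : Fin m → R)
    (t : VecTerm m) : f ∘ eval x t = eval (f ∘ x) t := by
  induction t with
  | axis k =>
    ext i; by_cases h : i = k <;> simp [eval, axisVec, h]
  | diag k =>
    ext i
    simp only [eval, diagVec, axisVec, Function.comp_apply, Pi.add_apply, map_add,
      Pi.single_apply, apply_ite f, map_one, map_zero]
  | var i => ext j; fin_cases j <;> simp [eval]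
  | cross a b iha ihb =>
    simp only [eval, ← iha, ← ihb]
    ext j
    fin_cases j <;> simp [cross_apply]

theorem cross_ne_left (a b : VecTerm m) : cross a b ≠ a := by
  intro h
  have := congrArg sizeOf h
  simp only [cross.sizeOf_spec] at this
  omega

theorem cross_ne_right (a b : VecTerm m) : cross a b ≠ b := by
  intro h
  have := congrArg sizeOf h
  simp only [cross.sizeOf_spec] at this
  omega

/-- The pairs of expressions whose values are orthogonal by construction, or are to be made
orthogonal by a relation. -/
inductive Orth (Rl : Set (VecTerm m)) : VecTerm m → VecTerm m → Prop
  | axis (i j : Fin 3) : i ≠ j → Orth Rl (axis i) (axis j)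
  | diag_zero : Orth Rl (diag 0) (axis 2)
  | diag_one : Orth Rl (diag 1) (axis 0)
  | var (i : Fin m) : Orth Rl (var i) (axis 2)
  | left (a b : VecTerm m) : Orth Rl (cross a b) a
  | right (a b : VecTerm m) : Orth Rl (cross a b) b
  | rel (a b : VecTerm m) : cross a b ∈ Rl → Orth Rl (cross a b) (axis 1)

/-- The pairs consisting of a bisector and one of the axes it bisects. -/
inductive Bisect : VecTerm m → VecTerm m → Prop
  | left (k : Fin 2) : Bisect (diag k) (axis k.castSucc)
  | right (k : Fin 2) : Bisect (diag k) (axis k.succ)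

theorem Orth.ne {Rl : Set (VecTerm m)} {s t : VecTerm m} (h : Orth Rl s t) : s ≠ t := by
  cases h with
  | axis i j hij => intro h; cases h; exact hij rfl
  | left a b => exact cross_ne_left _ _
  | right a b => exact cross_ne_right _ _
  | _ => intro h; cases h

/-- Labels 2 and 4 are never both requested for the same pair, so `label` honours every prescribed
condition. -/
theorem Orth.not_bisect {Rl : Set (VecTerm m)} {s t : VecTerm m} (h : Orth Rl s t) :
    ¬(Bisect s t ∨ Bisect t s) := by
  rintro (h' | h')
  · generalize hs : s = s' at h'
    generalize ht : t = t' at h'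
    cases h' with
    | left k => cases h <;> fin_cases k <;> simp_all
    | right k => cases h <;> fin_cases k <;> simp_all
  · generalize hs : s = s' at h'
    generalize ht : t = t' at h'
    cases h' with
    | left k => cases h <;> fin_cases k <;> simp_all
    | right k => cases h <;> fin_cases k <;> simp_all

theorem Bisect.ne {s t : VecTerm m} (h : Bisect s t) : s ≠ t := by
  cases h <;> intro h <;> cases h

theorem Orth.dot_eq_zero {Rl : Set (VecTerm m)} {s t : VecTerm m} (h : Orth Rl s t) {R : Type*}
    [CommRing R] {x : Fin m → R} (hx : ∀ r ∈ Rl, eval x r 1 = 0) : eval x s ⬝ᵥ eval x t = 0 := by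
  cases h with
  | axis i j hij => simp [eval, axisVec_dot, hij]
  | diag_zero => simp [eval, diagVec, axisVec_dot]
  | diag_one => simp [eval, diagVec, axisVec_dot]
  | var i => simp [eval, axisVec]
  | left a b => rw [eval, dotProduct_comm, dot_self_cross]
  | right a b => rw [eval, dotProduct_comm, dot_cross_self]
  | rel a b h => simpa [eval, axisVec] using hx _ h

/-- This is cos² = 1/2 cleared of denominators, the form in which label 4 is verified. -/
theorem Bisect.dot {s t : VecTerm m} (h : Bisect s t) {R : Type*} [CommRing R] (x : Fin m → R) :
    2 * (eval x s ⬝ᵥ eval x t) ^ 2 = (eval x s ⬝ᵥ eval x s) * (eval x t ⬝ᵥ eval x t) := by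
  cases h with
  | left k =>
    simp only [eval, diagVec_dot, axisVec_dot]
    fin_cases k <;> simp [diagVec, axisVec_dot]
  | right k =>
    simp only [eval, diagVec_dot, axisVec_dot]
    fin_cases k <;> simp [diagVec, axisVec_dot]

open Classical in
/-- The Coxeter label of a pair of expressions. -/
def label (Rl : Set (VecTerm m)) (s t : VecTerm m) : ℕ :=
  if s = t then 1 else if Bisect s t ∨ Bisect t s then 4
    else if Orth Rl s t ∨ Orth Rl t s then 2 else 0

variable (Rl : Set (VecTerm m))

theorem label_self (s : VecTerm m) : label Rl s s = 1 := by simp [label]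

theorem label_comm (s t : VecTerm m) : label Rl s t = label Rl t s := by
  grind [label]

theorem label_cases {s t : VecTerm m} (h : s ≠ t) :
    label Rl s t = 0 ∨ label Rl s t = 2 ∨ label Rl s t = 4 := by
  unfold label
  split_ifs <;> simp_all

variable {Rl}

theorem Bisect.label_eq {s t : VecTerm m} (h : Bisect s t) : label Rl s t = 4 := by
  simp [label, h.ne, h]

theorem Orth.label_eq {s t : VecTerm m} (h : Orth Rl s t) : label Rl s t = 2 := by
  rw [label, if_neg h.ne, if_neg h.not_bisect, if_pos (Or.inl h)]

theorem dot_eq_zero_of_label {s t : VecTerm m} (h : label Rl s t = 2) {R : Type*}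
    [CommRing R] {x : Fin m → R} (hx : ∀ r ∈ Rl, eval x r 1 = 0) : eval x s ⬝ᵥ eval x t = 0 := by
  unfold label at h
  split_ifs at h with h1 h2 h3 <;> try omega
  rcases h3 with h3 | h3
  · exact h3.dot_eq_zero hx
  · rw [dotProduct_comm]; exact h3.dot_eq_zero hx

theorem dot_of_label {s t : VecTerm m} (h : label Rl s t = 4) {R : Type*}
    [CommRing R] (x : Fin m → R) :
    2 * (eval x s ⬝ᵥ eval x t) ^ 2 = (eval x s ⬝ᵥ eval x s) * (eval x t ⬝ᵥ eval x t) := by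
  unfold label at h
  split_ifs at h with h1 h2 h3 <;> try omega
  rcases h2 with h2 | h2
  · exact h2.dot x
  · rw [dotProduct_comm (eval x s) (eval x t), h2.dot x, mul_comm]

end VecTerm

/-- A finite set of vector expressions closed under subexpressions, with a set of relations. -/
structure Config (m : ℕ) where
  /-- the expressions -/
  terms : Finset (VecTerm m)
  /-- the expressions whose second coordinate is required to vanish -/
  rels : Set (VecTerm m)
  axis_mem : ∀ k, .axis k ∈ terms
  diag_mem : ∀ k, .diag k ∈ terms
  var_mem : ∀ i, .var i ∈ terms
  left_mem : ∀ a b, .cross a b ∈ terms → a ∈ terms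
  right_mem : ∀ a b, .cross a b ∈ terms → b ∈ terms
  rels_subset : ∀ t ∈ rels, t ∈ terms
  rels_cross : ∀ t ∈ rels, ∃ a b, t = .cross a b

namespace Config

variable {m : ℕ} (c : Config m)

/-- The enumeration of the expressions. -/
def term (i : Fin c.terms.card) : VecTerm m := (c.terms.equivFin.symm i).1

theorem term_mem (i : Fin c.terms.card) : c.term i ∈ c.terms := (c.terms.equivFin.symm i).2

theorem term_injective : Function.Injective c.term := fun _ _ h =>
  c.terms.equivFin.symm.injective (Subtype.ext h)

theorem exists_term_eq {t : VecTerm m} (ht : t ∈ c.terms) : ∃ i, c.term i = t :=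
  ⟨c.terms.equivFin ⟨t, ht⟩, by simp [term]⟩

/-- The Coxeter matrix of a configuration. -/
def coxeter : CoxeterMatrix (Fin c.terms.card) where
  M := Matrix.of fun i j => VecTerm.label c.rels (c.term i) (c.term j)
  isSymm := by
    ext i j
    exact VecTerm.label_comm _ _ _
  diagonal i := VecTerm.label_self _ _
  off_diagonal i j h := by
    rcases VecTerm.label_cases c.rels (c.term_injective.ne h) with h' | h' | h' <;>
      simp [h']

theorem hasLabels : HasLabelsTwoFour c.coxeter := fun _ _ h =>
  VecTerm.label_cases c.rels (c.term_injective.ne h)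

open Classical in
/-- The generator attached to an expression. -/
def gen (t : VecTerm m) : c.coxeter.Group :=
  if h : t ∈ c.terms then c.coxeter.simple (c.terms.equivFin ⟨t, h⟩) else 1

theorem gen_term (i : Fin c.terms.card) : c.gen (c.term i) = c.coxeter.simple i := by
  have : (⟨c.term i, c.term_mem i⟩ : {t // t ∈ c.terms}) = c.terms.equivFin.symm i := rfl
  rw [gen, dif_pos (c.term_mem i), this, Equiv.apply_symm_apply]

/-! The slice of the representations mapping the frame to the standard one. -/

variable {R : Type*} [CommRing R] [Algebra ℚ R] {ρ : c.coxeter.Group →* PO3 R}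

variable {c}

theorem isHalfTurn (hρ : pointOf ρ (elementaryIdem c.coxeter) = 1) {t : VecTerm m}
    (ht : t ∈ c.terms) : IsHalfTurn (repMat ρ (c.gen t)) := by
  obtain ⟨i, rfl⟩ := c.exists_term_eq ht
  rw [gen_term]
  exact c.hasLabels.isHalfTurn hρ i

theorem mul_eq_zero (hρ : pointOf ρ (elementaryIdem c.coxeter) = 1) {s t : VecTerm m}
    (hs : s ∈ c.terms) (ht : t ∈ c.terms) (hst : VecTerm.Orth c.rels s t)
    {P Q : Matrix (Fin 3) (Fin 3) R} (hP : IsLineProj P) (hQ : IsLineProj Q)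
    (hi : repMat ρ (c.gen s) = 2 * P - 1) (hj : repMat ρ (c.gen t) = 2 * Q - 1) :
    P * Q = 0 := by
  obtain ⟨i, rfl⟩ := c.exists_term_eq hs
  obtain ⟨j, rfl⟩ := c.exists_term_eq ht
  rw [gen_term] at hi hj
  exact c.hasLabels.mul_eq_zero hρ hst.label_eq hP hQ hi hj

theorem two_mul_trace (hρ : pointOf ρ (elementaryIdem c.coxeter) = 1) {s t : VecTerm m}
    (hs : s ∈ c.terms) (ht : t ∈ c.terms) (hst : VecTerm.Bisect s t)
    {P Q : Matrix (Fin 3) (Fin 3) R} (hP : IsLineProj P) (hQ : IsLineProj Q)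
    (hi : repMat ρ (c.gen s) = 2 * P - 1) (hj : repMat ρ (c.gen t) = 2 * Q - 1) :
    2 * (P * Q).trace = 1 := by
  obtain ⟨i, rfl⟩ := c.exists_term_eq hs
  obtain ⟨j, rfl⟩ := c.exists_term_eq ht
  rw [gen_term] at hi hj
  exact c.hasLabels.two_mul_trace hρ hst.label_eq hP hQ hi hj

variable (c)

/-- The ideal of the representations in `Hom_o` mapping the frame to the standard one. -/
def sliceIdeal : Ideal (RepRing c.coxeter.Group) :=
  Ideal.span ({1 - elementaryIdem c.coxeter} ∪
    {a | ∃ k i j, a = univMatrix _ (c.gen (.axis k)) i j - halfTurn (axisVec k) i j} ∪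
    {a | ∃ k i j, a = univMatrix _ (c.gen (.diag k)) i j - halfTurn (diagVec k) i j})

theorem map_axisVec {S T : Type*} [CommRing S] [CommRing T] (f : S →+* T) (k : Fin 3) :
    f ∘ (axisVec k : Fin 3 → S) = axisVec k :=
  VecTerm.map_eval f (fun i : Fin 0 => i.elim0) (.axis k)

theorem map_diagVec {S T : Type*} [CommRing S] [CommRing T] (f : S →+* T) (k : Fin 2) :
    f ∘ (diagVec k : Fin 3 → S) = diagVec k :=
  VecTerm.map_eval f (fun i : Fin 0 => i.elim0) (.diag k)

/-- The representations in `Hom_o` mapping the frame to the standard one. -/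
structure IsNormalized (ρ : c.coxeter.Group →* PO3 R) : Prop where
  idem : pointOf ρ (elementaryIdem c.coxeter) = 1
  axis : ∀ k, repMat ρ (c.gen (.axis k)) = halfTurn (axisVec k)
  diag : ∀ k, repMat ρ (c.gen (.diag k)) = halfTurn (diagVec k)

theorem isNormalized_iff (ρ : c.coxeter.Group →* PO3 R) :
    c.IsNormalized ρ ↔ ∀ a ∈ c.sliceIdeal, pointOf ρ a = 0 := by
  have haxis : ∀ k i j, pointOf ρ (univMatrix _ (c.gen (.axis k)) i j - halfTurn (axisVec k) i j)
      = repMat ρ (c.gen (.axis k)) i j - halfTurn (axisVec k) i j := by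
    intro k i j
    rw [map_sub, pointOf_univMatrix_apply]
    congr 1
    have := map_halfTurn (pointOf ρ).toRingHom (isUnit_axisVec (R := RepRing c.coxeter.Group) k)
    rw [map_axisVec] at this
    exact congrFun (congrFun this i) j
  have hdiag : ∀ k i j, pointOf ρ (univMatrix _ (c.gen (.diag k)) i j - halfTurn (diagVec k) i j)
      = repMat ρ (c.gen (.diag k)) i j - halfTurn (diagVec k) i j := by
    intro k i j
    rw [map_sub, pointOf_univMatrix_apply]
    congr 1
    have := map_halfTurn (pointOf ρ).toRingHom (isUnit_diagVec (R := RepRing c.coxeter.Group) k)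
    rw [map_diagVec] at this
    exact congrFun (congrFun this i) j
  constructor
  · intro h
    have key : c.sliceIdeal ≤ RingHom.ker (pointOf ρ) := by
      rw [sliceIdeal, Ideal.span_le]
      rintro a ((rfl | ⟨k, i, j, rfl⟩) | ⟨k, i, j, rfl⟩)
      · change pointOf ρ _ = 0
        rw [map_sub, map_one, h.idem, sub_self]
      · change pointOf ρ _ = 0
        rw [haxis, h.axis, sub_self]
      · change pointOf ρ _ = 0
        rw [hdiag, h.diag, sub_self]
    exact fun a ha => key ha
  · intro h
    refine ⟨?_, fun k => ?_, fun k => ?_⟩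
    · have := h (1 - elementaryIdem c.coxeter) (Ideal.subset_span (Or.inl (Or.inl rfl)))
      rw [map_sub, map_one, sub_eq_zero] at this
      exact this.symm
    · ext i j
      rw [← sub_eq_zero, ← haxis]
      exact h _ (Ideal.subset_span (Or.inl (Or.inr ⟨k, i, j, rfl⟩)))
    · ext i j
      rw [← sub_eq_zero, ← hdiag]
      exact h _ (Ideal.subset_span (Or.inr ⟨k, i, j, rfl⟩))

theorem exists_isNormalized (hρ : pointOf ρ (elementaryIdem c.coxeter) = 1) :
    ∃ g, ∀ a ∈ c.sliceIdeal, pointOf (conjRep g ρ) a = 0 := by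
  choose P hP hPe using fun k => (isHalfTurn hρ (c.axis_mem k)).exists_proj
  choose D hD hDe using fun k => (isHalfTurn hρ (c.diag_mem k)).exists_proj
  have hframe : IsFrame P D :=
    { axis := hP
      diag := hD
      orth := fun i j hij => mul_eq_zero hρ (c.axis_mem i) (c.axis_mem j) (.axis i j hij)
        (hP i) (hP j) (hPe i) (hPe j)
      orth_zero := mul_eq_zero hρ (c.diag_mem 0) (c.axis_mem 2) .diag_zero (hD 0) (hP 2) (hDe 0)
        (hPe 2)
      orth_one := mul_eq_zero hρ (c.diag_mem 1) (c.axis_mem 0) .diag_one (hD 1) (hP 0) (hDe 1)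
        (hPe 0)
      bisect_left := fun k => two_mul_trace hρ (c.diag_mem k) (c.axis_mem _) (.left k) (hD k)
        (hP _) (hDe k) (hPe _)
      bisect_right := fun k => two_mul_trace hρ (c.diag_mem k) (c.axis_mem _) (.right k) (hD k)
        (hP _) (hDe k) (hPe _) }
  obtain ⟨g, hg, hgP, hgD⟩ := hframe.exists_rotation
  -- The rotation g carries the standard frame to the given one; its inverse gᵀ normalizes the
  -- representation.
  have hgt : gᵀ ∈ specialOrthogonalGroup (Fin 3) R :=
    mem_of_eqs (by rw [transpose_transpose, transpose_mul_of_mem hg])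
      (by rw [det_transpose, det_of_mem hg])
  refine ⟨PO3.equivSO.symm ⟨gᵀ, hgt⟩, (c.isNormalized_iff _).1 ⟨?_, fun k => ?_, fun k => ?_⟩⟩
  · rw [c.hasLabels.pointOf_elementaryIdem_eq_one_iff] at hρ ⊢
    intro γ hγ
    rw [trace_repMat_conjRep, hρ γ hγ]
  · rw [repMat_conjRep, hPe, hgP, MulEquiv.apply_symm_apply]
    change gᵀ * halfTurn _ * gᵀᵀ = _
    rw [conj_halfTurn hgt, mulVec_mulVec, transpose_mul_of_mem hg, one_mulVec]
  · rw [repMat_conjRep, hDe, hgD, MulEquiv.apply_symm_apply]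
    change gᵀ * halfTurn _ * gᵀᵀ = _
    rw [conj_halfTurn hgt, mulVec_mulVec, transpose_mul_of_mem hg, one_mulVec]

theorem eq_one_of_isNormalized {g : PO3 R} (h1 : c.IsNormalized ρ)
    (h2 : c.IsNormalized (conjRep g ρ)) : g = 1 := by
  have cancel : ∀ v w : Fin 3 → R, halfTurn v = halfTurn w → lineProj v = lineProj w := by
    intro v w h
    apply matrix_two_cancel
    exact sub_left_injective h
  apply PO3.equivSO.injective
  rw [map_one]
  apply Subtype.ext
  refine eq_one_of_fixes_frame (PO3.equivSO g).2 (fun k => cancel _ _ ?_) (fun k => cancel _ _ ?_)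
  · rw [← conj_halfTurn (PO3.equivSO g).2, ← h1.axis, ← repMat_conjRep, h2.axis, h1.axis]
  · rw [← conj_halfTurn (PO3.equivSO g).2, ← h1.diag, ← repMat_conjRep, h2.diag, h1.diag]

theorem isSlice : IsSlice (elementaryIdem c.coxeter) c.sliceIdeal where
  idem := c.hasLabels.elementaryIdem_mul_self
  inv := elementaryIdem_mem_charRing
  mem := Ideal.subset_span (Or.inl (Or.inl rfl))
  exists_conj _ _ _ _ hρ := c.exists_isNormalized hρ
  unique _ _ _ _ _ h1 h2 :=
    c.eq_one_of_isNormalized ((c.isNormalized_iff _).2 h1) ((c.isNormalized_iff _).2 h2)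

end Config

end Terms

/-! ### The slice and the solutions of the relations -/

section Realization

open Matrix

set_option linter.unusedSectionVars false

namespace Config

variable {m : ℕ} (c : Config m)

/-- The tuples satisfying the relations of the configuration, at which all the vectors of the
configuration are nondegenerate. -/
structure IsSolution {R : Type*} [CommRing R] (x : Fin m → R) : Prop where
  isUnit : ∀ t ∈ c.terms, IsUnit (t.eval x ⬝ᵥ t.eval x)
  rel : ∀ t ∈ c.rels, t.eval x 1 = 0

variable {c} {R : Type*} [CommRing R]

theorem IsSolution.map {S : Type*} [CommRing S] (f : R →+* S) {x : Fin m → R}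
    (hx : c.IsSolution x) : c.IsSolution (f ∘ x) := by
  refine ⟨fun t ht => ?_, fun t ht => ?_⟩
  · rw [← VecTerm.map_eval]
    have : f (t.eval x ⬝ᵥ t.eval x) = (f ∘ t.eval x) ⬝ᵥ (f ∘ t.eval x) :=
      RingHom.map_dotProduct f _ _
    rw [← this]
    exact (hx.isUnit t ht).map f
  · rw [← VecTerm.map_eval, Function.comp_apply, hx.rel t ht, map_zero]

variable [Algebra ℚ R]

theorem halfTurn_mem {v : Fin 3 → R} (hv : IsUnit (v ⬝ᵥ v)) :
    halfTurn v ∈ specialOrthogonalGroup (Fin 3) R :=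
  (lineProj_isLineProj hv).isHalfTurn.mem

theorem halfTurn_relation_two {v w : Fin 3 → R} (hv : IsUnit (v ⬝ᵥ v)) (hw : IsUnit (w ⬝ᵥ w))
    (h : v ⬝ᵥ w = 0) :
    (halfTurn v * halfTurn w) ^ 2 = 1 ∧ (halfTurn v * halfTurn w).trace = -1 := by
  have := (lineProj_isLineProj hv).prod_of_mul_eq_zero (lineProj_isLineProj hw)
    (lineProj_mul_eq_zero h)
  exact ⟨by rw [pow_two]; exact this.1, this.2⟩

theorem halfTurn_relation_four {v w : Fin 3 → R} (hv : IsUnit (v ⬝ᵥ v)) (hw : IsUnit (w ⬝ᵥ w))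
    (h : 2 * (v ⬝ᵥ w) ^ 2 = (v ⬝ᵥ v) * (w ⬝ᵥ w)) :
    (halfTurn v * halfTurn w) ^ 4 = 1 ∧ ((halfTurn v * halfTurn w) ^ 2).trace = -1 := by
  refine order_four_of_trace_eq_one (mul_mem (halfTurn_mem hv) (halfTurn_mem hw)) ?_
  rw [halfTurn, halfTurn, (lineProj_isLineProj hv).trace_mul (lineProj_isLineProj hw),
    trace_lineProj_mul]
  linear_combination 2 * Ring.inverse (v ⬝ᵥ v) * Ring.inverse (w ⬝ᵥ w) * h
    + 2 * Ring.inverse (w ⬝ᵥ w) * (w ⬝ᵥ w) * Ring.inverse_mul_cancel _ hv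
    + 2 * Ring.inverse_mul_cancel _ hw

namespace IsSolution

variable {x : Fin m → R} (hx : c.IsSolution x)

/-- The images of the generators. -/
def genImage (i : Fin c.terms.card) : PO3 R :=
  PO3.equivSO.symm ⟨halfTurn ((c.term i).eval x), halfTurn_mem (hx.isUnit _ (c.term_mem i))⟩

theorem equivSO_genImage (i : Fin c.terms.card) :
    (PO3.equivSO (hx.genImage i)).1 = halfTurn ((c.term i).eval x) := by
  rw [genImage, MulEquiv.apply_symm_apply]

theorem isLiftable : c.coxeter.IsLiftable hx.genImage := by
  intro i j
  apply PO3.equivSO.injective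
  apply Subtype.ext
  rw [map_pow, map_mul, map_one]
  simp only [SubmonoidClass.coe_pow, Submonoid.coe_mul, Submonoid.coe_one, equivSO_genImage]
  have hi := hx.isUnit _ (c.term_mem i)
  have hj := hx.isUnit _ (c.term_mem j)
  by_cases hij : i = j
  · subst hij
    rw [c.coxeter.diagonal, pow_one]
    exact (lineProj_isLineProj hi).isHalfTurn.sq
  · rcases c.hasLabels i j hij with h | h | h
    · rw [h, pow_zero]
    · rw [h]
      exact (halfTurn_relation_two hi hj (VecTerm.dot_eq_zero_of_label h hx.rel)).1
    · rw [h]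
      exact (halfTurn_relation_four hi hj (VecTerm.dot_of_label h x)).1

/-- The representation attached to a solution. -/
def rep : c.coxeter.Group →* PO3 R := c.coxeter.toCoxeterSystem.lift ⟨hx.genImage, hx.isLiftable⟩

theorem repMat_rep_simple (i : Fin c.terms.card) :
    repMat hx.rep (c.coxeter.simple i) = halfTurn ((c.term i).eval x) := by
  have : hx.rep (c.coxeter.simple i) = hx.genImage i :=
    c.coxeter.toCoxeterSystem.lift_apply_simple hx.isLiftable i
  rw [repMat, this, equivSO_genImage]

theorem repMat_rep {t : VecTerm m} (ht : t ∈ c.terms) :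
    repMat hx.rep (c.gen t) = halfTurn (t.eval x) := by
  obtain ⟨i, rfl⟩ := c.exists_term_eq ht
  rw [gen_term, repMat_rep_simple]

theorem isNormalized : c.IsNormalized hx.rep := by
  refine ⟨?_, fun k => hx.repMat_rep (c.axis_mem k), fun k => hx.repMat_rep (c.diag_mem k)⟩
  rw [c.hasLabels.pointOf_elementaryIdem_eq_one_iff]
  rintro γ (⟨i, rfl⟩ | ⟨i, j, hij, h0, rfl⟩)
  · rw [repMat_rep_simple]
    exact (lineProj_isLineProj (hx.isUnit _ (c.term_mem i))).isHalfTurn.trace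
  · rw [repMat_pow, repMat_mul, repMat_rep_simple, repMat_rep_simple]
    have hi := hx.isUnit _ (c.term_mem i)
    have hj := hx.isUnit _ (c.term_mem j)
    rcases c.hasLabels i j hij with h | h | h
    · exact absurd h h0
    · rw [h, Nat.div_self (by norm_num), pow_one]
      exact (halfTurn_relation_two hi hj (VecTerm.dot_eq_zero_of_label h hx.rel)).2
    · rw [h]
      exact (halfTurn_relation_four hi hj (VecTerm.dot_of_label h x)).2

end IsSolution

variable (c)

/-- The function whose nonvanishing makes an expression determine its line. -/
def factor : VecTerm m → RepRing c.coxeter.Group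
  | .var i => 1 + univMatrix _ (c.gen (.var i)) 0 0
  | .cross a b => 3 - (univMatrix _ (c.gen a * c.gen b)).trace
  | _ => 1

/-- The function on the representation scheme whose nonvanishing makes the configuration
generic. -/
def generic : RepRing c.coxeter.Group := ∏ t ∈ c.terms, c.factor t

variable {c}

theorem IsSolution.isUnit_generic {x : Fin m → R} (hx : c.IsSolution x) :
    IsUnit (pointOf hx.rep c.generic) := by
  have h2 : IsUnit (2 : R) := by simpa using isUnit_ofNat_of_rat (R := R) 2 (by norm_num)
  rw [generic, map_prod, IsUnit.prod_iff]
  intro t ht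
  cases t with
  | axis k => simp [factor]
  | diag k => simp [factor]
  | var i =>
    have hu := hx.isUnit _ ht
    rw [factor, map_add, map_one, pointOf_univMatrix_apply, hx.repMat_rep ht]
    have : 1 + halfTurn (VecTerm.eval x (.var i)) 0 0
        = 2 * Ring.inverse (VecTerm.eval x (.var i) ⬝ᵥ VecTerm.eval x (.var i)) := by
      rw [halfTurn, two_mul (lineProj _)]
      simp only [Matrix.sub_apply, Matrix.add_apply, lineProj, Matrix.smul_apply, vecMulVec_apply,
        one_apply_eq, VecTerm.eval, cons_val_zero, smul_eq_mul]
      ring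
    rw [this]
    exact h2.mul hu.ringInverse
  | cross a b =>
    rw [factor, map_sub, map_ofNat, pointOf_trace, repMat_mul, hx.repMat_rep (c.left_mem a b ht),
      hx.repMat_rep (c.right_mem a b ht),
      isUnit_three_sub_trace_iff (hx.isUnit _ (c.left_mem a b ht))
        (hx.isUnit _ (c.right_mem a b ht))]
    exact hx.isUnit _ ht

/-- The coordinates read off from a representation. -/
def coords (ρ : c.coxeter.Group →* PO3 R) (i : Fin m) : R :=
  Ring.inverse (1 + repMat ρ (c.gen (.var i)) 0 0) * repMat ρ (c.gen (.var i)) 0 1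

/-- For v = (1, xᵢ, 0) and q = 1/(v · v) the half-turn has entries 2q − 1 and 2q xᵢ at the start of
its first row, so the ratio in `coords` returns xᵢ. -/
theorem IsSolution.coords_rep {x : Fin m → R} (hx : c.IsSolution x) : coords hx.rep = x := by
  funext i
  have hu := hx.isUnit _ (c.var_mem i)
  have h2 : IsUnit (2 : R) := by simpa using isUnit_ofNat_of_rat (R := R) 2 (by norm_num)
  rw [coords, hx.repMat_rep (c.var_mem i)]
  obtain ⟨q, hq⟩ : ∃ q, q = Ring.inverse (VecTerm.eval x (.var i) ⬝ᵥ VecTerm.eval x (.var i)) :=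
    ⟨_, rfl⟩
  have h00 : 1 + halfTurn (VecTerm.eval x (.var i)) 0 0 = 2 * q := by
    rw [halfTurn, two_mul (lineProj _), hq]
    simp only [Matrix.sub_apply, Matrix.add_apply, lineProj, Matrix.smul_apply, vecMulVec_apply,
      one_apply_eq, VecTerm.eval, cons_val_zero, smul_eq_mul]
    ring
  have h01 : halfTurn (VecTerm.eval x (.var i)) 0 1 = 2 * q * x i := by
    rw [halfTurn, two_mul (lineProj _), hq]
    simp only [Matrix.sub_apply, Matrix.add_apply, lineProj, Matrix.smul_apply, vecMulVec_apply,
      VecTerm.eval, cons_val_zero, cons_val_one, smul_eq_mul, one_apply_ne (zero_ne_one)]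
    ring
  have hqu : IsUnit (2 * q) := by rw [hq]; exact h2.mul hu.ringInverse
  rw [h00, h01, ← mul_assoc, Ring.inverse_mul_cancel _ hqu, one_mul]

theorem isUnit_factor {ρ : c.coxeter.Group →* PO3 R} (hg : IsUnit (pointOf ρ c.generic))
    {t : VecTerm m} (ht : t ∈ c.terms) : IsUnit (pointOf ρ (c.factor t)) := by
  rw [generic, map_prod, IsUnit.prod_iff] at hg
  exact hg t ht

/-- A generic normalized representation is determined by its coordinates. -/
theorem IsNormalized.repMat_eq {ρ : c.coxeter.Group →* PO3 R} (hρ : c.IsNormalized ρ)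
    (hg : IsUnit (pointOf ρ c.generic)) (t : VecTerm m) (ht : t ∈ c.terms) :
    IsUnit (t.eval (coords ρ) ⬝ᵥ t.eval (coords ρ)) ∧
      repMat ρ (c.gen t) = halfTurn (t.eval (coords ρ)) := by
  induction t with
  | axis k => exact ⟨isUnit_axisVec k, hρ.axis k⟩
  | diag k => exact ⟨isUnit_diagVec k, hρ.diag k⟩
  | var i =>
    obtain ⟨P, hP, hPe⟩ := (isHalfTurn hρ.idem ht).exists_proj
    have hz := mulVec_eq_zero_of_mul_lineProj (isUnit_axisVec 2) (mul_eq_zero hρ.idem ht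
      (c.axis_mem 2) (.var i) hP (lineProj_isLineProj (isUnit_axisVec 2)) hPe (hρ.axis 2))
    have hf := isUnit_factor hg ht
    rw [factor, map_add, map_one, pointOf_univMatrix_apply, hPe] at hf
    have e0 : 1 + (2 * P - 1 : Matrix (Fin 3) (Fin 3) R) 0 0 = 2 * P 0 0 := by
      rw [two_mul P]; simp; ring
    have e1 : (2 * P - 1 : Matrix (Fin 3) (Fin 3) R) 0 1 = 2 * P 0 1 := by
      rw [two_mul P]; simp; ring
    rw [e0] at hf
    have h0 : IsUnit (P 0 0) := isUnit_of_mul_isUnit_right hf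
    have hc : coords ρ i = Ring.inverse (P 0 0) * P 0 1 := by
      rw [coords, hPe, e0, e1]
      refine hf.mul_left_cancel ?_
      rw [← mul_assoc, Ring.mul_inverse_cancel _ hf, mul_assoc, ← mul_assoc (P 0 0),
        Ring.mul_inverse_cancel _ h0]
      ring
    have := hP.eq_lineProj_var hz h0
    rw [← hc] at this
    exact ⟨this.1, by rw [hPe, halfTurn]; congr 2; exact this.2⟩
  | cross a b iha ihb =>
    have ha := c.left_mem a b ht
    have hb := c.right_mem a b ht
    obtain ⟨ua, ea⟩ := iha ha
    obtain ⟨ub, eb⟩ := ihb hb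
    have hf := isUnit_factor hg ht
    rw [factor, map_sub, map_ofNat, pointOf_trace, repMat_mul, ea, eb,
      isUnit_three_sub_trace_iff ua ub] at hf
    refine ⟨hf, ?_⟩
    obtain ⟨P, hP, hPe⟩ := (isHalfTurn hρ.idem ht).exists_proj
    have za := mulVec_eq_zero_of_mul_lineProj ua (mul_eq_zero hρ.idem ht ha (.left a b) hP
      (lineProj_isLineProj ua) hPe ea)
    have zb := mulVec_eq_zero_of_mul_lineProj ub (mul_eq_zero hρ.idem ht hb (.right a b) hP
      (lineProj_isLineProj ub) hPe eb)
    rw [hPe, halfTurn]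
    congr 2
    exact hP.eq_lineProj_cross za zb hf

theorem IsNormalized.isSolution {ρ : c.coxeter.Group →* PO3 R} (hρ : c.IsNormalized ρ)
    (hg : IsUnit (pointOf ρ c.generic)) : c.IsSolution (coords ρ) := by
  refine ⟨fun t ht => (hρ.repMat_eq hg t ht).1, fun t ht => ?_⟩
  have htm := c.rels_subset t ht
  obtain ⟨a, b, rfl⟩ := c.rels_cross t ht
  obtain ⟨u, e⟩ := hρ.repMat_eq hg _ htm
  have hz := mul_eq_zero hρ.idem htm (c.axis_mem 1) (.rel a b ht) (lineProj_isLineProj u)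
    (lineProj_isLineProj (isUnit_axisVec 1)) e (hρ.axis 1)
  have h1 := mulVec_eq_zero_of_mul_lineProj (isUnit_axisVec 1) hz
  generalize VecTerm.eval (coords ρ) (.cross a b) = v at *
  -- Pairing the projection of the second basis vector to the line of v with v itself leaves the
  -- second coordinate of v.
  have h2 := congrArg (fun w => v ⬝ᵥ w) h1
  simp only [lineProj, smul_mulVec, vecMulVec_mulVec, dotProduct_zero] at h2
  have h3 := Ring.inverse_mul_cancel _ u
  simp only [dotProduct_smul, smul_eq_mul, MulOpposite.smul_eq_mul_unop, MulOpposite.unop_op] at h2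
  have h4 : v ⬝ᵥ axisVec 1 = v 1 := by simp [axisVec]
  rw [h4] at h2
  linear_combination h2 - v 1 * h3

theorem repMat_ext {ρ σ : c.coxeter.Group →* PO3 R}
    (h : ∀ t ∈ c.terms, repMat ρ (c.gen t) = repMat σ (c.gen t)) : ρ = σ := by
  apply c.coxeter.toCoxeterSystem.ext_simple
  intro i
  apply PO3.equivSO.injective
  apply Subtype.ext
  have := h _ (c.term_mem i)
  rwa [gen_term] at this

theorem IsNormalized.eq_rep {ρ : c.coxeter.Group →* PO3 R} (hρ : c.IsNormalized ρ)
    (hg : IsUnit (pointOf ρ c.generic)) : ρ = (hρ.isSolution hg).rep :=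
  repMat_ext fun t ht => by
    rw [(hρ.repMat_eq hg t ht).2, IsSolution.repMat_rep _ ht]

theorem IsSolution.rep_congr {x y : Fin m → R} (hx : c.IsSolution x) (hy : c.IsSolution y)
    (h : x = y) : hx.rep = hy.rep := by
  subst h; rfl

theorem IsSolution.map_rep {S : Type*} [CommRing S] [Algebra ℚ S] (f : R →ₐ[ℚ] S) {x : Fin m → R}
    (hx : c.IsSolution x) :
    (PO3.map (f : R →+* S)).comp hx.rep = (hx.map (f : R →+* S)).rep := by
  refine repMat_ext fun t ht => ?_
  rw [IsSolution.repMat_rep _ ht, repMat, MonoidHom.comp_apply, PO3.equivSO_map]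
  have := hx.repMat_rep ht
  rw [repMat] at this
  rw [this, map_halfTurn _ (hx.isUnit t ht), VecTerm.map_eval]

end Config

end Realization

/-! ### The nondegenerate locus of Spec B as an open part of the slice -/

section OpenImmersion

open Matrix

/-- φ becomes an isomorphism after inverting f. Only one of the two inverse identities is assumed;
the other is automatic because maps out of a localization are determined on A. -/
theorem isOpenImmersion_of_away {A D : Type} [CommRing A] [CommRing D] (φ : A →+* D) (f : A)
    (hf : IsUnit (φ f)) (ψ : D →+* Localization.Away f)
    (h1 : ψ.comp φ = algebraMap A (Localization.Away f))
    (h2 : (IsLocalization.Away.lift (S := Localization.Away f) f hf).comp ψ = RingHom.id D) :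
    IsOpenImmersion (Spec.map (CommRingCat.ofHom φ)) := by
  have h3 : ψ.comp (IsLocalization.Away.lift (S := Localization.Away f) f hf)
      = RingHom.id (Localization.Away f) := by
    refine IsLocalization.ringHom_ext (Submonoid.powers f) ?_
    rw [RingHom.comp_assoc, IsLocalization.Away.lift_comp, h1, RingHom.id_comp]
  let E : Localization.Away f ≃+* D := RingEquiv.ofRingHom _ ψ h2 h3
  have h4 : CommRingCat.ofHom φ = CommRingCat.ofHom (algebraMap A (Localization.Away f)) ≫
      E.toCommRingCatIso.hom := by
    ext a
    exact (IsLocalization.Away.lift_eq f hf a).symm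
  rw [h4, Spec.map_comp]
  have : IsOpenImmersion (Spec.map (CommRingCat.ofHom (algebraMap A (Localization.Away f)))) :=
    IsOpenImmersion.of_isLocalization f
  infer_instance

namespace Config

variable {m : ℕ} {c : Config m} {B : Type} [CommRing B] {x : Fin m → B}

variable (c x) in
/-- The locus where all vectors of the configuration are nondegenerate. -/
def nondegenerate : B := ∏ t ∈ c.terms, t.eval x ⬝ᵥ t.eval x

theorem isSolution_of_isUnit {S : Type*} [CommRing S] (f : B →+* S)
    (hf : IsUnit (f (nondegenerate c x))) (hrel : ∀ t ∈ c.rels, t.eval x 1 = 0) :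
    c.IsSolution (f ∘ x) := by
  refine ⟨fun t ht => ?_, fun t ht => ?_⟩
  · rw [nondegenerate, map_prod, IsUnit.prod_iff] at hf
    rw [← VecTerm.map_eval]
    have : f (t.eval x ⬝ᵥ t.eval x) = (f ∘ t.eval x) ⬝ᵥ (f ∘ t.eval x) :=
      RingHom.map_dotProduct f _ _
    rw [← this]
    exact hf t ht
  · rw [← VecTerm.map_eval, Function.comp_apply, hrel t ht, map_zero]

/-- If `B` is the universal algebra with a solution of the relations, then its nondegenerate locus
is an open subscheme of the slice. -/
theorem exists_openImmersion [Algebra ℚ B]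
    (hext : ∀ (R : Type) [CommRing R] [Algebra ℚ R] (φ ψ : B →ₐ[ℚ] R),
      (∀ i, φ (x i) = ψ (x i)) → φ = ψ)
    (huniv : ∀ (R : Type) [CommRing R] [Algebra ℚ R] (y : Fin m → R),
      (∀ t ∈ c.rels, t.eval y 1 = 0) → ∃ φ : B →ₐ[ℚ] R, ∀ i, φ (x i) = y i)
    (hD : c.IsSolution (algebraMap B (Localization.Away (nondegenerate c x)) ∘ x)) :
    ∃ Φ : RepRing c.coxeter.Group ⧸ c.sliceIdeal →ₐ[ℚ] Localization.Away (nondegenerate c x),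
      IsOpenImmersion (Spec.map (CommRingCat.ofHom Φ.toRingHom)) ∧
        Φ.comp (Ideal.Quotient.mkₐ ℚ c.sliceIdeal) = pointOf hD.rep := by
  let D := Localization.Away (nondegenerate c x)
  let C := RepRing c.coxeter.Group ⧸ c.sliceIdeal
  let Φ : C →ₐ[ℚ] D := Ideal.Quotient.liftₐ c.sliceIdeal (pointOf hD.rep)
    ((c.isNormalized_iff _).1 hD.isNormalized)
  have hΦ : Φ.comp (Ideal.Quotient.mkₐ ℚ c.sliceIdeal) = pointOf hD.rep :=
    Ideal.Quotient.liftₐ_comp _ _ _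
  refine ⟨Φ, ?_, hΦ⟩
  -- Inverting `generic` on the slice gives E, which carries the universal normalized generic
  -- representation.
  let F : C := Ideal.Quotient.mk c.sliceIdeal c.generic
  have hF : IsUnit (Φ F) := by
    have : Φ F = pointOf hD.rep c.generic := DFunLike.congr_fun hΦ c.generic
    rw [this]
    exact hD.isUnit_generic
  let E := Localization.Away F
  let κ : RepRing c.coxeter.Group →ₐ[ℚ] E :=
    (IsScalarTower.toAlgHom ℚ C E).comp (Ideal.Quotient.mkₐ ℚ c.sliceIdeal)
  have hnorm : c.IsNormalized (repOf κ) := by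
    rw [c.isNormalized_iff, pointOf_repOf]
    intro a ha
    have : Ideal.Quotient.mkₐ ℚ c.sliceIdeal a = 0 := Ideal.Quotient.eq_zero_iff_mem.2 ha
    simp only [κ, AlgHom.comp_apply, this, map_zero]
  have hgen : IsUnit (pointOf (repOf κ) c.generic) := by
    rw [pointOf_repOf]
    exact IsLocalization.Away.algebraMap_isUnit F
  -- Its coordinates solve the relations over E, so universality of B turns them into a map from B
  -- to E.
  have hsol := hnorm.isSolution hgen
  obtain ⟨ψ₀, hψ₀⟩ := huniv E (coords (repOf κ)) hsol.rel
  have hψ₀x : (ψ₀ : B →+* E) ∘ x = coords (repOf κ) := funext hψ₀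
  have hunit : IsUnit ((ψ₀ : B →+* E) (nondegenerate c x)) := by
    rw [nondegenerate, map_prod, IsUnit.prod_iff]
    intro t ht
    have e : (ψ₀ : B →+* E) (t.eval x ⬝ᵥ t.eval x)
        = ((ψ₀ : B →+* E) ∘ t.eval x) ⬝ᵥ ((ψ₀ : B →+* E) ∘ t.eval x) :=
      RingHom.map_dotProduct _ _ _
    rw [e, VecTerm.map_eval, hψ₀x]
    exact hsol.isUnit t ht
  let ψ : D →+* E := IsLocalization.Away.lift (nondegenerate c x) hunit
  have hψ : ∀ b, ψ (algebraMap B D b) = ψ₀ b := IsLocalization.Away.lift_eq _ hunit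
  let ψa : D →ₐ[ℚ] E := ψ.toRatAlgHom
  have hψx : (ψa : D →+* E) ∘ (algebraMap B D ∘ x) = coords (repOf κ) := by
    rw [← hψ₀x]
    funext i
    exact hψ (x i)
  refine isOpenImmersion_of_away Φ.toRingHom F hF ψ ?_ ?_
  -- First composite: a generic normalized representation is the one built from its own coordinates.
  · have h1 : (ψa.comp Φ).comp (Ideal.Quotient.mkₐ ℚ c.sliceIdeal) = κ := by
      rw [AlgHom.comp_assoc, hΦ, ← pointOf_map, hD.map_rep,
        (hD.map (ψa : D →+* E)).rep_congr hsol hψx, ← hnorm.eq_rep hgen, pointOf_repOf]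
    apply Ideal.Quotient.ringHom_ext
    ext a
    exact DFunLike.congr_fun h1 a
  · let Λ : E →+* D := IsLocalization.Away.lift (S := E) F hF
    have hΛ : ∀ a, Λ (algebraMap C E a) = Φ a := IsLocalization.Away.lift_eq F hF
    let Λa : E →ₐ[ℚ] D := Λ.toRatAlgHom
    have hΛκ : Λa.comp κ = pointOf hD.rep := by
      rw [← hΦ]
      ext a
      exact hΛ _
    -- Second composite: the coordinates of the representation built from a solution are that
    -- solution, and they determine maps out of B.
    have hcoords : ∀ i, Λ (coords (repOf κ) i) = algebraMap B D (x i) := by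
      have h1 : (PO3.map (Λa : E →+* D)).comp (repOf κ) = hD.rep := by
        rw [← repOf_comp, hΛκ, repOf_pointOf]
      rw [hnorm.eq_rep hgen, hsol.map_rep] at h1
      have h2 : coords (hsol.map (Λa : E →+* D)).rep = coords hD.rep := by rw [h1]
      rw [IsSolution.coords_rep, IsSolution.coords_rep] at h2
      exact fun i => congrFun h2 i
    change Λ.comp ψ = RingHom.id D
    refine IsLocalization.ringHom_ext (Submonoid.powers (nondegenerate c x)) ?_
    have h3 : (Λa.comp ψa).comp (IsScalarTower.toAlgHom ℚ B D) = IsScalarTower.toAlgHom ℚ B D := by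
      refine hext D _ _ fun i => ?_
      change Λ (ψ (algebraMap B D (x i))) = algebraMap B D (x i)
      rw [hψ, hψ₀, hcoords]
    ext b
    exact DFunLike.congr_fun h3 b

end Config

end OpenImmersion

/-! ### Arithmetic with cross products -/

section Arithmetic

open Matrix MvPolynomial

variable {m : ℕ}

namespace VecTerm

/-- The expressions none of whose subexpressions vanishes at any rational point. -/
def Nonvanishing : VecTerm m → Prop
  | cross a b => Nonvanishing a ∧ Nonvanishing b ∧ ∀ x : Fin m → ℚ, eval x (cross a b) ≠ 0
  | _ => True

/-- The expression is nonvanishing and its coordinates are the given polynomials. -/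
structure IsVec (t : VecTerm m) (a b c : MvPolynomial (Fin m) ℚ) : Prop where
  nonvanishing : Nonvanishing t
  eval_eq : ∀ (R : Type) [CommRing R] [Algebra ℚ R] (x : Fin m → R),
    eval x t = ![aeval x a, aeval x b, aeval x c]

/-- A coordinate whose square is the polynomial 1 cannot vanish at any point; `hne` is the uniform
way in which nonvanishing is ensured below. -/
theorem IsVec.cross {s t : VecTerm m} {a b c a' b' c' p q r : MvPolynomial (Fin m) ℚ}
    (hs : IsVec s a b c) (ht : IsVec t a' b' c') (hp : p = b * c' - c * b')
    (hq : q = c * a' - a * c') (hr : r = a * b' - b * a')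
    (hne : p ^ 2 = 1 ∨ q ^ 2 = 1 ∨ r ^ 2 = 1) : IsVec (.cross s t) p q r := by
  have he : ∀ (R : Type) [CommRing R] [Algebra ℚ R] (x : Fin m → R),
      eval x (.cross s t) = ![aeval x p, aeval x q, aeval x r] := by
    intro R _ _ x
    rw [eval, hs.eval_eq, ht.eval_eq, hp, hq, hr, cross_apply]
    simp
  refine ⟨⟨hs.nonvanishing, ht.nonvanishing, fun x h => ?_⟩, he⟩
  rw [he] at h
  have h0 : aeval x p = 0 := congrFun h 0
  have h1 : aeval x q = 0 := congrFun h 1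
  have h2 : aeval x r = 0 := congrFun h 2
  rcases hne with hne | hne | hne
  · have := congrArg (aeval x) hne
    rw [map_pow, h0, map_one] at this
    norm_num at this
  · have := congrArg (aeval x) hne
    rw [map_pow, h1, map_one] at this
    norm_num at this
  · have := congrArg (aeval x) hne
    rw [map_pow, h2, map_one] at this
    norm_num at this

theorem isVec_axis_zero : IsVec (.axis 0 : VecTerm m) 1 0 0 :=
  ⟨trivial, fun R _ _ x => by ext i; fin_cases i <;> simp [eval, axisVec]⟩

theorem isVec_axis_one : IsVec (.axis 1 : VecTerm m) 0 1 0 :=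
  ⟨trivial, fun R _ _ x => by ext i; fin_cases i <;> simp [eval, axisVec]⟩

theorem isVec_axis_two : IsVec (.axis 2 : VecTerm m) 0 0 1 :=
  ⟨trivial, fun R _ _ x => by ext i; fin_cases i <;> simp [eval, axisVec]⟩

theorem isVec_diag_zero : IsVec (.diag 0 : VecTerm m) 1 1 0 :=
  ⟨trivial, fun R _ _ x => by ext i; fin_cases i <;> simp [eval, diagVec, axisVec]⟩

theorem isVec_diag_one : IsVec (.diag 1 : VecTerm m) 0 1 1 :=
  ⟨trivial, fun R _ _ x => by ext i; fin_cases i <;> simp [eval, diagVec, axisVec]⟩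

theorem isVec_var (i : Fin m) : IsVec (.var i) 1 (X i) 0 :=
  ⟨trivial, fun R _ _ x => by ext j; fin_cases j <;> simp [eval]⟩

variable {s t : VecTerm m} {p q : MvPolynomial (Fin m) ℚ}

/-- The plane through (1, p, 0) and (0, −1, 1) meets the plane of the first and third axes in the
line of (1, 0, p); a cross product gives the normal of a plane, a second one the intersection. -/
theorem IsVec.vertical (hs : IsVec s 1 p 0) :
    IsVec (.cross (.cross s (.cross (.axis 0) (.diag 1))) (.axis 1)) 1 0 p := by
  have h1 : IsVec (.cross (.axis 0) (.diag 1) : VecTerm m) 0 (-1) 1 :=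
    isVec_axis_zero.cross isVec_diag_one (by ring) (by ring) (by ring) (by simp)
  have h2 : IsVec (.cross s (.cross (.axis 0) (.diag 1))) p (-1) (-1) :=
    hs.cross h1 (by ring) (by ring) (by ring) (by simp)
  exact h2.cross isVec_axis_one (by ring) (by ring) (by ring) (by simp)

/-- The point (1, p, q) is assembled from its two projections and moved into the horizontal plane
along (0, 1, −1), landing at (1, p + q, 0). -/
theorem IsVec.exists_add (hs : IsVec s 1 p 0) (ht : IsVec t 1 q 0) :
    ∃ a b, IsVec (.cross a b) 1 (p + q) 0 := by
  have h1 : IsVec (.cross s (.axis 2)) p (-1) 0 :=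
    hs.cross isVec_axis_two (by ring) (by ring) (by ring) (by simp)
  have h2 := ht.vertical.cross (p := -q) (q := 0) (r := 1) isVec_axis_one (by ring) (by ring)
    (by ring) (by simp)
  have h3 := h2.cross (p := 1) (q := p) (r := q) h1 (by ring) (by ring) (by ring) (by simp)
  have h4 : IsVec (.cross (.diag 1) (.axis 0) : VecTerm m) 0 1 (-1) :=
    isVec_diag_one.cross isVec_axis_zero (by ring) (by ring) (by ring) (by simp)
  have h5 := h3.cross (p := -p - q) (q := 1) (r := 1) h4 (by ring) (by ring) (by ring) (by simp)
  exact ⟨_, _, h5.cross isVec_axis_two (by ring) (by ring) (by ring) (by simp)⟩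

theorem IsVec.exists_mul (hs : IsVec s 1 p 0) (ht : IsVec t 1 q 0) :
    ∃ a b, IsVec (.cross a b) 1 (p * q) 0 := by
  have h1 : IsVec (.cross (.diag 0) (.axis 2) : VecTerm m) 1 (-1) 0 :=
    isVec_diag_zero.cross isVec_axis_two (by ring) (by ring) (by ring) (by simp)
  have h2 := ht.vertical.cross (p := q) (q := q) (r := -1) h1 (by ring) (by ring) (by ring)
    (by simp)
  have h3 := isVec_axis_zero.cross (p := 0) (q := 1) (r := q) h2 (by ring) (by ring) (by ring)
    (by simp)
  -- The product is created here: (1, p, 0) × (0, 1, q) = (pq, −q, 1). The remaining steps move it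
  -- to the second coordinate.
  have h4 := hs.cross (p := p * q) (q := -q) (r := 1) h3 (by ring) (by ring) (by ring) (by simp)
  have h5 := isVec_axis_one.cross (p := 1) (q := 0) (r := -(p * q)) h4 (by ring) (by ring)
    (by ring) (by simp)
  have h6 := h5.cross (p := p * q) (q := -1) (r := 1) isVec_diag_one (by ring) (by ring)
    (by ring) (by simp)
  exact ⟨_, _, isVec_axis_two.cross h6 (by ring) (by ring) (by ring) (by simp)⟩

variable (m) in
/-- The polynomials which occur as the second coordinate of an expression `(1, p, 0)`. -/
def representable : Subring (MvPolynomial (Fin m) ℚ) where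
  carrier := {p | ∃ t : VecTerm m, IsVec t 1 p 0}
  zero_mem' := ⟨_, isVec_axis_zero⟩
  one_mem' := ⟨_, isVec_diag_zero⟩
  add_mem' := by
    rintro p q ⟨s, hs⟩ ⟨t, ht⟩
    obtain ⟨a, b, h⟩ := hs.exists_add ht
    exact ⟨_, h⟩
  mul_mem' := by
    rintro p q ⟨s, hs⟩ ⟨t, ht⟩
    obtain ⟨a, b, h⟩ := hs.exists_mul ht
    exact ⟨_, h⟩
  neg_mem' := by
    rintro p ⟨s, hs⟩
    have h1 : IsVec (.cross (.diag 0) (.axis 2) : VecTerm m) 1 (-1) 0 :=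
      isVec_diag_zero.cross isVec_axis_two (by ring) (by ring) (by ring) (by simp)
    obtain ⟨a, b, h⟩ := hs.exists_mul h1
    exact ⟨_, by simpa using h⟩

/-- Adding zero puts the expression in the form of a cross product, the only form on which relations
may be imposed. -/
theorem exists_cross_of_mem (hp : p ∈ representable m) : ∃ a b, IsVec (.cross a b) 1 p 0 := by
  obtain ⟨t, ht⟩ := hp
  simpa using ht.exists_add isVec_axis_zero

/-- The constructions yield integer coefficients only. Clearing denominators is harmless, since N is
invertible in every ℚ-algebra and Np = 0 is equivalent to p = 0. -/
theorem exists_nsmul_mem (p : MvPolynomial (Fin m) ℚ) :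
    ∃ N : ℕ, N ≠ 0 ∧ N • p ∈ representable m := by
  induction p using MvPolynomial.induction_on with
  | C a =>
    refine ⟨a.den, a.den_nz, ?_⟩
    have h : a.den • (C a : MvPolynomial (Fin m) ℚ) = ((a.num : ℤ) : MvPolynomial (Fin m) ℚ) := by
      rw [← map_nsmul, nsmul_eq_mul, mul_comm, Rat.mul_den_eq_num, map_intCast]
    rw [h]
    exact intCast_mem _ _
  | add p q hp hq =>
    obtain ⟨N, hN, h⟩ := hp
    obtain ⟨K, hK, h'⟩ := hq
    refine ⟨N * K, mul_ne_zero hN hK, ?_⟩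
    rw [smul_add]
    refine add_mem ?_ ?_
    · rw [mul_comm, mul_smul]; exact nsmul_mem h K
    · rw [mul_smul]; exact nsmul_mem h' N
  | mul_X p i hp =>
    obtain ⟨N, hN, h⟩ := hp
    refine ⟨N, hN, ?_⟩
    rw [← smul_mul_assoc]
    exact mul_mem h ⟨_, isVec_var i⟩

open Classical in
/-- The set of subexpressions. -/
def subterms : VecTerm m → Finset (VecTerm m)
  | cross a b => insert (cross a b) (subterms a ∪ subterms b)
  | t => {t}

theorem self_mem_subterms (t : VecTerm m) : t ∈ subterms t := by
  cases t <;> simp [subterms]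

theorem left_mem_subterms {a b t : VecTerm m} (h : cross a b ∈ subterms t) : a ∈ subterms t := by
  induction t with
  | cross c d ihc ihd =>
    simp only [subterms, Finset.mem_insert, Finset.mem_union, cross.injEq] at h ⊢
    rcases h with ⟨rfl, rfl⟩ | h | h
    · exact Or.inr (Or.inl (self_mem_subterms _))
    · exact Or.inr (Or.inl (ihc h))
    · exact Or.inr (Or.inr (ihd h))
  | _ => simp [subterms] at h

theorem right_mem_subterms {a b t : VecTerm m} (h : cross a b ∈ subterms t) : b ∈ subterms t := by
  induction t with
  | cross c d ihc ihd =>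
    simp only [subterms, Finset.mem_insert, Finset.mem_union, cross.injEq] at h ⊢
    rcases h with ⟨rfl, rfl⟩ | h | h
    · exact Or.inr (Or.inr (self_mem_subterms _))
    · exact Or.inr (Or.inl (ihc h))
    · exact Or.inr (Or.inr (ihd h))
  | _ => simp [subterms] at h

theorem Nonvanishing.of_mem_subterms {s t : VecTerm m} (ht : Nonvanishing t)
    (hs : s ∈ subterms t) : Nonvanishing s := by
  induction t with
  | cross c d ihc ihd =>
    simp only [subterms, Finset.mem_insert, Finset.mem_union] at hs
    rcases hs with rfl | h | h
    · exact ht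
    · exact ihc ht.1 h
    · exact ihd ht.2.1 h
  | _ =>
    simp only [subterms, Finset.mem_singleton] at hs
    subst hs
    exact ht

/-- Here positivity enters: over ℚ a sum of three squares vanishes only for the zero vector. -/
theorem Nonvanishing.isUnit_eval {t : VecTerm m} (ht : Nonvanishing t) (x : Fin m → ℚ) :
    IsUnit (eval x t ⬝ᵥ eval x t) := by
  have h : eval x t ≠ 0 := by
    cases t with
    | axis k => intro h; simpa [eval, axisVec] using congrFun h k
    | diag k =>
      intro h
      have h1 := congrArg (fun v => v ⬝ᵥ v) h
      simp only [eval, diagVec_dot, dotProduct_zero] at h1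
      norm_num at h1
    | var i => intro h; simpa [eval] using congrFun h 0
    | cross a b => exact ht.2.2 x
  rw [isUnit_iff_ne_zero]
  exact fun h0 => h (dotProduct_self_eq_zero.1 h0)

end VecTerm

open Classical in
/-- The configuration generated by finitely many expressions, with relations among them. -/
def Config.ofTerms (L Rl : Finset (VecTerm m)) (hRl : Rl ⊆ L)
    (hc : ∀ t ∈ Rl, ∃ a b, t = .cross a b) : Config m where
  terms := Finset.univ.image VecTerm.axis ∪ Finset.univ.image VecTerm.diag ∪
    Finset.univ.image VecTerm.var ∪ L.biUnion VecTerm.subterms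
  rels := Rl
  axis_mem k := by simp
  diag_mem k := by simp
  var_mem i := by simp
  left_mem a b h := by
    have h' : ∃ t ∈ L, .cross a b ∈ VecTerm.subterms t := by simpa using h
    obtain ⟨t, ht, h'⟩ := h'
    exact Finset.mem_union_right _ (Finset.mem_biUnion.2 ⟨t, ht, VecTerm.left_mem_subterms h'⟩)
  right_mem a b h := by
    have h' : ∃ t ∈ L, .cross a b ∈ VecTerm.subterms t := by simpa using h
    obtain ⟨t, ht, h'⟩ := h'
    exact Finset.mem_union_right _ (Finset.mem_biUnion.2 ⟨t, ht, VecTerm.right_mem_subterms h'⟩)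
  rels_subset t ht := Finset.mem_union_right _
    (Finset.mem_biUnion.2 ⟨t, hRl ht, VecTerm.self_mem_subterms t⟩)
  rels_cross t ht := hc t ht

theorem Config.nonvanishing_ofTerms {L Rl : Finset (VecTerm m)} {hRl : Rl ⊆ L}
    {hc : ∀ t ∈ Rl, ∃ a b, t = .cross a b} (hL : ∀ t ∈ L, VecTerm.Nonvanishing t)
    {t : VecTerm m} (ht : t ∈ (Config.ofTerms L Rl hRl hc).terms) : VecTerm.Nonvanishing t := by
  cases t with
  | cross a b =>
    have h' : ∃ t ∈ L, .cross a b ∈ VecTerm.subterms t := by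
      simpa [Config.ofTerms] using ht
    obtain ⟨s, hs, h'⟩ := h'
    exact (hL s hs).of_mem_subterms h'
  | _ => trivial

/-- Every algebra of finite type is the universal algebra with a solution of the relations of a
configuration, which moreover contains the vector `(1, 2, 0)`. -/
theorem exists_config (B : Type) [CommRing B] [Algebra ℚ B] [Algebra.FiniteType ℚ B] :
    ∃ (m : ℕ) (c : Config m) (x : Fin m → B),
      (∀ t ∈ c.terms, VecTerm.Nonvanishing t) ∧
      (∀ t ∈ c.rels, t.eval x 1 = 0) ∧
      (∀ (R : Type) [CommRing R] [Algebra ℚ R] (φ ψ : B →ₐ[ℚ] R),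
        (∀ i, φ (x i) = ψ (x i)) → φ = ψ) ∧
      (∀ (R : Type) [CommRing R] [Algebra ℚ R] (y : Fin m → R),
        (∀ t ∈ c.rels, t.eval y 1 = 0) → ∃ φ : B →ₐ[ℚ] R, ∀ i, φ (x i) = y i) ∧
      ∃ t ∈ c.terms, ∀ (R : Type) [CommRing R] [Algebra ℚ R] (y : Fin m → R),
        t.eval y = ![1, 2, 0] := by
  classical
  obtain ⟨m, π, hπ⟩ := Algebra.FiniteType.iff_quotient_mvPolynomial''.1
    (inferInstance : Algebra.FiniteType ℚ B)
  -- Finitely many equations define B by Hilbert's basis theorem; each will become one orthogonality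
  -- relation.
  obtain ⟨S, hS⟩ := (isNoetherianRing_iff_ideal_fg _).1
    (inferInstance : IsNoetherianRing (MvPolynomial (Fin m) ℚ)) (RingHom.ker π)
  choose N hN hmem using VecTerm.exists_nsmul_mem (m := m)
  choose a b hab using fun p => VecTerm.exists_cross_of_mem (hmem p)
  obtain ⟨t2, ht2⟩ : (2 : MvPolynomial (Fin m) ℚ) ∈ VecTerm.representable m :=
    ofNat_mem _ 2
  let Rl : Finset (VecTerm m) := S.image fun p => .cross (a p) (b p)
  let c : Config m := Config.ofTerms (insert t2 Rl) Rl (Finset.subset_insert _ _) (by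
    intro t ht
    obtain ⟨p, -, rfl⟩ := Finset.mem_image.1 ht
    exact ⟨_, _, rfl⟩)
  have hval : ∀ (R : Type) [CommRing R] [Algebra ℚ R] (y : Fin m → R) (p : MvPolynomial (Fin m) ℚ),
      VecTerm.eval y (.cross (a p) (b p)) 1 = N p • aeval y p := by
    intro R _ _ y p
    rw [(hab p).eval_eq]
    simp
  refine ⟨m, c, fun i => π (X i), ?_, ?_, ?_, ?_, t2, ?_, ?_⟩
  · intro t ht
    refine Config.nonvanishing_ofTerms ?_ ht
    intro s hs
    rcases Finset.mem_insert.1 hs with rfl | hs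
    · exact ht2.nonvanishing
    · obtain ⟨p, -, rfl⟩ := Finset.mem_image.1 hs
      exact (hab p).nonvanishing
  · intro t ht
    obtain ⟨p, hp, rfl⟩ := Finset.mem_image.1 (show t ∈ Rl from ht)
    have h1 : aeval (fun i => π (X i)) p = π p := by
      have : aeval (fun i => π (X i)) = π := by
        apply MvPolynomial.algHom_ext; simp
      rw [this]
    have h2 : π p = 0 := by
      have : p ∈ RingHom.ker π := by rw [← hS]; exact Ideal.subset_span hp
      exact this
    rw [hval, h1, h2, smul_zero]
  · intro R _ _ φ ψ h
    have h1 : φ.comp π = ψ.comp π := MvPolynomial.algHom_ext h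
    ext b
    obtain ⟨p, rfl⟩ := hπ b
    exact DFunLike.congr_fun h1 p
  · intro R _ _ y hy
    have hker : ∀ p ∈ RingHom.ker π, aeval y p = 0 := by
      have : RingHom.ker π ≤ RingHom.ker (aeval (R := ℚ) y) := by
        rw [← hS, Ideal.span_le]
        intro p hp
        have h1 := hy _ (show .cross (a p) (b p) ∈ Rl from Finset.mem_image_of_mem _ hp)
        rw [hval, nsmul_eq_mul] at h1
        exact (isUnit_ofNat_of_rat (R := R) (N p) (hN p)).mul_left_cancel (by rw [h1, mul_zero])
      exact fun p hp => this hp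
    refine ⟨(Ideal.Quotient.liftₐ (RingHom.ker π) (aeval y) hker).comp
      (Ideal.quotientKerAlgEquivOfSurjective hπ).symm.toAlgHom, fun i => ?_⟩
    have h1 : (Ideal.quotientKerAlgEquivOfSurjective hπ).symm (π (X i))
        = Ideal.Quotient.mk _ (X i) := by
      rw [AlgEquiv.symm_apply_eq]; rfl
    change Ideal.Quotient.liftₐ (RingHom.ker π) (aeval y) hker
      ((Ideal.quotientKerAlgEquivOfSurjective hπ).symm (π (X i))) = y i
    rw [h1]
    exact aeval_X y i
  · exact Finset.mem_union_right _
      (Finset.mem_biUnion.2 ⟨t2, Finset.mem_insert_self _ _, VecTerm.self_mem_subterms t2⟩)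
  · intro R _ _ y
    rw [ht2.eval_eq]
    simp

end Arithmetic

/-! ### Dense subgroups of the rotation group -/

section Density

open Matrix

/-- The rotation about the third axis. -/
def rotZ (α : ℝ) : Matrix (Fin 3) (Fin 3) ℝ :=
  !![Real.cos α, -Real.sin α, 0; Real.sin α, Real.cos α, 0; 0, 0, 1]

/-- The half-turn interchanging the second and the third axis. -/
def swapYZ : Matrix (Fin 3) (Fin 3) ℝ := !![-1, 0, 0; 0, 0, 1; 0, 1, 0]

theorem rotZ_mem (α : ℝ) : rotZ α ∈ specialOrthogonalGroup (Fin 3) ℝ := by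
  have h := Real.sin_sq_add_cos_sq α
  refine mem_of_eqs ?_ ?_
  · ext i j
    fin_cases i <;> fin_cases j <;>
      simp [rotZ, Matrix.mul_apply, Fin.sum_univ_three] <;> linarith
  · simp [rotZ, det_fin_three]
    linarith

theorem swapYZ_mem : swapYZ ∈ specialOrthogonalGroup (Fin 3) ℝ := by
  refine mem_of_eqs ?_ ?_
  · ext i j
    fin_cases i <;> fin_cases j <;>
      simp [swapYZ, Matrix.mul_apply, Fin.sum_univ_three]
  · simp [swapYZ, det_fin_three]

theorem rotZ_add (α β : ℝ) : rotZ (α + β) = rotZ α * rotZ β := by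
  ext i j
  fin_cases i <;> fin_cases j <;>
    simp [rotZ, Matrix.mul_apply, Fin.sum_univ_three, Real.cos_add, Real.sin_add] <;> ring

theorem rotZ_zero : rotZ 0 = 1 := by
  ext i j
  fin_cases i <;> fin_cases j <;> simp [rotZ]

theorem rotZ_two_pi : rotZ (2 * Real.pi) = 1 := by
  ext i j
  fin_cases i <;> fin_cases j <;> simp [rotZ]

theorem continuous_rotZ : Continuous rotZ := by
  refine continuous_matrix fun i j => ?_
  fin_cases i <;> fin_cases j <;> simp [rotZ] <;> fun_prop

theorem exists_polar (a b : ℝ) : ∃ α, a = Real.sqrt (a ^ 2 + b ^ 2) * Real.cos α ∧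
    b = Real.sqrt (a ^ 2 + b ^ 2) * Real.sin α := by
  refine ⟨Complex.arg ⟨a, b⟩, ?_, ?_⟩
  · have := Complex.norm_mul_cos_arg ⟨a, b⟩
    rw [Complex.norm_def, Complex.normSq_mk, ← pow_two, ← pow_two] at this
    exact this.symm
  · have := Complex.norm_mul_sin_arg ⟨a, b⟩
    rw [Complex.norm_def, Complex.normSq_mk, ← pow_two, ← pow_two] at this
    exact this.symm

/-- Rotations fixing the third axis. -/
theorem exists_rotZ_of_fixes {A : Matrix (Fin 3) (Fin 3) ℝ}
    (hA : A ∈ specialOrthogonalGroup (Fin 3) ℝ) (h : A *ᵥ axisVec 2 = axisVec 2) :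
    ∃ γ, A = rotZ γ := by
  have hT : Aᵀ *ᵥ axisVec 2 = axisVec 2 := by
    conv_lhs => rw [← h, mulVec_mulVec, transpose_mul_of_mem hA, one_mulVec]
  have hc : ∀ i, A i 2 = (axisVec 2 : Fin 3 → ℝ) i := fun i => by
    rw [← h]; simp [axisVec]
  have hr : ∀ i, A 2 i = (axisVec 2 : Fin 3 → ℝ) i := fun i => by
    rw [← hT]; simp [axisVec]
  have c0 : A 0 2 = 0 := by rw [hc]; simp [axisVec]
  have c1 : A 1 2 = 0 := by rw [hc]; simp [axisVec]
  have c2 : A 2 2 = 1 := by rw [hc]; simp [axisVec]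
  have r0 : A 2 0 = 0 := by rw [hr]; simp [axisVec]
  have r1 : A 2 1 = 0 := by rw [hr]; simp [axisVec]
  -- The cofactors of a rotation are its entries, which gives the remaining block its rotation
  -- shape.
  have hadj := adjugate_of_mem hA
  rw [adjugate_fin_three] at hadj
  have e00 := congrFun (congrFun hadj 0) 0
  have e01 := congrFun (congrFun hadj 0) 1
  simp [c0, c1, c2, r0, r1] at e00 e01
  have hone := congrFun (congrFun (transpose_mul_of_mem hA) 0) 0
  simp [Matrix.mul_apply, Fin.sum_univ_three, r0] at hone
  obtain ⟨γ, h1, h2⟩ := exists_polar (A 0 0) (A 1 0)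
  have hs : A 0 0 ^ 2 + A 1 0 ^ 2 = 1 := by linear_combination hone
  rw [hs, Real.sqrt_one, one_mul] at h1 h2
  refine ⟨γ, ?_⟩
  ext i j
  fin_cases i <;> fin_cases j <;> simp [rotZ, c0, c1, c2, r0, r1, ← h1, ← h2] <;> linarith

/-- Euler angles. -/
theorem exists_euler {A : Matrix (Fin 3) (Fin 3) ℝ}
    (hA : A ∈ specialOrthogonalGroup (Fin 3) ℝ) :
    ∃ α β γ, A = rotZ α * (swapYZ * rotZ β * swapYZ) * rotZ γ := by
  have hone := congrFun (congrFun (transpose_mul_of_mem hA) 2) 2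
  simp [Matrix.mul_apply, Fin.sum_univ_three] at hone
  -- Spherical coordinates of the last column of A: α is the longitude and β, below, the colatitude.
  -- What remains fixes the third axis.
  obtain ⟨α, h1, h2⟩ := exists_polar (A 0 2) (A 1 2)
  obtain ⟨r, hr⟩ : ∃ r, r = Real.sqrt (A 0 2 ^ 2 + A 1 2 ^ 2) := ⟨_, rfl⟩
  have hr2 : r ^ 2 = A 0 2 ^ 2 + A 1 2 ^ 2 := by rw [hr, Real.sq_sqrt (by positivity)]
  rw [← hr] at h1 h2
  obtain ⟨β, h3, h4⟩ := exists_polar (A 2 2) r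
  have hs : A 2 2 ^ 2 + r ^ 2 = 1 := by rw [hr2]; linear_combination hone
  rw [hs, Real.sqrt_one, one_mul] at h3 h4
  obtain ⟨E, hE⟩ : ∃ E, E = rotZ α * (swapYZ * rotZ β * swapYZ) := ⟨_, rfl⟩
  have hEm : E ∈ specialOrthogonalGroup (Fin 3) ℝ := by
    rw [hE]
    exact mul_mem (rotZ_mem _) (mul_mem (mul_mem swapYZ_mem (rotZ_mem _)) swapYZ_mem)
  have hEA : E *ᵥ axisVec 2 = A *ᵥ axisVec 2 := by
    rw [axisVec, mulVec_single_one, mulVec_single_one, hE]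
    ext i
    fin_cases i <;> simp [rotZ, swapYZ, ← h3, ← h4] <;>
      linarith
  have hEt : Eᵀ ∈ specialOrthogonalGroup (Fin 3) ℝ :=
    mem_of_eqs (by rw [transpose_transpose, transpose_mul_of_mem hEm])
      (by rw [det_transpose, det_of_mem hEm])
  obtain ⟨γ, hγ⟩ := exists_rotZ_of_fixes (mul_mem hEt hA) (by
    rw [← mulVec_mulVec, ← hEA, mulVec_mulVec, transpose_mul_of_mem hEm, one_mulVec])
  refine ⟨α, β, γ, ?_⟩
  rw [← hE, ← hγ, ← mul_assoc, mul_transpose_of_mem hEm, one_mul]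

theorem halfTurn_diag_one : halfTurn (diagVec 1 : Fin 3 → ℝ) = swapYZ := by
  rw [halfTurn, two_mul, lineProj, diagVec_dot]
  ext i j
  fin_cases i <;> fin_cases j <;>
    simp [swapYZ, diagVec, axisVec, vecMulVec_apply] <;> norm_num

/-- An angle which is not a rational multiple of a full turn. -/
theorem halfTurn_mul_eq_rotZ : halfTurn (![1, 2, 0] : Fin 3 → ℝ) * halfTurn (axisVec 0)
    = rotZ (Real.arccos (-3 / 5)) := by
  -- The product turns by twice the angle between the axes, whose tangent is 2, so its cosine is (1
  -- − 4)/(1 + 4).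
  have hc : Real.cos (Real.arccos (-3 / 5)) = -3 / 5 := Real.cos_arccos (by norm_num) (by norm_num)
  have hs : Real.sin (Real.arccos (-3 / 5)) = 4 / 5 := by
    rw [Real.sin_arccos, show (1 : ℝ) - (-3 / 5) ^ 2 = (4 / 5) ^ 2 by norm_num,
      Real.sqrt_sq (by norm_num)]
  have hq : (![1, 2, 0] : Fin 3 → ℝ) ⬝ᵥ ![1, 2, 0] = 5 := by
    simp [dotProduct, Fin.sum_univ_three]; norm_num
  rw [halfTurn, halfTurn, two_mul, two_mul, lineProj, lineProj, axisVec_dot, hq, rotZ, hc, hs]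
  ext i j
  fin_cases i <;> fin_cases j <;>
    simp [axisVec, vecMulVec_apply, Matrix.mul_apply, Fin.sum_univ_three] <;> norm_num

/-- A subgroup of ℝ that is not dense is cyclic, which would make the angle a rational multiple of
π; Niven's theorem excludes the cosine −3/5. -/
theorem dense_of_arccos_mem (S : AddSubgroup ℝ) (h1 : 2 * Real.pi ∈ S)
    (h2 : Real.arccos (-3 / 5) ∈ S) : Dense (S : Set ℝ) := by
  rcases S.dense_or_cyclic with h | ⟨a, ha⟩
  · exact h
  · exfalso
    rw [ha, AddSubgroup.mem_closure_singleton] at h1 h2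
    obtain ⟨k, hk⟩ := h1
    obtain ⟨l, hl⟩ := h2
    have hk0 : (k : ℝ) ≠ 0 := by
      rintro h0
      rw [zsmul_eq_mul, h0, zero_mul] at hk
      have := Real.pi_pos
      linarith
    rw [zsmul_eq_mul] at hk hl
    have hc : Real.cos (Real.arccos (-3 / 5)) = -3 / 5 :=
      Real.cos_arccos (by norm_num) (by norm_num)
    have := niven (θ := Real.arccos (-3 / 5)) ⟨2 * l / k, by
      push_cast
      rw [← hl, eq_comm, div_mul_eq_mul_div, div_eq_iff hk0]
      linear_combination (-(l : ℝ)) * hk⟩ ⟨-3 / 5, by rw [hc]; norm_num⟩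
    rw [hc] at this
    norm_num at this

/-- The angles of rotations about the third axis in the image form a dense subgroup. Conjugation by
the half-turn about the second bisector turns these into rotations about the second axis, and the
Euler-angle map, continuous and onto, carries dense sets to dense sets. -/
theorem denseRange_of_halfTurns {Γ : Type} [Group Γ] (ρ : Γ →* PO3 ℝ) {u v w : Γ}
    (hu : repMat ρ u = halfTurn (axisVec 0)) (hv : repMat ρ v = halfTurn (diagVec 1))
    (hw : repMat ρ w = halfTurn ![1, 2, 0]) : DenseRange ρ := by
  let S : AddSubgroup ℝ :=
    { carrier := {α | ∃ γ, repMat ρ γ = rotZ α}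
      zero_mem' := ⟨1, by rw [repMat_one, rotZ_zero]⟩
      add_mem' := by
        rintro α β ⟨a, ha⟩ ⟨b, hb⟩
        exact ⟨a * b, by rw [repMat_mul, ha, hb, rotZ_add]⟩
      neg_mem' := by
        rintro α ⟨a, ha⟩
        refine ⟨a⁻¹, ?_⟩
        have h1 : repMat ρ a⁻¹ * rotZ α = 1 := by
          rw [← ha, ← repMat_mul, inv_mul_cancel, repMat_one]
        have h2 : rotZ α * rotZ (-α) = 1 := by rw [← rotZ_add, add_neg_cancel, rotZ_zero]
        exact left_inv_eq_right_inv h1 h2 }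
  have hS : Dense (S : Set ℝ) := dense_of_arccos_mem S ⟨1, by rw [repMat_one, rotZ_two_pi]⟩
    ⟨w * u, by rw [repMat_mul, hw, hu, halfTurn_mul_eq_rotZ]⟩
  have hmem : ∀ p : ℝ × ℝ × ℝ, rotZ p.1 * (swapYZ * rotZ p.2.1 * swapYZ) * rotZ p.2.2 ∈
      specialOrthogonalGroup (Fin 3) ℝ := fun p => mul_mem (mul_mem (rotZ_mem _)
    (mul_mem (mul_mem swapYZ_mem (rotZ_mem _)) swapYZ_mem)) (rotZ_mem _)
  let E : ℝ × ℝ × ℝ → PO3 ℝ := fun p => QuotientGroup.mk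
    (⟨_, (mem_specialOrthogonalGroup_iff.1 (hmem p)).1⟩ : O3 ℝ)
  have hE : ∀ p, (PO3.equivSO (E p)).1
      = rotZ p.1 * (swapYZ * rotZ p.2.1 * swapYZ) * rotZ p.2.2 := by
    intro p
    change (rotZ p.1 * (swapYZ * rotZ p.2.1 * swapYZ) * rotZ p.2.2).det •
      (rotZ p.1 * (swapYZ * rotZ p.2.1 * swapYZ) * rotZ p.2.2) = _
    rw [det_of_mem (hmem p), one_smul]
  have hcont : Continuous E := by
    refine continuous_quotient_mk'.comp (Continuous.subtype_mk ?_ _)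
    have := continuous_rotZ
    fun_prop
  have hsurj : Function.Surjective E := by
    intro g
    obtain ⟨α, β, γ, h⟩ := exists_euler (PO3.equivSO g).2
    refine ⟨(α, β, γ), PO3.equivSO.injective (Subtype.ext ?_)⟩
    rw [hE, h]
  have hdense := hsurj.denseRange.dense_image hcont (hS.prod (hS.prod hS))
  refine hdense.mono ?_
  rintro _ ⟨⟨α, β, γ⟩, ⟨⟨a, ha⟩, ⟨b, hb⟩, ⟨d, hd⟩⟩, rfl⟩
  refine ⟨a * (v * b * v) * d, PO3.equivSO.injective (Subtype.ext ?_)⟩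
  rw [hE]
  change repMat ρ _ = _
  rw [repMat_mul, repMat_mul, repMat_mul, repMat_mul, hv, halfTurn_diag_one, ha, hb, hd]

end Density

/-! ### The rational point, and the assembly of the theorem -/

open Matrix in
theorem Config.isUnit_map_nondegenerate {m : ℕ} {c : Config m} {B : Type} [CommRing B]
    {x : Fin m → B} (hc : ∀ t ∈ c.terms, VecTerm.Nonvanishing t) (f : B →+* ℚ) :
    IsUnit (f (nondegenerate c x)) := by
  rw [nondegenerate, map_prod, IsUnit.prod_iff]
  intro t ht
  have : f (t.eval x ⬝ᵥ t.eval x) = (f ∘ t.eval x) ⬝ᵥ (f ∘ t.eval x) :=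
    RingHom.map_dotProduct f _ _
  rw [this, VecTerm.map_eval]
  exact (hc t ht).isUnit_eval _

open Matrix in
theorem Config.IsSolution.denseRange_rep {m : ℕ} {c : Config m} {x : Fin m → ℝ}
    (hx : c.IsSolution x) {t : VecTerm m} (ht : t ∈ c.terms) (hte : t.eval x = ![1, 2, 0]) :
    DenseRange hx.rep := by
  have hu : repMat hx.rep (c.gen (.axis 0)) = halfTurn (axisVec 0) := hx.repMat_rep (c.axis_mem 0)
  have hv : repMat hx.rep (c.gen (.diag 1)) = halfTurn (diagVec 1) := hx.repMat_rep (c.diag_mem 1)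
  have hw : repMat hx.rep (c.gen t) = halfTurn ![1, 2, 0] := by rw [hx.repMat_rep ht, hte]
  exact denseRange_of_halfTurns hx.rep hu hv hw

end KM

end

theorem theorem4p1 (B : Type) [CommRing B] [Algebra ℚ B] [Algebra.FiniteType ℚ B]
    (x : B →ₐ[ℚ] ℚ) :
    ∃ (X' : (Spec (CommRingCat.of B)).Opens)
      (n : ℕ) (M : CoxeterMatrix (Fin n)) (ρc : M.Group →* KM.PO3 ℝ),
      -- the edges of the Coxeter graph (pairs with `M i j ≠ 0`) have label 2 or 4
      (∀ i j, i ≠ j → M i j = 0 ∨ M i j = 2 ∨ M i j = 4) ∧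
      KM.StandingAssumption M ∧
      DenseRange ρc ∧
      -- `X_o` is an open subscheme of the character scheme
      ∃ Xo : (KM.charScheme M.Group).Opens,
        (Xo : Set (KM.charScheme M.Group)) = KM.charOSet M ∧
        -- `X'` is isomorphic over `ℚ` to an open subscheme `S` of `X_o`, with `x ↦ [ρc]`
        (∃ (S : (KM.charScheme M.Group).Opens) (f : X'.toScheme ≅ S.toScheme)
          (x' : Spec (CommRingCat.of ℚ) ⟶ X'.toScheme),
          S ≤ Xo ∧
          f.hom ≫ S.ι ≫ KM.charSchemeToSpec M.Group =
            X'.ι ≫ Spec.map (CommRingCat.ofHom (algebraMap ℚ B)) ∧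
          x' ≫ X'.ι = Spec.map (CommRingCat.ofHom x.toRingHom) ∧
          Spec.map (CommRingCat.ofHom (algebraMap ℚ ℂ)) ≫ x' ≫ f.hom ≫ S.ι =
            KM.homPoint (KM.complexify ρc) ≫ KM.quotientMap M.Group) ∧
        -- the action on `Hom_o` has a cross-section containing `ρc`
        ∃ (Sc : Scheme.{0}) (ι : Sc ⟶ (KM.homO M).toScheme),
          KM.IsCrossSection M Xo ι ∧
          ∃ s : Spec (CommRingCat.of ℂ) ⟶ Sc,
            s ≫ ι ≫ (KM.homO M).ι = KM.homPoint (KM.complexify ρc) := by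
  obtain ⟨m, c, y, hnv, hrel, hext, huniv, t, ht, hte⟩ := KM.exists_config B
  have hD := KM.Config.isSolution_of_isUnit
    (algebraMap B (Localization.Away (KM.Config.nondegenerate c y)))
    (IsLocalization.Away.algebraMap_isUnit _) hrel
  obtain ⟨Φ, hΦ, hΦe⟩ := KM.Config.exists_openImmersion hext huniv hD
  -- The rational point lies in the nondegenerate locus, so x factors through the localization.
  have hx : IsUnit (x.toRingHom (KM.Config.nondegenerate c y)) :=
    KM.Config.isUnit_map_nondegenerate hnv x.toRingHom
  obtain ⟨x', hx'⟩ : ∃ x' : Localization.Away (KM.Config.nondegenerate c y) →ₐ[ℚ] ℚ,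
      x'.comp (IsScalarTower.toAlgHom ℚ B _) = x :=
    ⟨(IsLocalization.Away.lift _ hx).toRatAlgHom,
      AlgHom.ext fun b => IsLocalization.Away.lift_eq _ hx b⟩
  -- The representation attached to x is defined over ℚ and read over ℝ.
  obtain ⟨ρc, hρc⟩ : ∃ ρc, ρc = (hD.map ((Algebra.ofId ℚ ℝ).comp x' : _ →+* ℝ)).rep := ⟨_, rfl⟩
  have hρ : KM.pointOf ρc = (Algebra.ofId ℚ ℝ).comp
      (x'.comp (Φ.comp (Ideal.Quotient.mkₐ ℚ c.sliceIdeal))) := by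
    rw [hρc, ← hD.map_rep, KM.pointOf_map, hΦe, AlgHom.comp_assoc]
  obtain ⟨X', h⟩ := c.isSlice.assemble (fun p => c.hasLabels.injOnElementary_repAt_iff p) x
    (IsScalarTower.toAlgHom ℚ B _)
    (IsOpenImmersion.of_isLocalization (KM.Config.nondegenerate c y)) Φ hΦ x' hx' ρc hρ
  refine ⟨X', _, c.coxeter, ρc, c.hasLabels,
    KM.IsSlice.standingAssumption c.hasLabels c.isSlice, ?_, h⟩
  rw [hρc]
  exact KM.Config.IsSolution.denseRange_rep _ ht (hte ℝ _)
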